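/- **Model.** Fix a path loss exponent $\alpha>0$ with path loss $l(s)=s^{-\alpha}$, an SINR requirement $\beta>0$, a threshold $\delta>0$, an initial power update $\Delta>0$, a link length $d>0$, and a largest realizable power increase $M\in[\delta,\infty]$ ($M=\infty$ means that there is no limit). Let $\nu$ be a probability measure on the circle $\{w\in\mathbb R^2:\|w\|=d\}$. A user $i$ has its transmitter at a point $t_i\in\mathbb R^2$ and its receiver at $t_i+w_i$; put $d_{ji}=\|t_j-(t_i+w_i)\|$, so that $d_{ii}=d$. The users form a random set $\Phi$ such that the pairs $(t_i,w_i)$ are a Poisson point process on $\mathbb R^2\times\mathbb R^2$ with intensity measure $\lambda\,\mathrm{Leb}\otimes\nu$; that is, the transmitters form a homogeneous planar Poisson point process of density $\lambda\ge 0$, and the displacements to the receivers are independent marks with law $\nu$. **Propagation of change.** Let a user $x\in\Phi$ raise its power by $\Delta$. Let $q^n_i$ be the increase of the power of user $i$ after round $n$. Then $q^n_x=\Delta$ for all $n\ge0$; and for $i\ne x$, $q^0_i=0$ and $$q^{n+1}_i=\begin{cases}\min(v^{n}_i,M)&\text{if } v^{n}_i>\delta,\\ 0&\text{otherwise,}\end{cases}\qquad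 v^{n}_i=\beta\sum_{j\in\Phi,\,j\neq i}\frac{l(d_{ji})}{l(d_{ii})}\,q^n_j ,$$ where $v^n_i$ is the increase of power by which user $i$ restores its SINR requirement with minimal power. Let $\mathcal A(x)$ be the set of all users $i\in\Phi$, $i\neq x$, with $q^n_i\ne0$ for some $n$. **Theorem.** There is a critical density $\lambda_c\in[0,\infty)$, which depends only on $\alpha,\beta,\delta,\Delta,M,d,\nu$, such that * for $\lambda<\lambda_c$ the propagation of change is almost surely finite: almost surely, $\mathcal A(x)$ is finite for every user $x\in\Phi$; * for $\lambda>\lambda_c$ the propagation of change is almost surely infinite: almost surely, there is a user $x\in\Phi$ for which $\mathcal A(x)$ is infinite. Moreover, $\lambda_c>0$ whenever $\alpha>2$ and $M<\infty$. -/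

import Mathlib

open MeasureTheory ProbabilityTheory
open scoped NNReal ENNReal

/-- The Euclidean plane. -/
abbrev Plane := EuclideanSpace ℝ (Fin 2)

/-- A random set `Φ` of points of `E` is a Poisson point process with intensity measure `m`:
the number of points in a measurable set `B` with `m B < ∞` is Poisson distributed with mean `m B`,
and the numbers of points in pairwise disjoint measurable sets are independent. -/
structure IsPoissonPointProcess {Ω E : Type*} [MeasurableSpace Ω] [MeasurableSpace E]
    (P : Measure Ω) (m : Measure E) (Φ : Ω → Set E) : Prop where
  measurable_count : ∀ B : Set E, MeasurableSet B → Measurable fun ω => (Φ ω ∩ B).encard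
  law_count : ∀ B : Set E, MeasurableSet B → m B ≠ ∞ →
    P.map (fun ω => (Φ ω ∩ B).encard) =
      (poissonMeasure (m B).toNNReal).map fun k : ℕ => (k : ℕ∞)
  indep_count : ∀ (k : ℕ) (B : Fin k → Set E), (∀ a, MeasurableSet (B a)) →
    Pairwise (fun a b => Disjoint (B a) (B b)) →
      iIndepFun (fun a ω => (Φ ω ∩ B a).encard) P

/-- A user: the location of its transmitter, and the displacement from its transmitter to its
receiver. -/
abbrev User := Plane × Plane

/-- The location of the transmitter of a user. -/
def User.tx (i : User) : Plane := i.1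

/-- The location of the receiver of a user. -/
def User.rx (i : User) : Plane := i.1 + i.2

/-- The parameters of the power control rule. -/
structure PowerControl where
  /-- the path loss exponent `α` -/
  exponent : ℝ
  /-- the SINR requirement `β`, common to all users -/
  sinr : ℝ≥0
  /-- the threshold `δ`: a user changes its power only if it needs an increase above `δ` -/
  threshold : ℝ≥0
  /-- the power update `Δ` of the initial user -/
  update : ℝ≥0
  /-- the largest power increase `M` that a user can realize; `M = ∞` means no limit -/
  maxIncrease : ℝ≥0∞

namespace PowerControl

variable (c : PowerControl)

/-- The path loss `l(s) = 1 / s ^ α` at distance `s ≥ 0`. -/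
noncomputable def pathLoss (s : ℝ) : ℝ≥0∞ := (ENNReal.ofReal s ^ c.exponent)⁻¹

/-- `β l(d_ji) / l(d_ii)`, where `d_ji` is the distance from transmitter `j` to receiver `i`: the
increase of the minimal power of user `i` that is caused by a unit power increase of user `j`. -/
noncomputable def gain (j i : User) : ℝ≥0∞ :=
  c.sinr * c.pathLoss (dist j.tx i.rx) / c.pathLoss (dist i.tx i.rx)

open Classical in
/-- The increase of the minimal power that satisfies the SINR requirement of user `i`, when the
other users `j` of the network `S` have increased their powers by `q j`. As the minimal power
`β (N₀ + ∑ j ≠ i, l(d_ji) p_j) / l(d_ii)` is affine in the powers, neither the noise `N₀` nor the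
old powers enter. -/
noncomputable def requiredIncrease (S : Set User) (q : User → ℝ≥0∞) (i : User) : ℝ≥0∞ :=
  ∑' j : S, if (j : User) = i then 0 else c.gain j i * q j

open Classical in
/-- The power increase of user `i` in the network `S` after round `n`, when user `x` has increased
its power by `Δ`. In each round, every other user whose required increase exceeds the threshold `δ`
realizes it (up to the limit `M`), and every other user keeps its old power. -/
noncomputable def powerIncrease (S : Set User) (x : User) : ℕ → User → ℝ≥0∞
  | 0, i => if i = x then (c.update : ℝ≥0∞) else 0
  | n + 1, i =>
    if i = x then (c.update : ℝ≥0∞)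
    else if (c.threshold : ℝ≥0∞) < c.requiredIncrease S (powerIncrease S x n) i then
      min (c.requiredIncrease S (powerIncrease S x n) i) c.maxIncrease
    else 0

/-- The users of the network `S`, other than `x`, whose power changes in some round as a consequence
of the update of user `x`. -/
def affected (S : Set User) (x : User) : Set User :=
  {i ∈ S | i ≠ x ∧ ∃ n, c.powerIncrease S x n i ≠ 0}

end PowerControl

/-! Poisson random measures, the Mecke equation, and percolation of power control. -/

/-! The network is treated as the random measure that puts unit mass on every user. The rounds of
power control become integrals against this measure, and the event that some update reaches
infinitely many users is measurable (`measurableSet_percolating`), increasing when users are added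
(`percolating_mono`) and translation invariant.

The Poisson law is handled through the Mecke equation: `exists_isMecke` constructs a solution and
`IsMecke.unique` identifies it, so superposition, independence over disjoint regions and translation
invariance follow by exhibiting solutions. Independence of distant strips gives a zero-one law
(`IsMecke.zero_or_one`), and superposition makes percolation monotone in the density. The critical
density is the infimum of the densities that percolate almost surely; `sInf_dichotomy` gives the two
regimes.

Finiteness of the critical density (`exists_poissonLaw_percolating`): call a unit square good if it
holds at least `N` users. If all users of a good square have raised their power by at least `min δ
Δ`, then for large `N` they push every user of the neighbouring squares above the threshold. At high
density bad squares are rare and independent. A hierarchical block argument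
(`Block.infinite_of_good`) takes the place of contour counting: a block is good if at most one of
its nine subblocks is bad, and the probability of a bad block decays doubly exponentially. So with
positive probability an update near a suitable place ignites the square at the origin and spreads
forever; the Mecke equation turns this into a positive expected number of percolating users.

Positivity for `α > 2` and `M < ∞` (`poissonLaw_percolating_eq_zero`): all increases are at most
`max M Δ`, so a reached user feels a total influence of at least one from `x` and the users reached
before. Each influence may be truncated at one, since users have unit mass and one influence of size
at least one suffices alone. The truncated influence has a finite integral `I`. By the Mecke
equation, the expected number reached by round `n` satisfies `E (n + 1) ≤ λ I (1 + E n)`, which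
stays bounded by one when `λ I ≤ 1 / 2`. -/

/-! ### Locally finite measures and measurable integration against them. -/

/-- The users whose transmitter lies in the unit square with lower left corner `z`. -/
def userCell (z : ℤ × ℤ) : Set User := {i | ⌊i.1 0⌋ = z.1 ∧ ⌊i.1 1⌋ = z.2}

lemma measurableSet_userCell (z : ℤ × ℤ) : MeasurableSet (userCell z) := by
  have h (k : Fin 2) (n : ℤ) : MeasurableSet {i : User | ⌊i.1 k⌋ = n} := by
    have : Measurable fun i : User => ⌊i.1 k⌋ :=
      Int.measurable_floor.comp (by fun_prop)
    exact this (measurableSet_singleton n)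
  exact (h 0 z.1).inter (h 1 z.2)

lemma iUnion_userCell : ⋃ z, userCell z = Set.univ := by
  refine Set.eq_univ_of_forall fun i => Set.mem_iUnion.2 ⟨(⌊i.1 0⌋, ⌊i.1 1⌋), rfl, rfl⟩

lemma pairwise_disjoint_userCell : Pairwise (Function.onFun Disjoint userCell) := by
  intro z z' h
  refine Set.disjoint_left.2 fun i hi hi' => h (Prod.ext ?_ ?_)
  · exact hi.1.symm.trans hi'.1
  · exact hi.2.symm.trans hi'.2

/-- A measure on users that is finite on every unit square. -/
def LocFin (μ : Measure User) : Prop := ∀ z, μ (userCell z) ≠ ∞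

lemma measurableSet_locFin : MeasurableSet {μ | LocFin μ} := by
  simp only [LocFin, Set.ofPred_forall]
  exact MeasurableSet.iInter fun z =>
    (Measure.measurable_coe (measurableSet_userCell z)) (measurableSet_singleton ∞).compl

/-- The identity kernel on locally finite measures, set to zero elsewhere. -/
noncomputable def pts : Kernel (Measure User) User := by
  classical exact Kernel.piecewise measurableSet_locFin ⟨id, measurable_id⟩ 0

lemma pts_of_locFin {μ : Measure User} (h : LocFin μ) : pts μ = μ := by
  classical
  simp only [pts, Kernel.piecewise_apply]
  exact if_pos h

lemma pts_of_not_locFin {μ : Measure User} (h : ¬ LocFin μ) : pts μ = 0 := by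
  classical
  simp only [pts, Kernel.piecewise_apply]
  exact if_neg h

lemma measure_eq_tsum_userCell (μ : Measure User) {B : Set User} (hB : MeasurableSet B) :
    μ B = ∑' z, μ (B ∩ userCell z) := by
  rw [← measure_iUnion (fun z z' h => (pairwise_disjoint_userCell h).mono
    Set.inter_subset_right Set.inter_subset_right) (fun z => hB.inter (measurableSet_userCell z)),
    ← Set.inter_iUnion, iUnion_userCell, Set.inter_univ]

/-- s-finiteness is what makes integrals against a random measure jointly measurable. The pieces are
indexed by a unit square and the integer part of its mass, because a finite kernel has to be bounded
uniformly over all measures. -/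
instance : IsSFiniteKernel pts := by
  classical
  have hs (p : (ℤ × ℤ) × ℕ) : MeasurableSet
      {μ : Measure User | LocFin μ ∧ (p.2 : ℝ≥0∞) ≤ μ (userCell p.1) ∧
        μ (userCell p.1) < p.2 + 1} := by
    have h := Measure.measurable_coe (measurableSet_userCell p.1)
    exact measurableSet_locFin.inter ((measurableSet_le measurable_const h).inter
      (measurableSet_lt h measurable_const))
  let κ (p : (ℤ × ℤ) × ℕ) : Kernel (Measure User) User :=
    Kernel.piecewise (hs p) (Kernel.restrict ⟨id, measurable_id⟩ (measurableSet_userCell p.1)) 0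
  have hκ (p) : IsFiniteKernel (κ p) := by
    refine ⟨⟨p.2 + 1, by simp, fun μ => ?_⟩⟩
    simp only [κ, Kernel.piecewise_apply']
    split_ifs with h
    · rw [Kernel.restrict_apply' _ _ _ MeasurableSet.univ, Set.univ_inter]
      exact h.2.2.le
    · simp
  have : pts = Kernel.sum κ := by
    ext μ B hB
    rw [Kernel.sum_apply' _ _ hB]
    by_cases h : LocFin μ
    · rw [pts_of_locFin h, measure_eq_tsum_userCell μ hB, ENNReal.tsum_prod (f := fun z k => κ (z, k) μ B)]
      refine tsum_congr fun z => ?_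
      have hz := h z
      set c := μ (userCell z) with hc
      lift c to ℝ≥0 using hz with c'
      rw [tsum_eq_single ⌊c'⌋₊]
      · simp only [κ, Kernel.piecewise_apply']
        rw [if_pos]
        · rw [Kernel.restrict_apply' _ _ _ hB]; rfl
        · refine ⟨h, ?_, ?_⟩
          · rw [← hc]; exact_mod_cast Nat.floor_le zero_le
          · rw [← hc]; exact_mod_cast Nat.lt_floor_add_one c'
      · intro k hk
        simp only [κ, Kernel.piecewise_apply']
        rw [if_neg]
        · simp
        · rintro ⟨-, h1, h2⟩
          simp only [← hc] at h1 h2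
          refine hk ((Nat.floor_eq_iff zero_le).2 ⟨by exact_mod_cast h1, by exact_mod_cast h2⟩).symm
    · rw [pts_of_not_locFin h]
      symm
      simp only [Measure.coe_zero, Pi.zero_apply, ENNReal.tsum_eq_zero]
      intro p
      simp only [κ, Kernel.piecewise_apply']
      rw [if_neg]
      · simp
      · exact fun h' => h h'.1
  rw [this]
  infer_instance

lemma measurable_lintegral_pts {α : Type*} [MeasurableSpace α] {f : α → Measure User}
    (hf : Measurable f) {F : α → User → ℝ≥0∞} (hF : Measurable (Function.uncurry F)) :
    Measurable fun a => ∫⁻ x, F a x ∂(pts (f a)) := by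
  have := hF.lintegral_kernel_prod_right (κ := pts.comap f hf)
  simpa using this

@[fun_prop]
lemma Measurable.measure_add {α : Type*} [MeasurableSpace α] {f g : α → Measure User}
    (hf : Measurable f) (hg : Measurable g) : Measurable fun a => f a + g a := by
  refine Measure.measurable_of_measurable_coe _ fun s hs => ?_
  simp only [Measure.coe_add, Pi.add_apply]
  exact ((Measure.measurable_coe hs).comp hf).add ((Measure.measurable_coe hs).comp hg)

@[fun_prop]
lemma Measurable.measure_dirac {α : Type*} [MeasurableSpace α] {f : α → User}
    (hf : Measurable f) : Measurable fun a => Measure.dirac (f a) :=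
  Measure.measurable_dirac.comp hf

lemma Measurable.uncurry_apply {α β γ δ : Type*} [MeasurableSpace α] [MeasurableSpace β]
    [MeasurableSpace γ] [MeasurableSpace δ] {F : α → β → γ} (hF : Measurable (Function.uncurry F))
    {f : δ → α} {g : δ → β} (hf : Measurable f) (hg : Measurable g) :
    Measurable fun a => F (f a) (g a) :=
  hF.comp (hf.prodMk hg)

lemma LocFin.add {μ ν : Measure User} (hμ : LocFin μ) (hν : LocFin ν) : LocFin (μ + ν) :=
  fun z => by simp [hμ z, hν z]

lemma locFin_of_finite (μ : Measure User) [IsFiniteMeasure μ] : LocFin μ :=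
  fun _ => measure_ne_top _ _

lemma LocFin.mono {μ ν : Measure User} (hν : LocFin ν) (h : μ ≤ ν) : LocFin μ :=
  fun z => ne_top_of_le_ne_top (hν z) (h _)

lemma pts_add_dirac {μ : Measure User} (h : LocFin μ) (x : User) :
    pts (μ + Measure.dirac x) = pts μ + Measure.dirac x := by
  rw [pts_of_locFin h, pts_of_locFin (h.add (locFin_of_finite _))]

/-! ### The Mecke equation for a finite intensity measure. -/

/-- The law `Q` of a locally finite random measure satisfies the Mecke equation with intensity
measure `m`. -/
structure IsMecke (m : Measure User) (Q : Measure (Measure User)) : Prop where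
  locFin : ∀ᵐ μ ∂Q, LocFin μ
  mecke : ∀ F : User → Measure User → ℝ≥0∞, Measurable (Function.uncurry F) →
    ∫⁻ μ, ∫⁻ x, F x μ ∂(pts μ) ∂Q = ∫⁻ x, ∫⁻ μ, F x (μ + Measure.dirac x) ∂Q ∂m

/-- The law of the sum of the point masses at `n` points, integrated against `m ^ n`. -/
noncomputable def sumDirac (m : Measure User) : ℕ → Measure (Measure User)
  | 0 => Measure.dirac 0
  | n + 1 => (m.prod (sumDirac m n)).map fun p => p.2 + Measure.dirac p.1

section
variable (m : Measure User)

lemma ae_locFin_sumDirac (n : ℕ) : ∀ᵐ μ ∂(sumDirac m n), LocFin μ := by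
  induction n with
  | zero =>
    rw [sumDirac, ae_dirac_iff measurableSet_locFin]
    exact locFin_of_finite _
  | succ n ih =>
    rw [sumDirac, ae_map_iff (by fun_prop) measurableSet_locFin]
    have := (Measure.quasiMeasurePreserving_snd (μ := m) (ν := sumDirac m n)).ae ih
    filter_upwards [this] with p hp
    exact hp.add (locFin_of_finite _)

variable [IsFiniteMeasure m]

instance (n : ℕ) : IsFiniteMeasure (sumDirac m n) := by
  induction n with
  | zero => rw [sumDirac]; infer_instance
  | succ n ih => rw [sumDirac]; infer_instance

lemma sumDirac_univ (n : ℕ) : sumDirac m n Set.univ = m Set.univ ^ n := by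
  induction n with
  | zero => simp [sumDirac]
  | succ n ih =>
    rw [sumDirac, Measure.map_apply (by fun_prop) MeasurableSet.univ, Set.preimage_univ,
      ← Set.univ_prod_univ, Measure.prod_prod, ih, pow_succ']

lemma lintegral_sumDirac_succ (n : ℕ) {F : Measure User → ℝ≥0∞} (hF : Measurable F) :
    ∫⁻ μ, F μ ∂(sumDirac m (n + 1)) =
      ∫⁻ y, ∫⁻ μ, F (μ + Measure.dirac y) ∂(sumDirac m n) ∂m := by
  rw [sumDirac, lintegral_map hF (by fun_prop), lintegral_prod]
  exact (hF.comp (by fun_prop)).aemeasurable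

/-- The factor counts the choices of the distinguished point among exchangeable ones. In the
induction the last point `y` is split off: the distinguished point is either `y` itself or one of
the others, to which the induction hypothesis applies. -/
lemma mecke_sumDirac (n : ℕ) : ∀ F : User → Measure User → ℝ≥0∞, Measurable (Function.uncurry F) →
    ∫⁻ μ, ∫⁻ x, F x μ ∂(pts μ) ∂(sumDirac m (n + 1)) =
      (n + 1) * ∫⁻ x, ∫⁻ μ, F x (μ + Measure.dirac x) ∂(sumDirac m n) ∂m := by
  induction n with
  | zero =>
    intro F hF
    have h0 : pts 0 = 0 := pts_of_locFin (locFin_of_finite 0)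
    rw [lintegral_sumDirac_succ]
    · simp only [sumDirac, Nat.cast_zero, zero_add, one_mul]
      refine lintegral_congr fun y => ?_
      rw [lintegral_dirac', lintegral_dirac']
      · have := pts_add_dirac (locFin_of_finite 0) y
        rw [this, h0, zero_add, lintegral_dirac]
      · exact hF.uncurry_apply (by fun_prop) (by fun_prop)
      · refine (measurable_lintegral_pts (f := fun μ => μ + Measure.dirac y)
          (F := fun μ x => F x (μ + Measure.dirac y)) (by fun_prop) (hF.uncurry_apply (by fun_prop) (by fun_prop)))
    · exact measurable_lintegral_pts (F := fun μ x => F x μ) measurable_id (hF.comp measurable_swap)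
  | succ n ih =>
    intro F hF
    have hm : Measurable fun p : User × Measure User =>
        ∫⁻ x, F x (p.2 + Measure.dirac p.1) ∂(pts p.2) :=
      measurable_lintegral_pts (α := User × Measure User) (f := Prod.snd)
        (F := fun p x => F x (p.2 + Measure.dirac p.1)) measurable_snd (hF.uncurry_apply (by fun_prop) (by fun_prop))
    have hG : Measurable fun p : User × Measure User => F p.1 (p.2 + Measure.dirac p.1) :=
      hF.uncurry_apply (by fun_prop) (by fun_prop)
    rw [lintegral_sumDirac_succ]
    swap
    · exact measurable_lintegral_pts (F := fun μ x => F x μ) measurable_id (hF.comp measurable_swap)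
    have h1 : ∀ y, ∫⁻ μ, ∫⁻ x, F x (μ + Measure.dirac y) ∂(pts (μ + Measure.dirac y))
          ∂(sumDirac m (n + 1)) =
        (n + 1) * ∫⁻ x, ∫⁻ μ, F x (μ + Measure.dirac x + Measure.dirac y) ∂(sumDirac m n) ∂m
        + ∫⁻ μ, F y (μ + Measure.dirac y) ∂(sumDirac m (n + 1)) := by
      intro y
      rw [← ih (fun x μ => F x (μ + Measure.dirac y)) (hF.uncurry_apply (by fun_prop) (by fun_prop)),
        ← lintegral_add_left]
      · refine lintegral_congr_ae ?_
        filter_upwards [ae_locFin_sumDirac m (n + 1)] with μ hμ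
        rw [pts_add_dirac hμ, lintegral_add_measure, lintegral_dirac]
      · exact hm.comp (by fun_prop : Measurable fun μ : Measure User => (y, μ))
    simp_rw [h1]
    have hK : Measurable fun q : (User × User) × Measure User =>
        F q.1.2 (q.2 + Measure.dirac q.1.2 + Measure.dirac q.1.1) := hF.uncurry_apply (by fun_prop) (by fun_prop)
    have hK' : Measurable fun q : User × User => ∫⁻ μ,
        F q.2 (μ + Measure.dirac q.2 + Measure.dirac q.1) ∂(sumDirac m n) :=
      hK.lintegral_prod_right'
    rw [lintegral_add_left, lintegral_const_mul]
    · rw [lintegral_lintegral_swap hK'.aemeasurable]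
      have : ∀ x, ∫⁻ y, ∫⁻ μ, F x (μ + Measure.dirac x + Measure.dirac y) ∂(sumDirac m n) ∂m =
          ∫⁻ μ, F x (μ + Measure.dirac x) ∂(sumDirac m (n + 1)) := by
        intro x
        rw [lintegral_sumDirac_succ m n (F := fun μ => F x (μ + Measure.dirac x))
          (hF.uncurry_apply (by fun_prop) (by fun_prop))]
        simp_rw [add_right_comm]
      simp_rw [this]
      push_cast
      ring
    · exact hK'.lintegral_prod_right'
    · exact (hK'.lintegral_prod_right').const_mul _

/-- The Mecke equation for the superposition of a Poisson number of independent points. -/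
theorem exists_isMecke_of_finite :
    ∃ Q : Measure (Measure User), IsProbabilityMeasure Q ∧ IsMecke m Q := by
  set r := (m Set.univ).toNNReal with hr
  have hr' : m Set.univ = r := (ENNReal.coe_toNNReal (measure_ne_top _ _)).symm
  -- The powers `r ^ n` of the Poisson weights are already the total masses of `sumDirac m n`. The
  -- recursion `hw` cancels the factor `n + 1` of `mecke_sumDirac`.
  let w (n : ℕ) : ℝ≥0∞ := ENNReal.ofReal (Real.exp (-r) / n.factorial)
  have hw (n : ℕ) : w (n + 1) * (n + 1) = w n := by
    have : ((n : ℝ≥0∞) + 1) = ENNReal.ofReal (n + 1) := by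
      rw [ENNReal.ofReal_add (by positivity) zero_le_one]; simp
    simp only [w]
    rw [this, ← ENNReal.ofReal_mul (by positivity), Nat.factorial_succ]
    congr 1
    push_cast
    field_simp
  refine ⟨Measure.sum fun n => w n • sumDirac m n, ⟨?_⟩, ?_, ?_⟩
  · rw [Measure.sum_apply _ MeasurableSet.univ]
    simp only [Measure.smul_apply, sumDirac_univ, smul_eq_mul, hr']
    have h := hasSum_one_poissonMeasure r
    rw [← ENNReal.ofReal_one, ← h.tsum_eq, ENNReal.ofReal_tsum_of_nonneg (fun n => by positivity)
      h.summable]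
    refine tsum_congr fun n => ?_
    have : (r : ℝ≥0∞) = ENNReal.ofReal r := by simp
    rw [this, ← ENNReal.ofReal_pow (by positivity), ← ENNReal.ofReal_mul (by positivity)]
    congr 1
    ring
  · rw [Measure.ae_sum_iff]
    intro n
    exact Measure.ae_smul_measure (ae_locFin_sumDirac m n) _
  · intro F hF
    have h0 : pts 0 = 0 := pts_of_locFin (locFin_of_finite 0)
    have hM : Measurable fun p : User × Measure User => F p.1 (p.2 + Measure.dirac p.1) :=
      hF.uncurry_apply (by fun_prop) (by fun_prop)
    have hM' (n : ℕ) : Measurable fun x => ∫⁻ μ, F x (μ + Measure.dirac x) ∂(sumDirac m n) :=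
      hM.lintegral_prod_right'
    simp_rw [lintegral_sum_measure, lintegral_smul_measure, smul_eq_mul]
    rw [lintegral_tsum]
    · rw [tsum_eq_zero_add' ENNReal.summable]
      simp_rw [mecke_sumDirac m _ F hF]
      simp only [sumDirac]
      rw [lintegral_dirac']
      · rw [h0, lintegral_zero_measure, mul_zero, zero_add]
        refine tsum_congr fun n => ?_
        rw [← mul_assoc, hw, lintegral_const_mul _ (hM' n)]
      · exact measurable_lintegral_pts (F := fun μ x => F x μ) measurable_id
          (hF.comp measurable_swap)
    · exact fun n => ((hM' n).const_mul _).aemeasurable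

end

/-! ### The law of the counts, derived from the Mecke equation. -/

lemma measurable_measure_apply {α : Type*} [MeasurableSpace α] {f : α → Measure User}
    (hf : Measurable f) {B : Set User} (hB : MeasurableSet B) : Measurable fun a => f a B :=
  (Measure.measurable_coe hB).comp hf

lemma measurable_measure_sum {ι : Type*} [Countable ι] :
    Measurable fun f : ι → Measure User => Measure.sum f := by
  refine Measure.measurable_of_measurable_coe _ fun s hs => ?_
  simp only [Measure.sum_apply _ hs]
  exact Measurable.tsum fun i => measurable_measure_apply (measurable_pi_apply i) hs

namespace IsMecke

variable {m m₁ m₂ : Measure User} {Q Q₁ Q₂ : Measure (Measure User)}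

/-- The Mecke equation for a product of indicators; the distribution of the counts is extracted from
this case. -/
lemma setLIntegral_apply (h : IsMecke m Q) {B : Set User} (hB : MeasurableSet B)
    {S : Set (Measure User)} (hS : MeasurableSet S) :
    ∫⁻ μ in S, μ B ∂Q = ∫⁻ x in B, Q {μ | μ + Measure.dirac x ∈ S} ∂m := by
  have key := h.mecke (fun x μ => B.indicator 1 x * S.indicator 1 μ)
    (((measurable_one.indicator hB).comp measurable_fst).mul
      ((measurable_one.indicator hS).comp measurable_snd))
  have e1 : ∫⁻ μ in S, μ B ∂Q =
      ∫⁻ μ, ∫⁻ x, B.indicator 1 x * S.indicator 1 μ ∂(pts μ) ∂Q := by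
    rw [← lintegral_indicator hS]
    refine lintegral_congr_ae ?_
    filter_upwards [h.locFin] with μ hμ
    rw [lintegral_mul_const _ (measurable_one.indicator hB), lintegral_indicator_one hB,
      pts_of_locFin hμ]
    by_cases hμS : μ ∈ S <;> simp [hμS]
  rw [e1, key, ← lintegral_indicator hB]
  refine lintegral_congr fun x => ?_
  by_cases hx : x ∈ B
  · have hS' : MeasurableSet {μ : Measure User | μ + Measure.dirac x ∈ S} :=
      (by fun_prop : Measurable fun μ : Measure User => μ + Measure.dirac x) hS
    simp only [hx, Set.indicator_of_mem, Pi.one_apply, one_mul]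
    rw [← lintegral_indicator_one hS']
    rfl
  · simp [hx]

lemma lintegral_apply (h : IsMecke m Q) [IsProbabilityMeasure Q] {B : Set User}
    (hB : MeasurableSet B) : ∫⁻ μ, μ B ∂Q = m B := by
  have := h.setLIntegral_apply hB MeasurableSet.univ
  simpa using this

lemma ae_apply_ne_top (h : IsMecke m Q) [IsProbabilityMeasure Q] {B : Set User}
    (hB : MeasurableSet B) (hm : m B ≠ ∞) : ∀ᵐ μ ∂Q, μ B ≠ ∞ := by
  have := ae_lt_top (measurable_measure_apply measurable_id hB) (by rw [← h.lintegral_apply hB] at hm; exact hm)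
  filter_upwards [this] with μ hμ using hμ.ne

/-- A new point raises the mass of `B` by one. So the integral of `μ B` over this event is governed
by the same event one level lower, which is null by induction and impossible below level zero; and
`μ B` is positive on the event. -/
lemma ae_apply_notMem_Ioo (h : IsMecke m Q) {B : Set User} (hB : MeasurableSet B) (k : ℕ) :
    ∀ᵐ μ ∂Q, ¬ ((k : ℝ≥0∞) < μ B ∧ μ B < (k : ℝ≥0∞) + 1) := by
  have hmeas := measurable_measure_apply (f := fun μ : Measure User => μ) measurable_id hB
  induction k with
  | zero =>
    have hS : MeasurableSet {μ : Measure User | ((0 : ℕ) : ℝ≥0∞) < μ B ∧ μ B < (0 : ℕ) + 1} :=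
      (measurableSet_lt measurable_const hmeas).inter (measurableSet_lt hmeas measurable_const)
    have := h.setLIntegral_apply hB hS
    rw [setLIntegral_eq_zero hB (f := fun x => Q {μ | μ + Measure.dirac x ∈ _})] at this
    · have h2 := (lintegral_eq_zero_iff hmeas).1 this
      have h3 := (ae_restrict_iff' hS).1 h2
      filter_upwards [h3] with μ hμ hc
      exact hc.1.ne' (by simpa using hμ hc)
    · intro x hx
      have : {μ : Measure User | μ + Measure.dirac x ∈
          {μ : Measure User | ((0 : ℕ) : ℝ≥0∞) < μ B ∧ μ B < (0 : ℕ) + 1}} = ∅ := by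
        ext μ
        simp [hB, hx]
      simp only [this, measure_empty, Pi.zero_apply]
  | succ k ih =>
    have hS : MeasurableSet
        {μ : Measure User | ((k + 1 : ℕ) : ℝ≥0∞) < μ B ∧ μ B < (k + 1 : ℕ) + 1} :=
      (measurableSet_lt measurable_const hmeas).inter (measurableSet_lt hmeas measurable_const)
    have := h.setLIntegral_apply hB hS
    rw [setLIntegral_eq_zero hB (f := fun x => Q {μ | μ + Measure.dirac x ∈ _})] at this
    · have h2 := (lintegral_eq_zero_iff hmeas).1 this
      have h3 := (ae_restrict_iff' hS).1 h2
      filter_upwards [h3] with μ hμ hc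
      exact (pos_of_gt hc.1).ne' (by simpa using hμ hc)
    · intro x hx
      refine measure_mono_null ?_ ih
      intro μ hμ
      simp only [Set.mem_ofPred_eq, Measure.coe_add, Pi.add_apply, Measure.dirac_apply' _ hB,
        Set.indicator_of_mem hx, Pi.one_apply, Nat.cast_add, Nat.cast_one] at hμ
      simp only [Set.mem_compl_iff, Set.mem_ofPred_eq, not_not]
      exact ⟨lt_of_add_lt_add_right hμ.1, lt_of_add_lt_add_right hμ.2⟩

lemma ae_exists_nat (h : IsMecke m Q) [IsProbabilityMeasure Q] {B : Set User}
    (hB : MeasurableSet B) (hm : m B ≠ ∞) : ∀ᵐ μ ∂Q, ∃ n : ℕ, μ B = (n : ℝ≥0∞) := by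
  filter_upwards [h.ae_apply_ne_top hB hm, ae_all_iff.2 (h.ae_apply_notMem_Ioo hB)] with μ h1 h2
  set c := μ B
  lift c to ℝ≥0 using h1 with c'
  refine ⟨⌊c'⌋₊, ?_⟩
  have h3 := h2 ⌊c'⌋₊
  by_contra h4
  refine h3 ⟨lt_of_le_of_ne ?_ (Ne.symm h4), ?_⟩
  · exact_mod_cast Nat.floor_le zero_le
  · exact_mod_cast Nat.lt_floor_add_one c'

section Counts

variable {ι : Type*} [Fintype ι] {C : ι → Set User}

lemma measurableSet_counts (hC : ∀ a, MeasurableSet (C a)) (n : ι → ℕ) :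
    MeasurableSet {μ : Measure User | ∀ b, μ (C b) = n b} := by
  simp only [Set.ofPred_forall]
  exact MeasurableSet.iInter fun b =>
    (measurable_measure_apply measurable_id (hC b)) (measurableSet_singleton _)

/-- On the event with one more point in `C a` the mass of `C a` is the constant `n a + 1`, and
removing a point of `C a` alters no other count. This recursion characterises independent Poisson
variables up to a constant. -/
lemma counts_succ [DecidableEq ι] (h : IsMecke m Q) (hC : ∀ a, MeasurableSet (C a))
    (hd : Pairwise fun a b => Disjoint (C a) (C b)) (n : ι → ℕ) (a : ι) :
    (n a + 1) * Q {μ | ∀ b, μ (C b) = (n + Pi.single a 1 : ι → ℕ) b} =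
      m (C a) * Q {μ | ∀ b, μ (C b) = n b} := by
  have hS := measurableSet_counts hC (n + Pi.single a 1)
  have key := h.setLIntegral_apply (hC a) hS
  have e1 : ∫⁻ μ in {μ : Measure User | ∀ b, μ (C b) = (n + Pi.single a 1 : ι → ℕ) b}, μ (C a) ∂Q =
      (n a + 1) * Q {μ | ∀ b, μ (C b) = (n + Pi.single a 1 : ι → ℕ) b} := by
    rw [setLIntegral_congr_fun (g := fun _ => (n a + 1 : ℝ≥0∞)) hS, setLIntegral_const]
    intro μ hμ
    simpa using hμ a
  have e2 : ∀ x ∈ C a, Q {μ | μ + Measure.dirac x ∈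
      {μ : Measure User | ∀ b, μ (C b) = (n + Pi.single a 1 : ι → ℕ) b}} =
      Q {μ | ∀ b, μ (C b) = n b} := by
    intro x hx
    congr 1
    ext μ
    simp only [Set.mem_ofPred_eq]
    refine forall_congr' fun b => ?_
    rcases eq_or_ne a b with rfl | hab
    · simp [hC, hx]
    · have : x ∉ C b := fun hb => Set.disjoint_left.1 (hd hab) hx hb
      simp [hC, this, Pi.single_eq_of_ne hab.symm]
  rw [← e1, key, setLIntegral_congr_fun (hC a) e2, setLIntegral_const, mul_comm]

end Counts

lemma poissonMeasure_succ (r : ℝ≥0) (k : ℕ) :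
    ((k : ℝ≥0∞) + 1) * poissonMeasure r {k + 1} = r * poissonMeasure r {k} := by
  rw [poissonMeasure_singleton, poissonMeasure_singleton]
  have h1 : ((k : ℝ≥0∞) + 1) = ENNReal.ofReal (k + 1) := by
    rw [ENNReal.ofReal_add (by positivity) zero_le_one]; simp
  have h2 : (r : ℝ≥0∞) = ENNReal.ofReal r := by simp
  rw [h1, h2, ← ENNReal.ofReal_mul (by positivity), ← ENNReal.ofReal_mul (by positivity)]
  congr 1
  rw [Nat.factorial_succ]
  push_cast
  field_simp
  ring

lemma poissonMeasure_zero_ne_zero (r : ℝ≥0) (k : ℕ) (h : k = 0) : poissonMeasure r {k} ≠ 0 := by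
  subst h
  rw [poissonMeasure_singleton]
  simp [Real.exp_pos]

/-- The numbers of points in disjoint sets are independent and Poisson distributed. -/
theorem map_counts (h : IsMecke m Q) [IsProbabilityMeasure Q] {ι : Type*} [Fintype ι]
    {C : ι → Set User} (hC : ∀ a, MeasurableSet (C a))
    (hd : Pairwise fun a b => Disjoint (C a) (C b)) (hm : ∀ a, m (C a) ≠ ∞) :
    Q.map (fun μ a => μ (C a)) =
      (Measure.pi fun a => poissonMeasure (m (C a)).toNNReal).map fun n a => (n a : ℝ≥0∞) := by
  classical
  set π := Measure.pi fun a => poissonMeasure (m (C a)).toNNReal with hπ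
  have hπs (n : ι → ℕ) : π {n} = ∏ a, poissonMeasure (m (C a)).toNNReal {n a} :=
    Measure.pi_singleton _ n
  set p : (ι → ℕ) → ℝ≥0∞ := fun n => Q {μ | ∀ b, μ (C b) = n b} with hp
  have hπ0 : π {0} ≠ 0 := by
    rw [hπs, Finset.prod_ne_zero_iff]
    exact fun a _ => poissonMeasure_zero_ne_zero _ _ rfl
  have hπsucc (n : ι → ℕ) (a : ι) : (n a + 1) * π {n + Pi.single a 1} = m (C a) * π {n} := by
    rw [hπs, hπs, ← Finset.mul_prod_erase _ _ (Finset.mem_univ a),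
      ← Finset.mul_prod_erase _ (fun b => poissonMeasure (m (C b)).toNNReal {n b})
        (Finset.mem_univ a), ← mul_assoc, ← mul_assoc]
    congr 1
    · have := poissonMeasure_succ (m (C a)).toNNReal (n a)
      rw [ENNReal.coe_toNNReal (hm a)] at this
      simpa using this
    · refine Finset.prod_congr rfl fun b hb => ?_
      simp [Pi.single_eq_of_ne (Finset.ne_of_mem_erase hb)]
  -- Both `p` and `π` obey the same recursion, so induction on the total number of points makes them
  -- proportional.
  set K := p 0 / π {0} with hK
  have hpK : ∀ N : ℕ, ∀ n : ι → ℕ, ∑ a, n a = N → p n = K * π {n} := by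
    intro N
    induction N with
    | zero =>
      intro n hn
      have : n = 0 := by
        ext a; exact (Finset.sum_eq_zero_iff.1 hn) a (Finset.mem_univ a)
      rw [this, hK, ENNReal.div_mul_cancel hπ0 (measure_ne_top _ _)]
    | succ N ih =>
      intro n hn
      obtain ⟨a, -, ha⟩ : ∃ a ∈ Finset.univ, n a ≠ 0 :=
        Finset.exists_ne_zero_of_sum_ne_zero (by omega)
      set n' : ι → ℕ := Function.update n a (n a - 1) with hn'
      have hnn : n = n' + Pi.single a 1 := by
        ext b
        rcases eq_or_ne b a with rfl | hb
        · simp [hn']; omega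
        · simp [hn', hb]
      have hN : ∑ b, n' b = N := by
        have : ∑ b, n b = ∑ b, n' b + 1 := by
          conv_lhs => rw [hnn]
          simp [Finset.sum_add_distrib]
        omega
      have h1 := h.counts_succ hC hd n' a
      rw [← hnn] at h1
      have h2 := hπsucc n' a
      rw [← hnn] at h2
      have h3 := ih n' hN
      have h4 : ((n' a : ℝ≥0∞) + 1) * p n = (n' a + 1) * (K * π {n}) := by
        calc ((n' a : ℝ≥0∞) + 1) * p n = m (C a) * p n' := h1
          _ = K * (m (C a) * π {n'}) := by rw [h3]; ring
          _ = _ := by rw [← h2]; ring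
      exact (ENNReal.mul_right_inj (by simp) (by finiteness)).1 h4
  set T : Measure User → ι → ℕ := fun μ a => ⌊(μ (C a)).toReal⌋₊ with hT
  have hTm : Measurable T := by
    refine measurable_pi_lambda _ fun a => ?_
    exact Nat.measurable_floor.comp
      (measurable_measure_apply measurable_id (hC a)).ennreal_toReal
  have hae : ∀ᵐ μ ∂Q, ∀ a, μ (C a) = (T μ a : ℝ≥0∞) := by
    rw [ae_all_iff]
    intro a
    filter_upwards [h.ae_exists_nat (hC a) (hm a)] with μ hμ
    obtain ⟨k, hk⟩ := hμ
    simp [hT, hk]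
  have hτ : Q.map T = K • π := by
    refine Measure.ext_of_singleton fun n => ?_
    rw [Measure.map_apply hTm (measurableSet_singleton n), Measure.smul_apply, smul_eq_mul,
      ← hpK _ n rfl]
    refine measure_congr ?_
    filter_upwards [hae] with μ hμ
    refine propext ?_
    change T μ = n ↔ ∀ b, μ (C b) = n b
    simp only [hμ, Nat.cast_inj]
    exact funext_iff
  have : IsProbabilityMeasure (Q.map T) := Measure.isProbabilityMeasure_map hTm.aemeasurable
  -- Both are probability measures, which fixes the factor.
  have hK1 : K = 1 := by
    have h1 : (Q.map T) Set.univ = 1 := measure_univ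
    rw [hτ] at h1
    simpa using h1
  rw [hK1, one_smul] at hτ
  rw [← hτ, Measure.map_map (by fun_prop) hTm]
  refine Measure.map_congr ?_
  filter_upwards [hae] with μ hμ
  ext a
  exact hμ a

end IsMecke

/-! ### Uniqueness of the law. -/

lemma measurable_of_measurable_apply_finite {m : Measure User} (hm : ∀ z, m (userCell z) ≠ ∞)
    {α : Type*} [MeasurableSpace α] {f : α → Measure User}
    (hf : ∀ B, MeasurableSet B → m B ≠ ∞ → Measurable fun a => f a B) : Measurable f := by
  refine Measure.measurable_of_measurable_coe _ fun B hB => ?_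
  simp_rw [fun a => measure_eq_tsum_userCell (f a) hB]
  refine Measurable.tsum fun z => hf _ (hB.inter (measurableSet_userCell z)) ?_
  exact ne_top_of_le_ne_top (hm z) (measure_mono Set.inter_subset_right)

/-- Overlapping sets are cut into the atoms of points that lie in exactly the sets indexed by `u`.
Only nonempty `u` are used, so each atom lies in some `B i` and has finite intensity. -/
lemma map_apply_eq_of_disjoint {m : Measure User} {Q₁ Q₂ : Measure (Measure User)}
    (h : ∀ (ι : Type) [Fintype ι] (C : ι → Set User), (∀ a, MeasurableSet (C a)) →
      Pairwise (fun a b => Disjoint (C a) (C b)) → (∀ a, m (C a) ≠ ∞) →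
      Q₁.map (fun μ a => μ (C a)) = Q₂.map (fun μ a => μ (C a)))
    {ι : Type} [Fintype ι] (B : ι → Set User) (hB : ∀ a, MeasurableSet (B a))
    (hm : ∀ a, m (B a) ≠ ∞) :
    Q₁.map (fun μ a => μ (B a)) = Q₂.map (fun μ a => μ (B a)) := by
  classical
  let C (u : {u : Finset ι // u.Nonempty}) : Set User := {x | ∀ i, x ∈ B i ↔ i ∈ u.1}
  have hC (u) : MeasurableSet (C u) := by
    simp only [C, Set.ofPred_forall]
    refine MeasurableSet.iInter fun i => ?_
    by_cases hi : i ∈ u.1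
    · simpa [hi] using hB i
    · have : {x : User | x ∈ B i ↔ i ∈ u.1} = (B i)ᶜ := by ext; simp [hi]
      rw [this]
      exact (hB i).compl
  have hd : Pairwise fun u v => Disjoint (C u) (C v) := by
    intro u v huv
    refine Set.disjoint_left.2 fun x hx hx' => huv (Subtype.ext (Finset.ext fun i => ?_))
    rw [← hx i, ← hx' i]
  have hsub (u : {u : Finset ι // u.Nonempty}) (i) (hi : i ∈ u.1) : C u ⊆ B i :=
    fun x hx => (hx i).2 hi
  have hfin (u) : m (C u) ≠ ∞ := by
    obtain ⟨i, hi⟩ := u.2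
    exact ne_top_of_le_ne_top (hm i) (measure_mono (hsub u i hi))
  have hsum (μ : Measure User) (i : ι) :
      μ (B i) = ∑ u : {u : Finset ι // u.Nonempty}, if i ∈ u.1 then μ (C u) else 0 := by
    rw [← Finset.sum_filter, ← measure_biUnion_finset]
    · congr 1
      ext x
      simp only [Finset.mem_filter, Finset.mem_univ, true_and, Set.mem_iUnion, exists_prop]
      constructor
      · intro hx
        refine ⟨⟨Finset.univ.filter fun j => x ∈ B j, ⟨i, by simpa using hx⟩⟩, by simpa using hx, ?_⟩
        intro j; simp
      · rintro ⟨u, hu, hx⟩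
        exact hsub u i hu hx
    · intro u _ v _ huv
      exact hd huv
    · exact fun u _ => hC u
  let g : ({u : Finset ι // u.Nonempty} → ℝ≥0∞) → ι → ℝ≥0∞ :=
    fun y i => ∑ u : {u : Finset ι // u.Nonempty}, if i ∈ u.1 then y u else 0
  have hg : Measurable g := by
    refine measurable_pi_lambda _ fun i => Finset.measurable_sum _ fun u _ => ?_
    by_cases hi : i ∈ u.1
    · simpa [hi] using measurable_pi_apply u
    · simp [hi]
  have hev : Measurable fun (μ : Measure User) u => μ (C u) :=
    measurable_pi_lambda _ fun u => measurable_measure_apply measurable_id (hC u)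
  have key (Q : Measure (Measure User)) :
      Q.map (fun μ a => μ (B a)) = (Q.map fun μ u => μ (C u)).map g := by
    rw [Measure.map_map hg hev]
    congr 1
    ext μ i
    exact hsum μ i
  rw [key, key, h _ C hC hd hfin]

/-- The law of a random measure is determined by the joint laws of its values on finitely many
disjoint sets of finite intensity. -/
theorem ext_of_disjoint_counts {m : Measure User} (hm : ∀ z, m (userCell z) ≠ ∞)
    {Q₁ Q₂ : Measure (Measure User)} [IsProbabilityMeasure Q₁] [IsProbabilityMeasure Q₂]
    (h : ∀ (ι : Type) [Fintype ι] (C : ι → Set User), (∀ a, MeasurableSet (C a)) →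
      Pairwise (fun a b => Disjoint (C a) (C b)) → (∀ a, m (C a) ≠ ∞) →
      Q₁.map (fun μ a => μ (C a)) = Q₂.map (fun μ a => μ (C a))) : Q₁ = Q₂ := by
  let 𝓒 := {B : Set User // MeasurableSet B ∧ m B ≠ ∞}
  let J : Measure User → 𝓒 → ℝ≥0∞ := fun μ B => μ B.1
  have hJ : Measurable J :=
    measurable_pi_lambda _ fun B => measurable_measure_apply measurable_id B.2.1
  -- Evaluations on sets of finite intensity already generate the σ-algebra, so the law is
  -- determined by its image under `J`.
  have hle : (inferInstance : MeasurableSpace (Measure User)) ≤ MeasurableSpace.comap J inferInstance := by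
    have : @Measurable _ _ (MeasurableSpace.comap J inferInstance) _ (id : Measure User → _) := by
      refine @measurable_of_measurable_apply_finite m hm _ (MeasurableSpace.comap J inferInstance)
        _ fun B hB hB' => ?_
      have h1 : @Measurable _ _ (MeasurableSpace.comap J inferInstance) _ J :=
        comap_measurable J
      exact (measurable_pi_apply (⟨B, hB, hB'⟩ : 𝓒)).comp h1
    intro s hs
    exact this hs
  have : IsProbabilityMeasure (Q₁.map J) := Measure.isProbabilityMeasure_map hJ.aemeasurable
  have : IsProbabilityMeasure (Q₂.map J) := Measure.isProbabilityMeasure_map hJ.aemeasurable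
  have hmap : Q₁.map J = Q₂.map J := by
    -- A finite measure on a product is determined by its finite dimensional marginals.
    refine IsProjectiveLimit.unique (P := fun I : Finset 𝓒 => (Q₁.map J).map I.restrict)
      (fun I => rfl) fun I => ?_
    have hr : Measurable (I.restrict : (𝓒 → ℝ≥0∞) → _) := by fun_prop
    rw [Measure.map_map hr hJ]
    refine Eq.trans ?_ (Measure.map_map hr hJ).symm
    exact (map_apply_eq_of_disjoint h (fun B : I => B.1.1) (fun B => B.1.2.1)
      (fun B => B.1.2.2)).symm
  ext s hs
  obtain ⟨s', hs', rfl⟩ := hle s hs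
  rw [← Measure.map_apply hJ hs', hmap, Measure.map_apply hJ hs']

theorem IsMecke.unique {m : Measure User} (hm : ∀ z, m (userCell z) ≠ ∞)
    {Q₁ Q₂ : Measure (Measure User)} [IsProbabilityMeasure Q₁] [IsProbabilityMeasure Q₂]
    (h₁ : IsMecke m Q₁) (h₂ : IsMecke m Q₂) : Q₁ = Q₂ :=
  ext_of_disjoint_counts hm fun _ _ _ hC hd hfin => by
    rw [h₁.map_counts hC hd hfin, h₂.map_counts hC hd hfin]

/-! ### Superposition, mapping and existence for infinite intensity. -/

lemma measurable_lintegral_pts_self {F : User → Measure User → ℝ≥0∞}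
    (hF : Measurable (Function.uncurry F)) : Measurable fun μ => ∫⁻ x, F x μ ∂(pts μ) :=
  measurable_lintegral_pts measurable_id (F := fun μ x => F x μ) (hF.comp measurable_swap)

/-- The superposition of two independent random measures. -/
theorem IsMecke.add {m₁ m₂ : Measure User} [SFinite m₁] [SFinite m₂]
    {Q₁ Q₂ : Measure (Measure User)} [IsProbabilityMeasure Q₁]
    [IsProbabilityMeasure Q₂] (h₁ : IsMecke m₁ Q₁) (h₂ : IsMecke m₂ Q₂) :
    IsMecke (m₁ + m₂) ((Q₁.prod Q₂).map fun p => p.1 + p.2) := by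
  have hae₁ : ∀ᵐ p ∂(Q₁.prod Q₂), LocFin p.1 := Measure.quasiMeasurePreserving_fst.ae h₁.locFin
  have hae₂ : ∀ᵐ p ∂(Q₁.prod Q₂), LocFin p.2 := Measure.quasiMeasurePreserving_snd.ae h₂.locFin
  refine ⟨?_, fun F hF => ?_⟩
  · rw [ae_map_iff (by fun_prop) measurableSet_locFin]
    filter_upwards [hae₁, hae₂] with p hp hp' using hp.add hp'
  have hA : Measurable fun p : Measure User × Measure User => ∫⁻ x, F x (p.1 + p.2) ∂(pts p.1) :=
    measurable_lintegral_pts measurable_fst (F := fun p x => F x (p.1 + p.2))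
      (hF.uncurry_apply (by fun_prop) (by fun_prop))
  have hB : Measurable fun p : Measure User × Measure User => ∫⁻ x, F x (p.1 + p.2) ∂(pts p.2) :=
    measurable_lintegral_pts measurable_snd (F := fun p x => F x (p.1 + p.2))
      (hF.uncurry_apply (by fun_prop) (by fun_prop))
  have hG : Measurable fun q : (User × Measure User) × Measure User =>
      F q.1.1 (q.1.2 + q.2 + Measure.dirac q.1.1) :=
    hF.uncurry_apply (by fun_prop) (by fun_prop)
  have hG' : Measurable fun q : User × Measure User =>
      ∫⁻ μ, F q.1 (μ + q.2 + Measure.dirac q.1) ∂Q₁ :=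
    (hF.uncurry_apply (f := fun q : (User × Measure User) × Measure User => q.1.1)
      (g := fun q => q.2 + q.1.2 + Measure.dirac q.1.1) (by fun_prop)
      (by fun_prop)).lintegral_prod_right'
  have hG'' : Measurable fun q : User × Measure User =>
      ∫⁻ μ, F q.1 (q.2 + μ + Measure.dirac q.1) ∂Q₂ :=
    hG.lintegral_prod_right'
  have hexp : ∀ x, ∫⁻ μ, F x (μ + Measure.dirac x) ∂((Q₁.prod Q₂).map fun p => p.1 + p.2) =
      ∫⁻ μ₁, ∫⁻ μ₂, F x (μ₁ + μ₂ + Measure.dirac x) ∂Q₂ ∂Q₁ := by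
    intro x
    rw [lintegral_map (hF.uncurry_apply (by fun_prop) (by fun_prop)) (by fun_prop),
      lintegral_prod _ (hF.uncurry_apply (f := fun _ : Measure User × Measure User => x)
        (g := fun p => p.1 + p.2 + Measure.dirac x) (by fun_prop) (by fun_prop)).aemeasurable]
  rw [lintegral_map (measurable_lintegral_pts_self hF) (by fun_prop), lintegral_add_measure]
  have hsplit : ∫⁻ p, ∫⁻ x, F x (p.1 + p.2) ∂(pts (p.1 + p.2)) ∂(Q₁.prod Q₂) =
      ∫⁻ p, ∫⁻ x, F x (p.1 + p.2) ∂(pts p.1) ∂(Q₁.prod Q₂) +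
      ∫⁻ p, ∫⁻ x, F x (p.1 + p.2) ∂(pts p.2) ∂(Q₁.prod Q₂) := by
    rw [← lintegral_add_left hA]
    refine lintegral_congr_ae ?_
    filter_upwards [hae₁, hae₂] with p hp hp'
    rw [pts_of_locFin hp, pts_of_locFin hp', pts_of_locFin (hp.add hp'), lintegral_add_measure]
  rw [hsplit]
  congr 1
  · rw [lintegral_prod_symm _ hA.aemeasurable]
    -- With the independent summand `ν` frozen, the Mecke equation of the other summand applies to
    -- `F x (· + ν)`.
    have : ∀ ν, ∫⁻ μ, ∫⁻ x, F x (μ + ν) ∂(pts μ) ∂Q₁ =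
        ∫⁻ x, ∫⁻ μ, F x (μ + ν + Measure.dirac x) ∂Q₁ ∂m₁ := by
      intro ν
      rw [h₁.mecke (fun x μ => F x (μ + ν)) (hF.uncurry_apply (by fun_prop) (by fun_prop))]
      simp_rw [add_right_comm]
    simp_rw [this]
    refine (lintegral_lintegral_swap (f := fun ν x => ∫⁻ μ, F x (μ + ν + Measure.dirac x) ∂Q₁)
      (hG'.comp measurable_swap).aemeasurable).trans (lintegral_congr fun x => ?_)
    rw [hexp, lintegral_lintegral_swap]
    exact (hF.uncurry_apply (f := fun _ : Measure User × Measure User => x)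
        (g := fun p => p.2 + p.1 + Measure.dirac x) (by fun_prop) (by fun_prop)).aemeasurable
  · rw [lintegral_prod _ hB.aemeasurable]
    have : ∀ ν, ∫⁻ μ, ∫⁻ x, F x (ν + μ) ∂(pts μ) ∂Q₂ =
        ∫⁻ x, ∫⁻ μ, F x (ν + μ + Measure.dirac x) ∂Q₂ ∂m₂ := by
      intro ν
      rw [h₂.mecke (fun x μ => F x (ν + μ)) (hF.uncurry_apply (by fun_prop) (by fun_prop))]
      simp_rw [add_assoc]
    simp_rw [this]
    exact (lintegral_lintegral_swap (f := fun ν x => ∫⁻ μ, F x (ν + μ + Measure.dirac x) ∂Q₂)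
      (hG''.comp measurable_swap).aemeasurable).trans (lintegral_congr fun x => (hexp x).symm)

section Countable

variable {ι : Type*} [DecidableEq ι]

lemma measurable_update_prod {X : Type*} [MeasurableSpace X] (i : ι) :
    Measurable fun p : (ι → X) × X => Function.update p.1 i p.2 := by
  refine measurable_pi_lambda _ fun j => ?_
  rcases eq_or_ne j i with rfl | hj
  · simpa using measurable_snd
  · simp only [Function.update_of_ne hj]
    exact (measurable_pi_apply j).comp measurable_fst

/-- Resampling one coordinate does not change a product law. -/
lemma infinitePi_map_update {X : Type*} [MeasurableSpace X] (Q : ι → Measure X)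
    [∀ i, IsProbabilityMeasure (Q i)] (i : ι) :
    ((Measure.infinitePi Q).prod (Q i)).map (fun p => Function.update p.1 i p.2) =
      Measure.infinitePi Q := by
  have hmeas := measurable_update_prod (X := X) i
  refine Measure.eq_infinitePi _ fun s t ht => ?_
  rw [Measure.map_apply hmeas (MeasurableSet.pi s.countable_toSet fun j _ => ht j)]
  have hpre : (fun p : (ι → X) × X => Function.update p.1 i p.2) ⁻¹' (Set.pi s t) =
      (Set.pi (s.erase i : Finset ι) t) ×ˢ (if i ∈ s then t i else Set.univ) := by
    ext p
    simp only [Set.mem_preimage, Set.mem_pi, Set.mem_prod, Finset.mem_coe, Finset.mem_erase]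
    constructor
    · intro h
      refine ⟨fun j hj => by simpa [hj.1] using h j hj.2, ?_⟩
      split_ifs with hi
      · simpa using h i hi
      · trivial
    · rintro ⟨h1, h2⟩ j hj
      rcases eq_or_ne j i with rfl | hji
      · simpa [hj] using h2
      · simpa [hji] using h1 j ⟨hji, hj⟩
  rw [hpre, Measure.prod_prod, Measure.infinitePi_pi _ (fun j _ => ht j)]
  by_cases hi : i ∈ s
  · rw [if_pos hi, mul_comm, Finset.mul_prod_erase s (fun j => Q j (t j)) hi]
  · rw [if_neg hi, measure_univ, mul_one, Finset.erase_eq_of_notMem hi]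

lemma lintegral_infinitePi_update {X : Type*} [MeasurableSpace X] (Q : ι → Measure X)
    [∀ i, IsProbabilityMeasure (Q i)] (i : ι) {F : (ι → X) → ℝ≥0∞} (hF : Measurable F) :
    ∫⁻ f, F f ∂(Measure.infinitePi Q) =
      ∫⁻ f, ∫⁻ x, F (Function.update f i x) ∂(Q i) ∂(Measure.infinitePi Q) := by
  have hmeas := measurable_update_prod (X := X) i
  conv_lhs => rw [← infinitePi_map_update Q i]
  rw [lintegral_map hF hmeas]
  exact lintegral_prod _ (hF.comp hmeas).aemeasurable

lemma Measurable.measure_sum_update [Countable ι] (i : ι) {α : Type*} [MeasurableSpace α]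
    {f : α → ι → Measure User} {g : α → Measure User} (hf : Measurable f) (hg : Measurable g) :
    Measurable fun a => Measure.sum (Function.update (f a) i (g a)) := by
  refine measurable_measure_sum.comp (measurable_pi_lambda _ fun j => ?_)
  rcases eq_or_ne j i with rfl | hj
  · simpa using hg
  · simp only [Function.update_of_ne hj]
    exact (measurable_pi_apply j).comp hf

/-- A point added to coordinate `i` is a point added to the superposition. This is how the Mecke
equation of one coordinate becomes that of the sum. -/
lemma sum_update_add (f : ι → Measure User) (i : ι) (μ ν : Measure User) :
    Measure.sum (Function.update f i (μ + ν)) = Measure.sum (Function.update f i μ) + ν := by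
  ext s hs
  have key (ρ : Measure User) : Measure.sum (Function.update f i ρ) s =
      ρ s + ∑' j, if j = i then 0 else f j s := by
    rw [Measure.sum_apply _ hs, ENNReal.tsum_eq_add_tsum_ite i, Function.update_self]
    congr 1
    refine tsum_congr fun j => ?_
    split_ifs with h
    · rfl
    · simp [h]
  rw [Measure.add_apply, key, key, Measure.add_apply]
  ring

/-- The superposition of countably many independent random measures. -/
theorem IsMecke.sum [Countable ι] {m : ι → Measure User} [∀ i, SFinite (m i)]
    {Q : ι → Measure (Measure User)} [∀ i, IsProbabilityMeasure (Q i)]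
    (h : ∀ i, IsMecke (m i) (Q i)) (hm : ∀ z, Measure.sum m (userCell z) ≠ ∞) :
    IsMecke (Measure.sum m) ((Measure.infinitePi Q).map Measure.sum) := by
  set Pr := Measure.infinitePi Q with hPr
  have hPi (i : ι) {F : (ι → Measure User) → ℝ≥0∞} (hF : Measurable F) :=
    lintegral_infinitePi_update Q i hF
  have hloc : ∀ᵐ f ∂Pr, LocFin (Measure.sum f) := by
    simp only [LocFin]
    rw [ae_all_iff]
    intro z
    have hz := measurableSet_userCell z
    have hms : Measurable fun f : ι → Measure User => Measure.sum f (userCell z) :=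
      measurable_measure_apply measurable_measure_sum hz
    have : ∫⁻ f, Measure.sum f (userCell z) ∂Pr = Measure.sum m (userCell z) := by
      simp_rw [Measure.sum_apply _ hz]
      rw [lintegral_tsum fun i =>
        (measurable_measure_apply (measurable_pi_apply i) hz).aemeasurable]
      refine tsum_congr fun i => ?_
      rw [hPi i (measurable_measure_apply (measurable_pi_apply i) hz)]
      simp [(h i).lintegral_apply hz]
    filter_upwards [ae_lt_top hms (by rw [this]; exact hm z)] with f hf using hf.ne
  have hloc' (i : ι) : ∀ᵐ f ∂Pr, LocFin (f i) :=
    (measurePreserving_eval_infinitePi Q i).quasiMeasurePreserving.ae (h i).locFin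
  refine ⟨?_, fun F hF => ?_⟩
  · rwa [ae_map_iff measurable_measure_sum.aemeasurable measurableSet_locFin]
  have hA (i : ι) : Measurable fun f : ι → Measure User =>
      ∫⁻ x, F x (Measure.sum f) ∂(pts (f i)) :=
    measurable_lintegral_pts (measurable_pi_apply i) (F := fun f x => F x (Measure.sum f))
      (hF.uncurry_apply measurable_snd (measurable_measure_sum.comp measurable_fst))
  rw [lintegral_map (measurable_lintegral_pts_self hF) measurable_measure_sum, lintegral_sum_measure]
  have hsplit : ∫⁻ f, ∫⁻ x, F x (Measure.sum f) ∂(pts (Measure.sum f)) ∂Pr =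
      ∑' i, ∫⁻ f, ∫⁻ x, F x (Measure.sum f) ∂(pts (f i)) ∂Pr := by
    rw [← lintegral_tsum fun i => (hA i).aemeasurable]
    refine lintegral_congr_ae ?_
    filter_upwards [hloc, ae_all_iff.2 hloc'] with f hf hf'
    rw [pts_of_locFin hf, lintegral_sum_measure]
    exact tsum_congr fun i => by rw [pts_of_locFin (hf' i)]
  rw [hsplit]
  refine tsum_congr fun i => ?_
  have hU' : Measurable fun q : ((ι → Measure User) × User) × Measure User =>
      Measure.sum (Function.update q.1.1 i q.2) :=
    (measurable_fst.comp measurable_fst).measure_sum_update i measurable_snd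
  have hB : Measurable fun q : ((ι → Measure User) × User) × Measure User =>
      F q.1.2 (Measure.sum (Function.update q.1.1 i q.2) + Measure.dirac q.1.2) :=
    hF.uncurry_apply (measurable_snd.comp measurable_fst)
      (hU'.measure_add (measurable_snd.comp measurable_fst).measure_dirac)
  rw [hPi i (hA i)]
  -- Coordinate `i` has been resampled independently of `f`, so its Mecke equation applies with `f`
  -- fixed.
  have h1 : ∀ f, ∫⁻ μ, ∫⁻ x, F x (Measure.sum (Function.update f i μ))
        ∂(pts (Function.update f i μ i)) ∂(Q i) =
      ∫⁻ x, ∫⁻ μ, F x (Measure.sum (Function.update f i μ) + Measure.dirac x) ∂(Q i) ∂(m i) := by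
    intro f
    have hf : Measurable fun μ : Measure User => Measure.sum (Function.update f i μ) :=
      measurable_const.measure_sum_update i measurable_id
    have := (h i).mecke (fun x μ => F x (Measure.sum (Function.update f i μ)))
      (hF.uncurry_apply measurable_fst (hf.comp measurable_snd))
    simp_rw [sum_update_add] at this
    simp_rw [Function.update_self]
    exact this
  simp_rw [h1]
  have hB' : Measurable fun q : (ι → Measure User) × User => ∫⁻ μ,
      F q.2 (Measure.sum (Function.update q.1 i μ) + Measure.dirac q.2) ∂(Q i) :=
    hB.lintegral_prod_right'
  have hswap := lintegral_lintegral_swap (μ := Pr) (ν := m i) (f := fun f x => ∫⁻ μ,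
    F x (Measure.sum (Function.update f i μ) + Measure.dirac x) ∂(Q i)) hB'.aemeasurable
  rw [hswap]
  refine lintegral_congr fun x => ?_
  have hFx : Measurable fun μ => F x (μ + Measure.dirac x) :=
    hF.uncurry_apply (by fun_prop) (by fun_prop)
  rw [lintegral_map hFx measurable_measure_sum]
  exact (hPi i (hFx.comp measurable_measure_sum)).symm

end Countable

/-- Existence of the law of a Poisson random measure. -/
theorem exists_isMecke {m : Measure User} (hm : ∀ z, m (userCell z) ≠ ∞) :
    ∃ Q : Measure (Measure User), IsProbabilityMeasure Q ∧ IsMecke m Q := by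
  have hfin (z) : IsFiniteMeasure (m.restrict (userCell z)) :=
    ⟨by rw [Measure.restrict_apply_univ]; exact (hm z).lt_top⟩
  have hsum : Measure.sum (fun z => m.restrict (userCell z)) = m := by
    rw [← Measure.restrict_iUnion pairwise_disjoint_userCell measurableSet_userCell,
      iUnion_userCell, Measure.restrict_univ]
  choose Q hQ hQ' using fun z => exists_isMecke_of_finite (m.restrict (userCell z))
  refine ⟨_, ?_, hsum ▸ IsMecke.sum hQ' (by rwa [hsum])⟩
  exact Measure.isProbabilityMeasure_map measurable_measure_sum.aemeasurable

/-- Pushing forward commutes with adding a point, so both sides of the equation transform by a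
change of variables. With uniqueness this gives translation invariance of the Poisson law. -/
theorem IsMecke.map {m : Measure User} {Q : Measure (Measure User)} [IsProbabilityMeasure Q] (h : IsMecke m Q)
    {T : User → User} (hT : Measurable T)
    (hloc : ∀ μ : Measure User, LocFin μ → LocFin (μ.map T)) :
    IsMecke (m.map T) (Q.map (Measure.map T)) := by
  have hTm := Measure.measurable_map T hT
  refine ⟨?_, fun F hF => ?_⟩
  · rw [ae_map_iff hTm.aemeasurable measurableSet_locFin]
    filter_upwards [h.locFin] with μ hμ using hloc μ hμ
  have hFx (x : User) : Measurable fun μ => F x (μ + Measure.dirac x) :=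
    hF.uncurry_apply (by fun_prop) (by fun_prop)
  rw [lintegral_map (measurable_lintegral_pts_self hF) hTm]
  have e1 : ∫⁻ μ, ∫⁻ x, F x (μ.map T) ∂(pts (μ.map T)) ∂Q =
      ∫⁻ μ, ∫⁻ x, F (T x) (μ.map T) ∂(pts μ) ∂Q := by
    refine lintegral_congr_ae ?_
    filter_upwards [h.locFin] with μ hμ
    rw [pts_of_locFin hμ, pts_of_locFin (hloc μ hμ),
      lintegral_map (hF.uncurry_apply (by fun_prop) (by fun_prop)) hT]
  rw [e1, h.mecke (fun x μ => F (T x) (μ.map T))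
    (hF.uncurry_apply (hT.comp measurable_fst) (hTm.comp measurable_snd))]
  have hmap : Measurable fun x => ∫⁻ μ, F x (μ + Measure.dirac x) ∂(Q.map (Measure.map T)) := by
    have := Measure.isProbabilityMeasure_map (μ := Q) hTm.aemeasurable
    exact (hF.uncurry_apply (f := fun q : User × Measure User => q.1)
      (g := fun q => q.2 + Measure.dirac q.1) (by fun_prop) (by fun_prop)).lintegral_prod_right'
  rw [lintegral_map hmap hT]
  refine lintegral_congr fun x => ?_
  rw [lintegral_map (hFx _) hTm]
  refine lintegral_congr fun μ => ?_
  rw [Measure.map_add _ _ hT, Measure.map_dirac' hT]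

/-! ### Point configurations as measures, and independence over disjoint regions. -/

lemma measurable_measure_restrict {V : Set User} (hV : MeasurableSet V) :
    Measurable fun μ : Measure User => μ.restrict V := by
  refine Measure.measurable_of_measurable_coe _ fun B hB => ?_
  simp_rw [Measure.restrict_apply hB]
  exact Measure.measurable_coe (hB.inter hV)

/-- The sum of the point masses at the points of a set. -/
noncomputable def diracSum (S : Set User) : Measure User :=
  Measure.sum fun x : S => Measure.dirac (x : User)

lemma diracSum_apply (S : Set User) {B : Set User} (hB : MeasurableSet B) :
    diracSum S B = ((S ∩ B).encard : ℝ≥0∞) := by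
  rw [diracSum, Measure.sum_apply _ hB]
  simp_rw [Measure.dirac_apply' _ hB]
  rw [tsum_subtype S (B.indicator (1 : User → ℝ≥0∞)), Set.indicator_indicator,
    ← tsum_subtype (S ∩ B) (1 : User → ℝ≥0∞), ← ENNReal.tsum_set_one]
  rfl

lemma lintegral_diracSum (S : Set User) (f : User → ℝ≥0∞) :
    ∫⁻ x, f x ∂(diracSum S) = ∑' x : S, f x := by
  rw [diracSum, lintegral_sum_measure]
  exact tsum_congr fun x => lintegral_dirac _ _

namespace IsPoissonPointProcess

variable {Ω : Type*} [MeasurableSpace Ω] {P : Measure Ω} {m : Measure User} {Φ : Ω → Set User}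

lemma measurable_diracSum (h : IsPoissonPointProcess P m Φ) :
    Measurable fun ω => diracSum (Φ ω) := by
  refine Measure.measurable_of_measurable_coe _ fun B hB => ?_
  simp_rw [diracSum_apply _ hB]
  exact (Measurable.of_discrete (f := fun n : ℕ∞ => (n : ℝ≥0∞))).comp (h.measurable_count B hB)

/-- The random measure of a Poisson point process has the law that satisfies the Mecke
equation. -/
theorem map_diracSum [IsProbabilityMeasure P] (h : IsPoissonPointProcess P m Φ)
    (hm : ∀ z, m (userCell z) ≠ ∞) {Q : Measure (Measure User)} [IsProbabilityMeasure Q]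
    (hQ : IsMecke m Q) : P.map (fun ω => diracSum (Φ ω)) = Q := by
  have hD := h.measurable_diracSum
  have := Measure.isProbabilityMeasure_map (μ := P) hD.aemeasurable
  refine ext_of_disjoint_counts hm fun ι _ C hC hd hfin => ?_
  have hev : Measurable fun (μ : Measure User) a => μ (C a) :=
    measurable_pi_lambda _ fun a => Measure.measurable_coe (hC a)
  rw [hQ.map_counts hC hd hfin, Measure.map_map hev hD]
  have hind : iIndepFun (fun a ω => (Φ ω ∩ C a).encard) P := by
    let e := Fintype.equivFin ι
    have h1 := h.indep_count (Fintype.card ι) (fun k => C (e.symm k)) (fun k => hC _)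
      (fun a b hab => hd (e.symm.injective.ne hab))
    have h2 := h1.precomp e.injective
    simpa [Function.comp_def] using h2
  have hmeas : Measurable fun ω a => (Φ ω ∩ C a).encard :=
    measurable_pi_lambda _ fun a => h.measurable_count _ (hC a)
  have hc : Measurable fun (y : ι → ℕ∞) a => (y a : ℝ≥0∞) :=
    measurable_pi_lambda _ fun a =>
      (Measurable.of_discrete (f := fun n : ℕ∞ => (n : ℝ≥0∞))).comp (measurable_pi_apply a)
  have h1 := (iIndepFun_iff_map_fun_eq_pi_map
    (fun a => (h.measurable_count _ (hC a)).aemeasurable)).1 hind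
  have h2 : (fun (μ : Measure User) a => μ (C a)) ∘ (fun ω => diracSum (Φ ω)) =
      (fun (y : ι → ℕ∞) a => (y a : ℝ≥0∞)) ∘ fun ω a => (Φ ω ∩ C a).encard := by
    ext ω a
    exact diracSum_apply _ (hC a)
  rw [h2, ← Measure.map_map hc hmeas, h1]
  simp_rw [fun a => h.law_count _ (hC a) (hfin a)]
  rw [Measure.pi_map_pi (f := fun _ (n : ℕ) => (n : ℝ≥0∞)) (fun a => by fun_prop)]
  have hp (a) : IsProbabilityMeasure
      ((poissonMeasure (m (C a)).toNNReal).map (fun k : ℕ => (k : ℕ∞))) :=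
    Measure.isProbabilityMeasure_map (Measurable.of_discrete).aemeasurable
  rw [Measure.pi_map_pi (f := fun _ (n : ℕ∞) => (n : ℝ≥0∞))
    (fun a => (Measurable.of_discrete).aemeasurable)]
  congr 1
  ext1 a
  rw [Measure.map_map (Measurable.of_discrete) (Measurable.of_discrete)]
  congr 1

end IsPoissonPointProcess

lemma sFinite_of_userCell {m : Measure User} (hm : ∀ z, m (userCell z) ≠ ∞) : SFinite m := by
  have hfin (z) : IsFiniteMeasure (m.restrict (userCell z)) :=
    ⟨by rw [Measure.restrict_apply_univ]; exact (hm z).lt_top⟩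
  have hsum : Measure.sum (fun z => m.restrict (userCell z)) = m := by
    rw [← Measure.restrict_iUnion pairwise_disjoint_userCell measurableSet_userCell,
      iUnion_userCell, Measure.restrict_univ]
  rw [← hsum]
  infer_instance

/-- The restrictions of a Poisson random measure to a set and to its complement are
independent. -/
theorem IsMecke.indepFun_restrict {m : Measure User} (hm : ∀ z, m (userCell z) ≠ ∞)
    {Q : Measure (Measure User)} [IsProbabilityMeasure Q] (hQ : IsMecke m Q)
    {W : Set User} (hW : MeasurableSet W) :
    IndepFun (fun μ : Measure User => μ.restrict W) (fun μ : Measure User => μ.restrict Wᶜ) Q := by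
  have hle (V : Set User) (z) : m.restrict V (userCell z) ≠ ∞ :=
    ne_top_of_le_ne_top (hm z) (Measure.restrict_apply_le _ _)
  obtain ⟨Q₁, hp₁, h₁⟩ := exists_isMecke (hle W)
  obtain ⟨Q₂, hp₂, h₂⟩ := exists_isMecke (hle Wᶜ)
  have := sFinite_of_userCell hm
  have hadd := h₁.add h₂
  rw [Measure.restrict_add_restrict_compl hW] at hadd
  have hpr : IsProbabilityMeasure ((Q₁.prod Q₂).map fun p => p.1 + p.2) :=
    Measure.isProbabilityMeasure_map (by fun_prop)
  -- By uniqueness `Q` is the superposition of independent processes on `W` and on its complement.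
  -- Each almost surely charges only its own side, so the two restrictions recover the independent
  -- summands.
  have hQeq : Q = (Q₁.prod Q₂).map fun p => p.1 + p.2 := hQ.unique hm hadd
  have hr (V : Set User) (hV : MeasurableSet V) :
      Measurable fun μ : Measure User => μ.restrict V := measurable_measure_restrict hV
  have hnull (m' : Measure User) (Q' : Measure (Measure User)) [IsProbabilityMeasure Q']
      (h : IsMecke m' Q') {V : Set User} (hV : MeasurableSet V) (h0 : m' V = 0) :
      ∀ᵐ μ ∂Q', μ V = 0 := by
    have := h.lintegral_apply hV
    rw [h0, lintegral_eq_zero_iff (Measure.measurable_coe hV)] at this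
    exact this
  have e₁ : ∀ᵐ p ∂(Q₁.prod Q₂), p.1 Wᶜ = 0 :=
    Measure.quasiMeasurePreserving_fst.ae (hnull _ _ h₁ hW.compl (by simp [hW]))
  have e₂ : ∀ᵐ p ∂(Q₁.prod Q₂), p.2 W = 0 :=
    Measure.quasiMeasurePreserving_snd.ae (hnull _ _ h₂ hW (by simp [hW]))
  have hmap : Q.map (fun μ => (μ.restrict W, μ.restrict Wᶜ)) = Q₁.prod Q₂ := by
    rw [hQeq, Measure.map_map ((hr W hW).prodMk (hr _ hW.compl)) (by fun_prop)]
    conv_rhs => rw [← Measure.map_id (μ := Q₁.prod Q₂)]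
    refine Measure.map_congr ?_
    filter_upwards [e₁, e₂] with p hp₁ hp₂
    simp only [Function.comp_apply, id]
    refine Prod.ext ?_ ?_
    · simp only [Measure.restrict_add]
      rw [Measure.restrict_eq_zero.2 hp₂, add_zero]
      exact Measure.restrict_eq_self_of_ae_mem hp₁
    · simp only [Measure.restrict_add]
      rw [Measure.restrict_eq_zero.2 hp₁, zero_add]
      refine Measure.restrict_eq_self_of_ae_mem ?_
      rw [ae_iff]
      simpa using hp₂
  rw [indepFun_iff_map_prod_eq_prod_map_map (hr W hW).aemeasurable (hr _ hW.compl).aemeasurable,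
    hmap]
  have f1 : Q.map (fun μ => μ.restrict W) = Q₁ := by
    have := congrArg (Measure.map Prod.fst) hmap
    rw [Measure.map_map measurable_fst ((hr W hW).prodMk (hr _ hW.compl))] at this
    simpa [Function.comp_def, Measure.map_fst_prod] using this
  have f2 : Q.map (fun μ => μ.restrict Wᶜ) = Q₂ := by
    have := congrArg (Measure.map Prod.snd) hmap
    rw [Measure.map_map measurable_snd ((hr W hW).prodMk (hr _ hW.compl))] at this
    simpa [Function.comp_def, Measure.map_snd_prod] using this
  rw [f1, f2]

/-! ### The zero-one law for translation invariant events. -/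

/-- The translation of users by `k` in the first coordinate direction. -/
noncomputable def userShift (k : ℤ) (i : User) : User := (i.1 + EuclideanSpace.single 0 (k : ℝ), i.2)

lemma measurable_userShift (k : ℤ) : Measurable (userShift k) := by
  unfold userShift
  fun_prop

/-- The users whose transmitter lies in the vertical strip of width `2 * n` about the origin. -/
def strip (n : ℕ) : Set User := {i | -(n : ℝ) ≤ i.1 0 ∧ i.1 0 < n}

lemma measurableSet_strip (n : ℕ) : MeasurableSet (strip n) := by
  have : Measurable fun i : User => i.1 0 := by fun_prop
  exact (measurableSet_le measurable_const this).inter (measurableSet_lt this measurable_const)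

lemma monotone_strip : Monotone strip := by
  intro n n' h i hi
  have : (n : ℝ) ≤ n' := by exact_mod_cast h
  exact ⟨by linarith [hi.1], by linarith [hi.2]⟩

lemma iUnion_strip : ⋃ n, strip n = Set.univ := by
  refine Set.eq_univ_of_forall fun i => Set.mem_iUnion.2 ?_
  obtain ⟨n, hn⟩ := exists_nat_gt |i.1 0|
  exact ⟨n, by linarith [neg_abs_le (i.1 0)], by linarith [le_abs_self (i.1 0)]⟩

/-- The half-open form of the strip lets a shift by exactly its width make it disjoint from itself.
-/
lemma preimage_userShift_strip (n : ℕ) : userShift (2 * n) ⁻¹' strip n ⊆ (strip n)ᶜ := by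
  intro i hi hi'
  have h1 := hi.2
  have h2 := hi'.1
  simp [userShift] at h1
  linarith

/-- The events that depend on the restriction to one of the strips. -/
def stripEvents : Set (Set (Measure User)) :=
  {S | ∃ (n : ℕ) (A : Set (Measure User)), MeasurableSet A ∧ S = (fun μ => μ.restrict (strip n)) ⁻¹' A}

lemma stripEvents_mono {n n' : ℕ} (h : n ≤ n') {A : Set (Measure User)} (hA : MeasurableSet A) :
    ∃ A' : Set (Measure User), MeasurableSet A' ∧
      (fun μ : Measure User => μ.restrict (strip n)) ⁻¹' A =
        (fun μ => μ.restrict (strip n')) ⁻¹' A' := by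
  refine ⟨(fun μ => μ.restrict (strip n)) ⁻¹' A,
    measurable_measure_restrict (measurableSet_strip n) hA, ?_⟩
  ext μ
  simp only [Set.mem_preimage]
  rw [Measure.restrict_restrict (measurableSet_strip n),
    Set.inter_eq_self_of_subset_left (monotone_strip h)]

lemma isSetAlgebra_stripEvents : IsSetAlgebra stripEvents where
  empty_mem := ⟨0, ∅, MeasurableSet.empty, rfl⟩
  compl_mem := by
    rintro _ ⟨n, A, hA, rfl⟩
    exact ⟨n, Aᶜ, hA.compl, rfl⟩
  union_mem := by
    rintro _ _ ⟨n, A, hA, rfl⟩ ⟨n', A', hA', rfl⟩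
    obtain ⟨B, hB, e⟩ := stripEvents_mono (le_max_left n n') hA
    obtain ⟨B', hB', e'⟩ := stripEvents_mono (le_max_right n n') hA'
    exact ⟨max n n', B ∪ B', hB.union hB', by rw [e, e']; rfl⟩

/-- The restricted masses increase to the full mass along the strips, so each evaluation is a
countable supremum of functions of the restrictions. -/
lemma generateFrom_stripEvents :
    (inferInstance : MeasurableSpace (Measure User)) = MeasurableSpace.generateFrom stripEvents := by
  refine le_antisymm ?_ (MeasurableSpace.generateFrom_le ?_)
  · have : @Measurable _ _ (MeasurableSpace.generateFrom stripEvents) _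
        (id : Measure User → Measure User) := by
      refine @Measure.measurable_of_measurable_coe _ _ _ (MeasurableSpace.generateFrom stripEvents)
        _ fun B hB => ?_
      have hsup : (fun μ : Measure User => (id μ) B) =
          fun μ => ⨆ n, (μ.restrict (strip n)) B := by
        ext μ
        simp_rw [Measure.restrict_apply hB]
        rw [← Monotone.measure_iUnion, ← Set.inter_iUnion, iUnion_strip, Set.inter_univ, id]
        exact fun n n' h => Set.inter_subset_inter_right _ (monotone_strip h)
      rw [hsup]
      refine @Measurable.iSup _ _ _ _ _ (MeasurableSpace.generateFrom stripEvents) _ _ _ _ _ _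
        fun n => ?_
      intro s hs
      exact MeasurableSpace.measurableSet_generateFrom
        ⟨n, (fun μ => μ B) ⁻¹' s, Measure.measurable_coe hB hs, rfl⟩
    intro s hs
    exact this hs
  · rintro _ ⟨n, A, hA, rfl⟩
    exact measurable_measure_restrict (measurableSet_strip n) hA

lemma restrict_strip_map_userShift (n : ℕ) (μ : Measure User) :
    (μ.map (userShift (2 * n))).restrict (strip n) =
      ((μ.restrict (strip n)ᶜ).map (userShift (2 * n))).restrict (strip n) := by
  have hs := measurable_userShift (2 * n)
  rw [Measure.restrict_map hs (measurableSet_strip n),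
    Measure.restrict_map hs (measurableSet_strip n),
    Measure.restrict_restrict (hs (measurableSet_strip n)),
    Set.inter_eq_self_of_subset_left (preimage_userShift_strip n)]

/-- The shifted event depends only on the points outside the strip, which are independent of those
inside. -/
lemma IsMecke.measure_strip_inter_shift {m : Measure User} (hm : ∀ z, m (userCell z) ≠ ∞)
    {Q : Measure (Measure User)} [IsProbabilityMeasure Q] (hQ : IsMecke m Q) (n : ℕ)
    {A : Set (Measure User)} (hA : MeasurableSet A) :
    Q ((fun μ : Measure User => μ.restrict (strip n)) ⁻¹' A ∩
        Measure.map (userShift (2 * n)) ⁻¹' ((fun μ : Measure User => μ.restrict (strip n)) ⁻¹' A)) =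
      Q ((fun μ : Measure User => μ.restrict (strip n)) ⁻¹' A) *
      Q (Measure.map (userShift (2 * n)) ⁻¹'
        ((fun μ : Measure User => μ.restrict (strip n)) ⁻¹' A)) := by
  obtain ⟨G, hG⟩ : ∃ G : Measure User → Measure User,
      G = fun ρ => (ρ.map (userShift (2 * n))).restrict (strip n) := ⟨_, rfl⟩
  have hGm : Measurable G := by
    rw [hG]
    exact (measurable_measure_restrict (measurableSet_strip n)).comp
      (Measure.measurable_map _ (measurable_userShift _))
  have h1 : Measure.map (userShift (2 * n)) ⁻¹'
        ((fun μ : Measure User => μ.restrict (strip n)) ⁻¹' A) =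
      (fun μ : Measure User => μ.restrict (strip n)ᶜ) ⁻¹' (G ⁻¹' A) := by
    ext μ
    simp only [Set.mem_preimage]
    rw [restrict_strip_map_userShift, hG]
  rw [h1]
  exact (hQ.indepFun_restrict hm (measurableSet_strip n)).measure_inter_preimage_eq_mul _ _ hA
    (hGm hA)

/-- An event that is invariant under translations has probability zero or one. -/
theorem IsMecke.zero_or_one {m : Measure User} (hm : ∀ z, m (userCell z) ≠ ∞)
    {Q : Measure (Measure User)} [IsProbabilityMeasure Q] (hQ : IsMecke m Q)
    (hQs : ∀ k, Q.map (Measure.map (userShift k)) = Q)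
    {A : Set (Measure User)} (hA : MeasurableSet A)
    (hinv : ∀ k μ, μ.map (userShift k) ∈ A ↔ μ ∈ A) : Q A = 0 ∨ Q A = 1 := by
  have hdense := Measure.MeasureDense.of_generateFrom_isSetAlgebra_finite (μ := Q)
    isSetAlgebra_stripEvents generateFrom_stripEvents
  set q := Q.real A with hq
  have hq1 : q ≤ 1 := measureReal_le_one
  have hq0 : 0 ≤ q := measureReal_nonneg
  -- Approximate `A` by a strip event `t` up to `ε`. Both `t` and its shift approximate the
  -- invariant `A`, and they are independent, so `q ≤ (q + ε) ^ 2 + 2 * ε`. Since `q, ε ≤ 1`, this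
  -- is at most `q ^ 2 + 5 * ε`.
  have key : ∀ ε : ℝ, 0 < ε → ε ≤ 1 → q ≤ q ^ 2 + 5 * ε := by
    intro ε hε hε1
    obtain ⟨_, ⟨n, A', hA', rfl⟩, hlt⟩ := hdense.approx A hA (measure_ne_top _ _) ε hε
    set t := (fun μ : Measure User => μ.restrict (strip n)) ⁻¹' A' with ht
    have htm : MeasurableSet t := measurable_measure_restrict (measurableSet_strip n) hA'
    set τ : Measure User → Measure User := Measure.map (userShift (2 * n)) with hτ
    have hτm : Measurable τ := Measure.measurable_map _ (measurable_userShift _)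
    have hpres (S : Set (Measure User)) (hS : MeasurableSet S) : Q (τ ⁻¹' S) = Q S := by
      rw [← Measure.map_apply hτm hS, hQs]
    have hAτ : τ ⁻¹' A = A := by ext μ; exact hinv _ μ
    have hd1 : Q.real (symmDiff A t) < ε := by
      rw [measureReal_def]
      exact (ENNReal.toReal_lt_of_lt_ofReal hlt)
    have hd2 : Q.real (symmDiff A (τ ⁻¹' t)) < ε := by
      have : symmDiff A (τ ⁻¹' t) = τ ⁻¹' (symmDiff A t) := by
        rw [Set.preimage_symmDiff, hAτ]
      rw [this, measureReal_def, hpres _ (hA.symmDiff htm)]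
      exact (ENNReal.toReal_lt_of_lt_ofReal hlt)
    have hind : Q.real (t ∩ τ ⁻¹' t) = Q.real t * Q.real t := by
      rw [measureReal_def, hQ.measure_strip_inter_shift hm n hA', hpres _ htm,
        ENNReal.toReal_mul, ← measureReal_def]
    have hle : q ≤ Q.real (t ∩ τ ⁻¹' t) + Q.real (symmDiff A t) + Q.real (symmDiff A (τ ⁻¹' t)) := by
      refine (measureReal_mono (s₂ := (t ∩ τ ⁻¹' t) ∪ symmDiff A t ∪ symmDiff A (τ ⁻¹' t)) ?_).trans
        ((measureReal_union_le _ _).trans (add_le_add_left (measureReal_union_le _ _) _))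
      intro μ hμ
      by_cases h1 : μ ∈ t
      · by_cases h2 : μ ∈ τ ⁻¹' t
        · exact Or.inl (Or.inl ⟨h1, h2⟩)
        · exact Or.inr (Or.inl ⟨hμ, h2⟩)
      · exact Or.inl (Or.inr (Or.inl ⟨hμ, h1⟩))
    have hr : Q.real t ≤ q + ε := by
      have : Q.real t ≤ Q.real (A ∪ symmDiff A t) := by
        refine measureReal_mono fun μ hμ => ?_
        by_cases h1 : μ ∈ A
        · exact Or.inl h1
        · exact Or.inr (Or.inr ⟨hμ, h1⟩)
      linarith [measureReal_union_le (μ := Q) A (symmDiff A t)]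
    have hr0 : 0 ≤ Q.real t := measureReal_nonneg
    have : Q.real t * Q.real t ≤ (q + ε) * (q + ε) := mul_self_le_mul_self hr0 hr
    nlinarith
  have hqq : q ≤ q ^ 2 := by
    refine le_of_forall_pos_le_add fun ε hε => ?_
    have h1 := key (min (ε / 5) 1) (by positivity) (min_le_right _ _)
    linarith [min_le_left (ε / 5) 1]
  have : q = 0 ∨ q = 1 := by
    rcases hq0.eq_or_lt with h | h
    · exact Or.inl h.symm
    · right; nlinarith
  rcases this with h | h
  · left
    rwa [hq, measureReal_eq_zero_iff] at h
  · right
    rw [← ENNReal.toReal_eq_one_iff]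
    exact h

/-! ### Power control on a measure of users, and its monotonicity. -/

namespace PowerControl

variable (c : PowerControl)

open Classical in
/-- The required increase of user `i` in a network that is given by a measure on users. -/
noncomputable def required (μ : Measure User) (q : User → ℝ≥0∞) (i : User) : ℝ≥0∞ :=
  ∫⁻ j, (if j = i then 0 else c.gain j i * q j) ∂μ

open Classical in
/-- The realized increase, given the required increase. -/
noncomputable def realize (v : ℝ≥0∞) : ℝ≥0∞ :=
  if (c.threshold : ℝ≥0∞) < v then min v c.maxIncrease else 0

open Classical in
/-- The power increase after round `n` in a network that is given by a measure on users. -/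
noncomputable def power (μ : Measure User) (x : User) : ℕ → User → ℝ≥0∞
  | 0, i => if i = x then (c.update : ℝ≥0∞) else 0
  | n + 1, i => if i = x then (c.update : ℝ≥0∞) else c.realize (c.required μ (power μ x n) i)

/-- The users other than `x` whose power changes. -/
def reach (μ : Measure User) (x : User) : Set User := {i | i ≠ x ∧ ∃ n, c.power μ x n i ≠ 0}

/-- The locally finite networks with a user whose update affects infinitely many users. -/
def percolating : Set (Measure User) :=
  {μ | pts μ {x | pts μ (c.reach (pts μ) x) = ∞} ≠ 0}

lemma required_diracSum (S : Set User) (q : User → ℝ≥0∞) (i : User) :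
    c.required (diracSum S) q i = c.requiredIncrease S q i := by
  rw [required, lintegral_diracSum, requiredIncrease]

lemma power_diracSum (S : Set User) (x : User) (n : ℕ) :
    c.power (diracSum S) x n = c.powerIncrease S x n := by
  induction n with
  | zero => ext i; simp only [power, powerIncrease]
  | succ n ih =>
    ext i
    simp only [power, powerIncrease, realize, ih, required_diracSum]

lemma affected_eq (S : Set User) (x : User) :
    c.affected S x = S ∩ c.reach (diracSum S) x := by
  ext i
  simp only [affected, reach, power_diracSum, Set.mem_inter_iff, Set.mem_ofPred_eq]

section Monotone

variable {c}

lemma realize_mono {v w : ℝ≥0∞} (h : v ≤ w) : c.realize v ≤ c.realize w := by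
  unfold realize
  split_ifs with h1 h2
  · exact min_le_min_right _ h
  · exact absurd (h1.trans_le h) h2
  · exact zero_le
  · exact zero_le

lemma required_mono {μ μ' : Measure User} (hμ : μ ≤ μ') {q q' : User → ℝ≥0∞} (hq : q ≤ q')
    (i : User) : c.required μ q i ≤ c.required μ' q' i := by
  refine lintegral_mono' hμ fun j => ?_
  dsimp only
  split_ifs
  · exact le_rfl
  · exact mul_le_mul_right (hq j) _

lemma power_self (μ : Measure User) (x : User) (n : ℕ) : c.power μ x n x = c.update := by
  cases n <;> simp [power]

lemma power_succ_of_ne {μ : Measure User} {x i : User} (h : i ≠ x) (n : ℕ) :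
    c.power μ x (n + 1) i = c.realize (c.required μ (c.power μ x n) i) := by
  simp [power, h]

/-- More users mean larger required increases, and `realize` preserves order because a user above
the threshold stays above it. -/
lemma power_mono {μ μ' : Measure User} (hμ : μ ≤ μ') (x : User) (n : ℕ) :
    c.power μ x n ≤ c.power μ' x n := by
  induction n with
  | zero => intro i; simp [power]
  | succ n ih =>
    intro i
    by_cases h : i = x
    · subst h; simp [power_self]
    · rw [power_succ_of_ne h, power_succ_of_ne h]
      exact realize_mono (required_mono hμ ih i)

lemma power_le_succ (μ : Measure User) (x : User) (n : ℕ) :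
    c.power μ x n ≤ c.power μ x (n + 1) := by
  induction n with
  | zero =>
    intro i
    by_cases h : i = x
    · subst h; simp [power_self]
    · simp [power, h]
  | succ n ih =>
    intro i
    by_cases h : i = x
    · subst h; simp [power_self]
    · rw [power_succ_of_ne h, power_succ_of_ne h]
      exact realize_mono (required_mono le_rfl ih i)

lemma monotone_power (μ : Measure User) (x : User) : Monotone (c.power μ x) :=
  monotone_nat_of_le_succ (power_le_succ μ x)

lemma reach_mono {μ μ' : Measure User} (hμ : μ ≤ μ') (x : User) : c.reach μ x ⊆ c.reach μ' x := by
  rintro i ⟨hi, n, hn⟩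
  exact ⟨hi, n, fun h => hn (le_zero_iff.1 (h ▸ power_mono hμ x n i))⟩

/-- A percolating user of the smaller network still percolates in the larger one, and the set of
such users has no less mass there. Local finiteness of `μ'` rules out the default value of `pts`. -/
lemma percolating_mono {μ μ' : Measure User} (hμ : μ ≤ μ') (h : LocFin μ')
    (hp : μ ∈ c.percolating) : μ' ∈ c.percolating := by
  have h0 := h.mono hμ
  simp only [percolating, Set.mem_ofPred_eq, pts_of_locFin h, pts_of_locFin h0] at hp ⊢
  intro h1
  refine hp (le_zero_iff.1 ?_)
  rw [← h1]
  refine (hμ _).trans (measure_mono fun x hx => ?_)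
  exact top_unique (hx.symm.le.trans ((hμ _).trans (measure_mono (reach_mono hμ x))))

end Monotone

/-! ### Measurability of the percolation event. -/

lemma measurable_pathLoss : Measurable c.pathLoss := by
  unfold pathLoss
  exact ((ENNReal.measurable_ofReal.pow_const _)).inv

lemma measurable_gain : Measurable (Function.uncurry c.gain) := by
  unfold gain User.tx User.rx Function.uncurry
  refine Measurable.div (Measurable.const_mul ?_ _) ?_
  · exact c.measurable_pathLoss.comp (by fun_prop)
  · exact c.measurable_pathLoss.comp (by fun_prop)

lemma measurable_realize : Measurable c.realize := by
  unfold realize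
  exact Measurable.ite measurableSet_Ioi (measurable_id.min measurable_const) measurable_const

open Classical in
lemma measurable_required {α : Type*} [MeasurableSpace α] {f : α → Measure User} {h : α → User}
    {q : α → User → ℝ≥0∞} (hf : Measurable f) (hh : Measurable h)
    (hq : Measurable (Function.uncurry q)) :
    Measurable fun a => c.required (pts (f a)) (q a) (h a) := by
  have hset : MeasurableSet {p : α × User | p.2 = h p.1} :=
    measurableSet_eq_fun measurable_snd (hh.comp measurable_fst)
  have hg : Measurable fun p : α × User => c.gain p.2 (h p.1) :=
    c.measurable_gain.uncurry_apply measurable_snd (hh.comp measurable_fst)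
  have hF : Measurable fun p : α × User => if p.2 = h p.1 then 0 else c.gain p.2 (h p.1) * q p.1 p.2 :=
    Measurable.ite hset measurable_const (hg.mul hq)
  exact measurable_lintegral_pts hf hF

/-- Joint measurability in network, initial user and observed user is what the induction needs: the
next round integrates over the observed user, against a measure that is itself an argument. -/
lemma measurable_power_aux (n : ℕ) :
    Measurable fun p : Measure User × User × User => c.power (pts p.1) p.2.1 n p.2.2 := by
  have heq : MeasurableSet {p : Measure User × User × User | p.2.2 = p.2.1} :=
    measurableSet_eq_fun (by fun_prop) (by fun_prop)
  induction n with
  | zero =>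
    simp only [power]
    exact Measurable.ite heq measurable_const measurable_const
  | succ n ih =>
    simp only [power]
    refine Measurable.ite heq measurable_const (c.measurable_realize.comp ?_)
    have hq : Measurable (Function.uncurry fun (p : Measure User × User × User) (j : User) =>
        c.power (pts p.1) p.2.1 n j) :=
      ih.comp (by fun_prop : Measurable fun q : (Measure User × User × User) × User =>
        (q.1.1, q.1.2.1, q.2))
    exact c.measurable_required measurable_fst (measurable_snd.comp measurable_snd) hq

lemma measurable_power {α : Type*} [MeasurableSpace α] {f : α → Measure User} {g h : α → User}
    (hf : Measurable f) (hg : Measurable g) (hh : Measurable h) (n : ℕ) :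
    Measurable fun a => c.power (pts (f a)) (g a) n (h a) :=
  (c.measurable_power_aux n).comp (hf.prodMk (hg.prodMk hh))

lemma measurableSet_reach_aux {α : Type*} [MeasurableSpace α] {f : α → Measure User}
    {g h : α → User} (hf : Measurable f) (hg : Measurable g) (hh : Measurable h) :
    MeasurableSet {a | h a ∈ c.reach (pts (f a)) (g a)} := by
  have : {a | h a ∈ c.reach (pts (f a)) (g a)} =
      {a | h a = g a}ᶜ ∩ ⋃ n, {a | c.power (pts (f a)) (g a) n (h a) = 0}ᶜ := by
    ext a; simp [reach]
  rw [this]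
  exact (measurableSet_eq_fun hh hg).compl.inter
    (MeasurableSet.iUnion fun n => (c.measurable_power hf hg hh n (measurableSet_singleton 0)).compl)

lemma measurableSet_reach (μ : Measure User) (x : User) : MeasurableSet (c.reach (pts μ) x) :=
  c.measurableSet_reach_aux (f := fun _ : User => μ) measurable_const measurable_const measurable_id

lemma measurable_reach {α : Type*} [MeasurableSpace α] {f f' : α → Measure User} {g : α → User}
    (hf : Measurable f) (hf' : Measurable f') (hg : Measurable g) :
    Measurable fun a => pts (f a) (c.reach (pts (f' a)) (g a)) := by
  have : (fun a => pts (f a) (c.reach (pts (f' a)) (g a))) = fun a =>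
      ∫⁻ i, (c.reach (pts (f' a)) (g a)).indicator 1 i ∂(pts (f a)) := by
    ext a
    rw [lintegral_indicator_one (c.measurableSet_reach _ _)]
  rw [this]
  refine measurable_lintegral_pts hf ?_
  have hm := c.measurableSet_reach_aux (f := fun q : α × User => f' q.1) (g := fun q => g q.1)
    (h := fun q => q.2) (by fun_prop) (by fun_prop) (by fun_prop)
  exact (measurable_one.indicator hm : Measurable (Set.indicator
    {q : α × User | q.2 ∈ c.reach (pts (f' q.1)) (g q.1)} (1 : α × User → ℝ≥0∞)))

lemma measurableSet_setOf_reach_eq_top (μ : Measure User) :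
    MeasurableSet {x | pts μ (c.reach (pts μ) x) = ∞} :=
  c.measurable_reach (f := fun _ => μ) (f' := fun _ => μ) measurable_const measurable_const
    measurable_id (measurableSet_singleton ∞)

lemma measurableSet_percolating : MeasurableSet c.percolating := by
  have hm : MeasurableSet {q : Measure User × User | pts q.1 (c.reach (pts q.1) q.2) = ∞} :=
    c.measurable_reach (f := fun q : Measure User × User => q.1) (f' := fun q => q.1)
      (g := fun q => q.2) measurable_fst measurable_fst measurable_snd (measurableSet_singleton ∞)
  have : Measurable fun μ : Measure User => pts μ {x | pts μ (c.reach (pts μ) x) = ∞} := by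
    have h1 : (fun μ : Measure User => pts μ {x | pts μ (c.reach (pts μ) x) = ∞}) = fun μ =>
        ∫⁻ x, {x | pts μ (c.reach (pts μ) x) = ∞}.indicator 1 x ∂(pts μ) := by
      ext μ
      rw [lintegral_indicator_one (c.measurableSet_setOf_reach_eq_top μ)]
    rw [h1]
    refine measurable_lintegral_pts measurable_id ?_
    exact (measurable_one.indicator hm : Measurable (Set.indicator
      {q : Measure User × User | pts q.1 (c.reach (pts q.1) q.2) = ∞}
        (1 : Measure User × User → ℝ≥0∞)))
  exact (this (measurableSet_singleton 0)).compl

/-- The bridge from masses to cardinalities: for a point configuration, infinite mass means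
infinitely many points and positive mass means at least one. -/
lemma diracSum_mem_percolating {S : Set User} (h : LocFin (diracSum S)) :
    diracSum S ∈ c.percolating ↔ ∃ x ∈ S, (c.affected S x).Infinite := by
  have hset := c.measurableSet_setOf_reach_eq_top (diracSum S)
  have hr := c.measurableSet_reach (diracSum S)
  rw [pts_of_locFin h] at hset hr
  simp only [percolating, Set.mem_ofPred_eq, pts_of_locFin h]
  rw [diracSum_apply _ hset]
  have h1 (x : User) : diracSum S (c.reach (diracSum S) x) = ∞ ↔ (c.affected S x).Infinite := by
    rw [diracSum_apply _ (hr x), ← affected_eq, ENat.toENNReal_eq_top, Set.encard_eq_top_iff]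
  simp only [h1, ne_eq, ENat.toENNReal_eq_zero, Set.encard_eq_zero]
  rw [← ne_eq, ← Set.nonempty_iff_ne_empty]
  rfl

end PowerControl

/-! ### Translation invariance of percolation. -/

section Shift

/-- The translation of users as an equivalence. -/
noncomputable def userShiftEquiv (k : ℤ) : User ≃ᵐ User where
  toFun := userShift k
  invFun := userShift (-k)
  left_inv i := by
    ext1
    · ext a; fin_cases a <;> simp [userShift]
    · rfl
  right_inv i := by
    ext1
    · ext a; fin_cases a <;> simp [userShift]
    · rfl
  measurable_toFun := measurable_userShift k
  measurable_invFun := measurable_userShift (-k)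

lemma preimage_userShift_userCell (k : ℤ) (z : ℤ × ℤ) :
    userShift k ⁻¹' userCell z = userCell (z.1 - k, z.2) := by
  ext i
  simp [userShift, userCell, eq_sub_iff_add_eq]

lemma locFin_map_userShift (k : ℤ) (μ : Measure User) :
    LocFin (μ.map (userShift k)) ↔ LocFin μ := by
  simp only [LocFin, Measure.map_apply (measurable_userShift k) (measurableSet_userCell _),
    preimage_userShift_userCell]
  refine ⟨fun h z => ?_, fun h z => h _⟩
  simpa using h (z.1 + k, z.2)

lemma pts_map_userShift (k : ℤ) (μ : Measure User) :
    pts (μ.map (userShift k)) = (pts μ).map (userShift k) := by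
  by_cases h : LocFin μ
  · rw [pts_of_locFin h, pts_of_locFin ((locFin_map_userShift k μ).2 h)]
  · rw [pts_of_not_locFin h, pts_of_not_locFin (mt (locFin_map_userShift k μ).1 h)]
    simp

namespace PowerControl
variable (c : PowerControl)

lemma gain_userShift (k : ℤ) (i j : User) :
    c.gain (userShift k j) (userShift k i) = c.gain j i := by
  simp only [gain, User.tx, User.rx, userShift]
  rw [add_right_comm i.1, dist_add_right, dist_add_right]

lemma power_map_userShift (k : ℤ) (μ : Measure User) (x : User) (n : ℕ) (i : User) :
    c.power (μ.map (userShift k)) (userShift k x) n (userShift k i) = c.power μ x n i := by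
  have hinj (i j : User) : userShift k i = userShift k j ↔ i = j :=
    (userShiftEquiv k).injective.eq_iff
  induction n generalizing i with
  | zero => simp [power, hinj]
  | succ n ih =>
    simp only [power, hinj]
    congr 2
    unfold required
    -- A measurable equivalence permits the change of variables without measurability of the
    -- integrand, which is not known for arbitrary `μ`.
    have := (lintegral_map_equiv (μ := μ) (fun j => if j = userShift k i then 0 else
      c.gain j (userShift k i) * c.power (μ.map (userShift k)) (userShift k x) n j)
      (userShiftEquiv k))
    change ∫⁻ j, _ ∂(μ.map (userShift k)) = ∫⁻ j, (if userShift k j = userShift k i then 0 else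
      c.gain (userShift k j) (userShift k i) *
        c.power (μ.map (userShift k)) (userShift k x) n (userShift k j)) ∂μ at this
    simp_rw [hinj, ih, gain_userShift] at this
    convert this

lemma map_userShift_mem_percolating (k : ℤ) (μ : Measure User) :
    μ.map (userShift k) ∈ c.percolating ↔ μ ∈ c.percolating := by
  have happ (ρ : Measure User) (B : Set User) : ρ.map (userShift k) B = ρ (userShift k ⁻¹' B) :=
    (userShiftEquiv k).map_apply B
  have hreach (ρ : Measure User) (x : User) :
      userShift k ⁻¹' c.reach (ρ.map (userShift k)) (userShift k x) = c.reach ρ x := by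
    ext i
    simp only [reach, Set.mem_preimage, Set.mem_ofPred_eq, power_map_userShift, ne_eq]
    rw [show userShift k i = userShift k x ↔ i = x from (userShiftEquiv k).injective.eq_iff]
  simp only [percolating, Set.mem_ofPred_eq, pts_map_userShift, happ]
  simp only [Set.preimage_ofPred_eq, hreach]

end PowerControl
end Shift

/-! ### The Poisson law of users and the critical density. -/

lemma volume_unitSquare (z : ℤ × ℤ) :
    (volume : Measure Plane) {t | ⌊t 0⌋ = z.1 ∧ ⌊t 1⌋ = z.2} = 1 := by
  have h1 : {t : Plane | ⌊t 0⌋ = z.1 ∧ ⌊t 1⌋ = z.2} =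
      (MeasurableEquiv.toLp 2 (Fin 2 → ℝ)).symm ⁻¹'
        (Set.univ.pi ![Set.Ico (z.1 : ℝ) (z.1 + 1), Set.Ico (z.2 : ℝ) (z.2 + 1)]) := by
    ext t
    simp [Set.mem_pi, Fin.forall_fin_two, Int.floor_eq_iff]
  rw [h1, (EuclideanSpace.volume_preserving_symm_measurableEquiv_toLp (Fin 2)).measure_preimage_equiv,
    volume_pi, Measure.pi_pi]
  simp [Fin.prod_univ_two]

/-- The intensity measure of the users. -/
noncomputable def userIntensity (ν : Measure Plane) (lam : ℝ≥0) : Measure User :=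
  lam • (volume : Measure Plane).prod ν

lemma userIntensity_add (ν : Measure Plane) (lam lam' : ℝ≥0) :
    userIntensity ν (lam + lam') = userIntensity ν lam + userIntensity ν lam' := by
  simp [userIntensity, add_smul]

section
variable (ν : Measure Plane) [IsProbabilityMeasure ν] (lam : ℝ≥0)

lemma userIntensity_prod (A B : Set Plane) :
    userIntensity ν lam (A ×ˢ B) = lam * (volume A * ν B) := by
  rw [userIntensity, Measure.smul_apply, Measure.prod_prod]
  rfl

lemma userIntensity_userCell (z : ℤ × ℤ) : userIntensity ν lam (userCell z) = lam := by
  have : userCell z = {t : Plane | ⌊t 0⌋ = z.1 ∧ ⌊t 1⌋ = z.2} ×ˢ Set.univ := by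
    ext i; simp [userCell]
  rw [this, userIntensity_prod, volume_unitSquare, measure_univ, mul_one, mul_one]

lemma userIntensity_userCell_ne_top (z : ℤ × ℤ) : userIntensity ν lam (userCell z) ≠ ∞ := by
  rw [userIntensity_userCell]; exact ENNReal.coe_ne_top

instance : SFinite (userIntensity ν lam) := sFinite_of_userCell (userIntensity_userCell_ne_top ν lam)

lemma userIntensity_map_userShift (k : ℤ) :
    (userIntensity ν lam).map (userShift k) = userIntensity ν lam := by
  have h := (measurePreserving_add_right (volume : Measure Plane)
    (EuclideanSpace.single 0 (k : ℝ))).prod (MeasurePreserving.id ν)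
  have h2 : userShift k = Prod.map (fun t => t + EuclideanSpace.single 0 (k : ℝ)) id := rfl
  rw [userIntensity, Measure.map_smul, h2, h.map_eq]

/-- The law of the Poisson random measure of users. -/
noncomputable def poissonLaw : Measure (Measure User) :=
  (exists_isMecke (userIntensity_userCell_ne_top ν lam)).choose

instance : IsProbabilityMeasure (poissonLaw ν lam) :=
  (exists_isMecke (userIntensity_userCell_ne_top ν lam)).choose_spec.1

lemma isMecke_poissonLaw : IsMecke (userIntensity ν lam) (poissonLaw ν lam) :=
  (exists_isMecke (userIntensity_userCell_ne_top ν lam)).choose_spec.2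

lemma poissonLaw_map_userShift (k : ℤ) :
    (poissonLaw ν lam).map (Measure.map (userShift k)) = poissonLaw ν lam := by
  have hm := Measure.measurable_map _ (measurable_userShift k)
  have := Measure.isProbabilityMeasure_map (μ := poissonLaw ν lam) hm.aemeasurable
  have h := (isMecke_poissonLaw ν lam).map (measurable_userShift k)
    (fun μ hμ => (locFin_map_userShift k μ).2 hμ)
  rw [userIntensity_map_userShift] at h
  exact h.unique (userIntensity_userCell_ne_top ν lam) (isMecke_poissonLaw ν lam)

lemma poissonLaw_add (lam' : ℝ≥0) : poissonLaw ν (lam + lam') =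
    ((poissonLaw ν lam).prod (poissonLaw ν lam')).map fun p => p.1 + p.2 := by
  have := Measure.isProbabilityMeasure_map (μ := (poissonLaw ν lam).prod (poissonLaw ν lam'))
    (f := fun p => p.1 + p.2) (by fun_prop)
  refine (isMecke_poissonLaw ν _).unique (userIntensity_userCell_ne_top ν _) ?_
  rw [userIntensity_add]
  exact (isMecke_poissonLaw ν lam).add (isMecke_poissonLaw ν lam')

namespace PowerControl

variable (c : PowerControl)

lemma poissonLaw_percolating_zero_or_one :
    poissonLaw ν lam c.percolating = 0 ∨ poissonLaw ν lam c.percolating = 1 :=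
  (isMecke_poissonLaw ν lam).zero_or_one (userIntensity_userCell_ne_top ν lam)
    (poissonLaw_map_userShift ν lam) c.measurableSet_percolating c.map_userShift_mem_percolating

/-- Coupling: the denser network is the sparser one with an independent Poisson network added, and
extra users cannot destroy percolation. -/
lemma poissonLaw_percolating_mono {lam lam' : ℝ≥0} (h : lam ≤ lam')
    (h1 : poissonLaw ν lam c.percolating = 1) : poissonLaw ν lam' c.percolating = 1 := by
  obtain ⟨η, rfl⟩ := exists_add_of_le h
  refine le_antisymm prob_le_one ?_
  rw [poissonLaw_add, Measure.map_apply (by fun_prop) c.measurableSet_percolating]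
  have h2 : ((poissonLaw ν lam).prod (poissonLaw ν η)) (Prod.fst ⁻¹' c.percolating) = 1 := by
    rw [← Measure.map_apply measurable_fst c.measurableSet_percolating, Measure.map_fst_prod]
    simp [h1]
  rw [← h2]
  refine measure_mono_ae ?_
  have e1 : ∀ᵐ p ∂((poissonLaw ν lam).prod (poissonLaw ν η)), LocFin p.1 :=
    Measure.quasiMeasurePreserving_fst.ae (isMecke_poissonLaw ν lam).locFin
  have e2 : ∀ᵐ p ∂((poissonLaw ν lam).prod (poissonLaw ν η)), LocFin p.2 :=
    Measure.quasiMeasurePreserving_snd.ae (isMecke_poissonLaw ν η).locFin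
  filter_upwards [e1, e2] with p hp hp' hq
  exact percolating_mono (Measure.le_add_right le_rfl) (hp.add hp') hq

/-- Transfers almost sure statements between an arbitrary realisation `Φ` and the canonical law.
This is why the critical density does not depend on the probability space. -/
lemma ae_diracSum_iff {Ω : Type*} [MeasurableSpace Ω] {P : Measure Ω} [IsProbabilityMeasure P]
    {Φ : Ω → Set User} (h : IsPoissonPointProcess P (userIntensity ν lam) Φ)
    {A : Set (Measure User)} (hA : MeasurableSet A) :
    (∀ᵐ ω ∂P, LocFin (diracSum (Φ ω)) ∧ diracSum (Φ ω) ∈ A) ↔ poissonLaw ν lam A = 1 := by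
  have hmap := h.map_diracSum (userIntensity_userCell_ne_top ν lam) (isMecke_poissonLaw ν lam)
  have hloc := (isMecke_poissonLaw ν lam).locFin
  rw [← prob_compl_eq_zero_iff hA]
  change _ ↔ ∀ᵐ μ ∂(poissonLaw ν lam), μ ∈ A
  rw [← hmap] at hloc ⊢
  rw [ae_map_iff h.measurable_diracSum.aemeasurable measurableSet_locFin] at hloc
  rw [ae_map_iff (p := (· ∈ A)) h.measurable_diracSum.aemeasurable hA]
  constructor
  · exact fun h => h.mono fun ω hω => hω.2
  · intro h
    filter_upwards [hloc, h] with ω h1 h2 using ⟨h1, h2⟩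

/-- The dichotomy at the infimum of the percolating densities. -/
theorem sInf_dichotomy (hne : ∃ lam, poissonLaw ν lam c.percolating = 1)
    {Ω : Type*} [MeasurableSpace Ω] (P : Measure Ω) [IsProbabilityMeasure P]
    (Φ : Ω → Set User) (lam : ℝ≥0)
    (h : IsPoissonPointProcess P (lam • (volume : Measure Plane).prod ν) Φ) :
    (lam < sInf {l | poissonLaw ν l c.percolating = 1} →
      ∀ᵐ ω ∂P, ∀ x ∈ Φ ω, (c.affected (Φ ω) x).Finite) ∧
    (sInf {l | poissonLaw ν l c.percolating = 1} < lam →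
      ∀ᵐ ω ∂P, ∃ x ∈ Φ ω, (c.affected (Φ ω) x).Infinite) := by
  constructor
  · intro hlt
    have h0 : poissonLaw ν lam c.percolatingᶜ = 1 := by
      rcases c.poissonLaw_percolating_zero_or_one ν lam with h0 | h1
      · exact (prob_compl_eq_one_iff c.measurableSet_percolating).2 h0
      · exact absurd (csInf_le' (show lam ∈ {l | poissonLaw ν l c.percolating = 1} from h1))
          (not_le.2 hlt)
    filter_upwards [(ae_diracSum_iff ν lam h c.measurableSet_percolating.compl).2 h0] with ω hω x hx
    by_contra hinf
    exact hω.2 ((c.diracSum_mem_percolating hω.1).2 ⟨x, hx, hinf⟩)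
  · intro hlt
    obtain ⟨l, hl, hl'⟩ := exists_lt_of_csInf_lt hne hlt
    have h1 := c.poissonLaw_percolating_mono ν hl'.le hl
    filter_upwards [(ae_diracSum_iff ν lam h c.measurableSet_percolating).2 h1] with ω hω
    exact (c.diracSum_mem_percolating hω.1).1 hω.2

end PowerControl
end

/-! ### Hierarchical blocks of tiles in the quadrant. -/

namespace Block

/-- Nearest neighbours in the quadrant. -/
def Adj (t t' : ℕ × ℕ) : Prop :=
  (t.1 = t'.1 ∧ (t.2 + 1 = t'.2 ∨ t'.2 + 1 = t.2)) ∨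
    (t.2 = t'.2 ∧ (t.1 + 1 = t'.1 ∨ t'.1 + 1 = t.1))

/-- The nine subblocks of a block. -/
def sub (b : ℕ × ℕ) (e : Fin 3 × Fin 3) : ℕ × ℕ := (3 * b.1 + e.1, 3 * b.2 + e.2)

/-- A block of level `n + 1` is good if at most one of its nine subblocks is not. -/
def Good (G : ℕ × ℕ → Prop) : ℕ → ℕ × ℕ → Prop
  | 0, b => G b
  | n + 1, b => ∀ e e', e ≠ e' → Good G n (sub b e) ∨ Good G n (sub b e')

/-- The tiles of a block that lie in good subblocks of all levels. -/
def core (G : ℕ × ℕ → Prop) : ℕ → ℕ × ℕ → Set (ℕ × ℕ)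
  | 0, b => {b}
  | n + 1, b => {t | ∃ e, Good G n (sub b e) ∧ t ∈ core G n (sub b e)}

/-- One step of the exploration of the three by three grid without the vertex `r`. -/
def explore (r : Fin 3 × Fin 3) (S : Finset (Fin 3 × Fin 3)) : Finset (Fin 3 × Fin 3) :=
  S ∪ Finset.univ.filter fun e => e ≠ r ∧ ∃ e' ∈ S,
    (e.1 = e'.1 ∧ (e.2.val + 1 = e'.2.val ∨ e'.2.val + 1 = e.2.val)) ∨
    (e.2 = e'.2 ∧ (e.1.val + 1 = e'.1.val ∨ e'.1.val + 1 = e.1.val))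

-- A finite check that removing one vertex leaves the grid connected; six steps of exploration
-- suffice from every starting vertex.
set_option maxRecDepth 10000 in
lemma mem_explore : ∀ r e₀ : Fin 3 × Fin 3, e₀ ≠ r → ∀ e, e ≠ r → e ∈ (explore r)^[6] {e₀} := by
  decide +kernel

lemma exists_third : ∀ e e' : Fin 3 × Fin 3, ∃ r, r ≠ e ∧ r ≠ e' := by decide

lemma adj_sub_of_adj (b : ℕ × ℕ) {e e' : Fin 3 × Fin 3}
    (h : (e.1 = e'.1 ∧ (e.2.val + 1 = e'.2.val ∨ e'.2.val + 1 = e.2.val)) ∨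
      (e.2 = e'.2 ∧ (e.1.val + 1 = e'.1.val ∨ e'.1.val + 1 = e.1.val))) :
    Adj (sub b e') (sub b e) := by
  simp only [Adj, sub]
  rcases h with ⟨h1, h2⟩ | ⟨h1, h2⟩
  · left; rw [h1]; omega
  · right; rw [h1]; omega

/-- The three by three grid without a vertex is connected. -/
lemma grid_spread {Gd L : Fin 3 × Fin 3 → Prop} (b : ℕ × ℕ) (h1 : ∀ e e', e ≠ e' → Gd e ∨ Gd e')
    (h2 : ∀ e e', Adj (sub b e) (sub b e') → Gd e → Gd e' → L e → L e')
    {e₀ : Fin 3 × Fin 3} (hG : Gd e₀) (hL : L e₀) (e : Fin 3 × Fin 3) (he : Gd e) : L e := by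
  obtain ⟨r, hr, hr0, hre⟩ : ∃ r, (∀ e, e ≠ r → Gd e) ∧ e₀ ≠ r ∧ e ≠ r := by
    by_cases h : ∃ r, ¬ Gd r
    · obtain ⟨r, hr⟩ := h
      exact ⟨r, fun e he => (h1 e r he).resolve_right hr, fun h => hr (h ▸ hG),
        fun h => hr (h ▸ he)⟩
    · push Not at h
      obtain ⟨r, h3, h4⟩ := exists_third e₀ e
      exact ⟨r, fun e _ => h e, h3.symm, h4.symm⟩
  have key : ∀ n, ∀ e ∈ (explore r)^[n] {e₀}, e ≠ r ∧ L e := by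
    intro n
    induction n with
    | zero =>
      intro e he
      obtain rfl : e = e₀ := by simpa using he
      exact ⟨hr0, hL⟩
    | succ n ih =>
      intro e he
      rw [Function.iterate_succ_apply', explore, Finset.mem_union, Finset.mem_filter] at he
      rcases he with he | ⟨-, her, e', he', hadj⟩
      · exact ih e he
      · obtain ⟨h5, h6⟩ := ih e' he'
        exact ⟨her, h2 e' e (adj_sub_of_adj b hadj) (hr e' h5) (hr e her) h6⟩
  exact (key 6 e (mem_explore r e₀ hr0 e hre)).2

/-- Neighbouring blocks have three disjoint pairs of neighbouring subblocks. -/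
lemma exists_pairs {b b' : ℕ × ℕ} (h : Adj b b') : ∃ f f' : Fin 3 → Fin 3 × Fin 3,
    Function.Injective f ∧ Function.Injective f' ∧ ∀ k, Adj (sub b (f k)) (sub b' (f' k)) := by
  have hi (a : Fin 3) : Function.Injective fun k : Fin 3 => (k, a) := fun _ _ h => (Prod.ext_iff.1 h).1
  have hi' (a : Fin 3) : Function.Injective fun k : Fin 3 => (a, k) := fun _ _ h => (Prod.ext_iff.1 h).2
  rcases h with ⟨h1, h2 | h2⟩ | ⟨h1, h2 | h2⟩
  · refine ⟨_, _, hi 2, hi 0, fun k => ?_⟩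
    simp only [Adj, sub, ← h2, h1]; left; simp; omega
  · refine ⟨_, _, hi 0, hi 2, fun k => ?_⟩
    simp only [Adj, sub, ← h2, h1]; left; simp; omega
  · refine ⟨_, _, hi' 2, hi' 0, fun k => ?_⟩
    simp only [Adj, sub, ← h2, h1]; right; simp; omega
  · refine ⟨_, _, hi' 0, hi' 2, fun k => ?_⟩
    simp only [Adj, sub, ← h2, h1]; right; simp; omega

/-- Each side spoils at most one of the three indices, so one index survives. This is why blocks are
divided into three along each side. -/
lemma exists_good_pair {A B : Fin 3 → Prop} (hA : ∀ k k', k ≠ k' → A k ∨ A k')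
    (hB : ∀ k k', k ≠ k' → B k ∨ B k') : ∃ k, A k ∧ B k := by
  have a01 := hA 0 1 (by decide)
  have a02 := hA 0 2 (by decide)
  have a12 := hA 1 2 (by decide)
  have b01 := hB 0 1 (by decide)
  have b02 := hB 0 2 (by decide)
  have b12 := hB 1 2 (by decide)
  by_contra h
  push Not at h
  have h0 := h 0
  have h1 := h 1
  have h2 := h 2
  tauto

section Spread

variable {G I : ℕ × ℕ → Prop}

/-- A spreading set of tiles that meets the core of a good block contains it, and then meets the
cores of the neighbouring good blocks. -/
lemma core_spread (hI : ∀ t t', I t → G t → Adj t t' → I t') (n : ℕ) :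
    (∀ b, Good G n b → (∃ t ∈ core G n b, I t) → ∀ t ∈ core G n b, I t) ∧
    (∀ b b', Good G n b → Good G n b' → Adj b b' → (∀ t ∈ core G n b, I t) →
      ∃ t ∈ core G n b', I t) := by
  induction n with
  | zero =>
    constructor
    · rintro b - ⟨t, ht, hIt⟩ t' ht'
      obtain rfl : t = b := ht
      obtain rfl : t' = t := ht'
      exact hIt
    · intro b b' hb _ hadj hall
      exact ⟨b', rfl, hI b b' (hall b rfl) hb hadj⟩
  | succ n ih =>
    obtain ⟨ihC, ihD⟩ := ih
    constructor
    · rintro b hb ⟨t, ⟨e₀, he₀, ht⟩, hIt⟩ t' ⟨e, he, ht'⟩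
      refine ihC _ he ?_ t' ht'
      -- The good subblocks are connected. Once the spreading set meets the core of one, it fills
      -- that core by `ihC` and meets the cores of its good neighbours by `ihD`.
      refine grid_spread (Gd := fun e => Good G n (sub b e))
        (L := fun e => ∃ t ∈ core G n (sub b e), I t) b hb ?_ he₀ ⟨t, ht, hIt⟩ e he
      intro e e' hadj he he' hL
      exact ihD _ _ he he' hadj (ihC _ he hL)
    · intro b b' hb hb' hadj hall
      obtain ⟨f, f', hf, hf', hff⟩ := exists_pairs hadj
      -- Some pair of subblocks that face each other across the common side is good on both sides;
      -- the spreading set crosses there.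
      obtain ⟨k, hk, hk'⟩ := exists_good_pair (A := fun k => Good G n (sub b (f k)))
        (B := fun k => Good G n (sub b' (f' k))) (fun k k' h => hb _ _ (hf.ne h))
        (fun k k' h => hb' _ _ (hf'.ne h))
      obtain ⟨t, ht, hIt⟩ := ihD _ _ hk hk' (hff k) fun t ht => hall t ⟨f k, hk, ht⟩
      exact ⟨t, ⟨f' k, hk', ht⟩, hIt⟩

lemma good_of_mem_core (n : ℕ) : ∀ b, Good G n b → ∀ t ∈ core G n b, G t := by
  induction n with
  | zero =>
    rintro b hb t ht
    obtain rfl : t = b := ht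
    exact hb
  | succ n ih =>
    rintro b - t ⟨e, he, ht⟩
    exact ih _ he t ht

lemma core_nonempty (n : ℕ) : ∀ b, Good G n b → (core G n b).Nonempty := by
  induction n with
  | zero => exact fun b _ => ⟨b, rfl⟩
  | succ n ih =>
    intro b hb
    rcases hb (0, 0) (0, 1) (by decide) with h | h
    · obtain ⟨t, ht⟩ := ih _ h
      exact ⟨t, _, h, ht⟩
    · obtain ⟨t, ht⟩ := ih _ h
      exact ⟨t, _, h, ht⟩

lemma le_of_mem_core (n : ℕ) : ∀ b, ∀ t ∈ core G n b, 3 ^ n * b.1 ≤ t.1 ∧ 3 ^ n * b.2 ≤ t.2 := by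
  induction n with
  | zero =>
    rintro b t ht
    obtain rfl : t = b := ht
    simp
  | succ n ih =>
    rintro b t ⟨e, -, ht⟩
    obtain ⟨h1, h2⟩ := ih _ t ht
    simp only [sub] at h1 h2
    rw [pow_succ, mul_assoc, mul_assoc]
    exact ⟨(Nat.mul_le_mul_left _ (Nat.le_add_right _ _)).trans h1,
      (Nat.mul_le_mul_left _ (Nat.le_add_right _ _)).trans h2⟩

/-- If the blocks of all levels at the origin are good, then a spreading set that contains the
origin contains infinitely many good tiles. -/
theorem infinite_of_good (hI : ∀ t t', I t → G t → Adj t t' → I t')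
    (hG : ∀ n, Good G n (0, 0)) (h0 : I (0, 0)) : {t | I t ∧ G t}.Infinite := by
  have hsub : sub (0, 0) (0, 0) = (0, 0) := rfl
  have hmem (n : ℕ) : (0, 0) ∈ core G n (0, 0) := by
    induction n with
    | zero => rfl
    | succ n ih => exact ⟨(0, 0), by rw [hsub]; exact hG n, by rw [hsub]; exact ih⟩
  have hall (n : ℕ) : ∀ t ∈ core G n (0, 0), I t :=
    (core_spread hI n).1 _ (hG n) ⟨_, hmem n, h0⟩
  intro hfin
  obtain ⟨N, hN⟩ := (hfin.image fun t => t.1 + t.2).bddAbove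
  -- At least one of two subblocks away from the origin is good, and its core lies at distance at
  -- least `3 ^ N > N`, beyond the supposed bound.
  obtain ⟨t, ht, hlarge⟩ : ∃ t ∈ core G (N + 1) (0, 0), 3 ^ N ≤ t.1 + t.2 := by
    rcases hG (N + 1) (1, 0) (0, 1) (by decide) with h | h
    · obtain ⟨t, ht⟩ := core_nonempty N _ h
      refine ⟨t, ⟨_, h, ht⟩, ?_⟩
      have := (le_of_mem_core N _ t ht).1
      simp [sub] at this
      omega
    · obtain ⟨t, ht⟩ := core_nonempty N _ h
      refine ⟨t, ⟨_, h, ht⟩, ?_⟩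
      have := (le_of_mem_core N _ t ht).2
      simp [sub] at this
      omega
  have h1 : t.1 + t.2 ≤ N :=
    hN ⟨t, ⟨hall _ t ht, good_of_mem_core _ _ (hG _) t ht⟩, rfl⟩
  have h2 : N < 3 ^ N := Nat.lt_pow_self (by norm_num)
  omega

end Spread

section Witness

/-- Sets of bad tiles, one of which is contained in every block that is not good. -/
def witness : ℕ → ℕ × ℕ → Finset (Finset (ℕ × ℕ))
  | 0, b => {{b}}
  | n + 1, b => (Finset.univ.filter fun p : (Fin 3 × Fin 3) × (Fin 3 × Fin 3) => p.1 ≠ p.2).biUnion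
      fun p => Finset.image₂ (· ∪ ·) (witness n (sub b p.1)) (witness n (sub b p.2))

lemma exists_witness {G : ℕ × ℕ → Prop} (n : ℕ) :
    ∀ b, ¬ Good G n b → ∃ w ∈ witness n b, ∀ t ∈ w, ¬ G t := by
  induction n with
  | zero => exact fun b hb => ⟨{b}, by simp [witness], by simpa [Good] using hb⟩
  | succ n ih =>
    intro b hb
    simp only [Good] at hb
    push Not at hb
    obtain ⟨e, e', hne, he, he'⟩ := hb
    obtain ⟨w, hw, h⟩ := ih _ he
    obtain ⟨w', hw', h'⟩ := ih _ he'
    refine ⟨w ∪ w', ?_, ?_⟩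
    · simp only [witness, Finset.mem_biUnion, Finset.mem_filter, Finset.mem_univ, true_and]
      exact ⟨(e, e'), hne, Finset.mem_image₂_of_mem hw hw'⟩
    · intro t ht
      rcases Finset.mem_union.1 ht with ht | ht
      · exact h t ht
      · exact h' t ht

/-- At most `9 ^ 2 = 81` pairs of subblocks give `a (n + 1) ≤ 81 * a n ^ 2`; the extra factor 81 in
the claim turns this into pure squaring. -/
lemma card_witness_le (n : ℕ) : ∀ b, 81 * (witness n b).card ≤ 81 ^ 2 ^ n := by
  induction n with
  | zero => intro b; simp [witness]
  | succ n ih =>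
    intro b
    have h1 : (witness (n + 1) b).card ≤ ∑ p ∈ (Finset.univ.filter
        fun p : (Fin 3 × Fin 3) × (Fin 3 × Fin 3) => p.1 ≠ p.2),
        (witness n (sub b p.1)).card * (witness n (sub b p.2)).card := by
      rw [witness]
      exact Finset.card_biUnion_le.trans (Finset.sum_le_sum fun p _ => Finset.card_image₂_le _ _ _)
    have h2 : ∑ p ∈ (Finset.univ.filter
        fun p : (Fin 3 × Fin 3) × (Fin 3 × Fin 3) => p.1 ≠ p.2),
        81 * (81 * ((witness n (sub b p.1)).card * (witness n (sub b p.2)).card)) ≤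
        ∑ _p ∈ (Finset.univ.filter
        fun p : (Fin 3 × Fin 3) × (Fin 3 × Fin 3) => p.1 ≠ p.2), 81 ^ 2 ^ (n + 1) := by
      refine Finset.sum_le_sum fun p _ => ?_
      calc 81 * (81 * ((witness n (sub b p.1)).card * (witness n (sub b p.2)).card))
          = (81 * (witness n (sub b p.1)).card) * (81 * (witness n (sub b p.2)).card) := by ring
        _ ≤ 81 ^ 2 ^ n * 81 ^ 2 ^ n := Nat.mul_le_mul (ih _) (ih _)
        _ = 81 ^ 2 ^ (n + 1) := by rw [← pow_add]; congr 1; ring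
    have h3 : (Finset.univ.filter
        fun p : (Fin 3 × Fin 3) × (Fin 3 × Fin 3) => p.1 ≠ p.2).card ≤ 81 := by decide +kernel
    rw [Finset.sum_const, smul_eq_mul, ← Finset.mul_sum, ← Finset.mul_sum] at h2
    have h4 := Nat.mul_le_mul_right (81 ^ 2 ^ (n + 1)) h3
    have h5 := Nat.mul_le_mul_left 81 (Nat.mul_le_mul_left 81 h1)
    omega

lemma mem_block_of_mem_witness (n : ℕ) : ∀ b, ∀ w ∈ witness n b, ∀ t ∈ w,
    t.1 / 3 ^ n = b.1 ∧ t.2 / 3 ^ n = b.2 := by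
  induction n with
  | zero =>
    intro b w hw t ht
    simp only [witness, Finset.mem_singleton] at hw
    subst hw
    obtain rfl : t = b := by simpa using ht
    simp
  | succ n ih =>
    intro b w hw t ht
    simp only [witness, Finset.mem_biUnion, Finset.mem_image₂] at hw
    obtain ⟨p, -, w₁, hw₁, w₂, hw₂, rfl⟩ := hw
    have key (e : Fin 3 × Fin 3) (h : t.1 / 3 ^ n = (sub b e).1 ∧ t.2 / 3 ^ n = (sub b e).2) :
        t.1 / 3 ^ (n + 1) = b.1 ∧ t.2 / 3 ^ (n + 1) = b.2 := by
      rw [pow_succ, ← Nat.div_div_eq_div_mul, ← Nat.div_div_eq_div_mul, h.1, h.2]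
      simp only [sub]
      omega
    rcases Finset.mem_union.1 ht with ht | ht
    · exact key _ (ih _ w₁ hw₁ t ht)
    · exact key _ (ih _ w₂ hw₂ t ht)

lemma sub_injective (b : ℕ × ℕ) : Function.Injective (sub b) := by
  intro e e' h
  simp only [sub, Prod.mk.injEq] at h
  ext <;> omega

/-- The two parts of a witness lie in different subblocks and are disjoint, so the size doubles at
each level. This outweighs the number of witnesses once the tiles are bad with small probability. -/
lemma card_of_mem_witness (n : ℕ) : ∀ b, ∀ w ∈ witness n b, w.card = 2 ^ n := by
  induction n with
  | zero =>
    intro b w hw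
    simp only [witness, Finset.mem_singleton] at hw
    simp [hw]
  | succ n ih =>
    intro b w hw
    simp only [witness, Finset.mem_biUnion, Finset.mem_image₂, Finset.mem_filter] at hw
    obtain ⟨p, ⟨-, hp⟩, w₁, hw₁, w₂, hw₂, rfl⟩ := hw
    rw [Finset.card_union_of_disjoint, ih _ _ hw₁, ih _ _ hw₂]
    · ring
    · refine Finset.disjoint_left.2 fun t h1 h2 => hp (sub_injective b ?_)
      have e1 := mem_block_of_mem_witness n _ w₁ hw₁ t h1
      have e2 := mem_block_of_mem_witness n _ w₂ hw₂ t h2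
      exact Prod.ext (e1.1.symm.trans e2.1) (e1.2.symm.trans e2.2)

/-- Union bound over the witnesses. -/
lemma measure_not_good_le {Ω : Type*} [MeasurableSpace Ω] {P : Measure Ω}
    {G : Ω → ℕ × ℕ → Prop} {p : ℝ≥0∞}
    (hp : ∀ w : Finset (ℕ × ℕ), P {ω | ∀ t ∈ w, ¬ G ω t} ≤ p ^ w.card) (n : ℕ) (b : ℕ × ℕ) :
    P {ω | ¬ Good (G ω) n b} ≤ (81 * p) ^ 2 ^ n := by
  have h1 : {ω | ¬ Good (G ω) n b} ⊆ ⋃ w ∈ witness n b, {ω | ∀ t ∈ w, ¬ G ω t} := by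
    intro ω hω
    obtain ⟨w, hw, h⟩ := exists_witness n b hω
    exact Set.mem_biUnion hw h
  calc P {ω | ¬ Good (G ω) n b} ≤ ∑ w ∈ witness n b, P {ω | ∀ t ∈ w, ¬ G ω t} :=
        (measure_mono h1).trans (measure_biUnion_finset_le _ _)
    _ ≤ ∑ w ∈ witness n b, p ^ 2 ^ n := Finset.sum_le_sum fun w hw =>
        (hp w).trans_eq (by rw [card_of_mem_witness n b w hw])
    _ = (witness n b).card * p ^ 2 ^ n := by rw [Finset.sum_const, nsmul_eq_mul]
    _ ≤ 81 ^ 2 ^ n * p ^ 2 ^ n := by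
        gcongr
        have := card_witness_le n b
        exact_mod_cast (Nat.le_mul_of_pos_left _ (by norm_num)).trans this
    _ = (81 * p) ^ 2 ^ n := (mul_pow _ _ _).symm

/-- Since `n + 1 ≤ 2 ^ n`, the failure probabilities are at most `8⁻¹ * 2⁻¹ ^ n`, and these sum to a
quarter. -/
lemma measure_exists_not_good_le {Ω : Type*} [MeasurableSpace Ω] {P : Measure Ω}
    {G : Ω → ℕ × ℕ → Prop} {p : ℝ≥0∞} (hp8 : 81 * p ≤ 8⁻¹)
    (hp : ∀ w : Finset (ℕ × ℕ), P {ω | ∀ t ∈ w, ¬ G ω t} ≤ p ^ w.card) :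
    P {ω | ∃ n, ¬ Good (G ω) n (0, 0)} ≤ 4⁻¹ := by
  have h8 : (8 : ℝ≥0∞)⁻¹ ≤ 2⁻¹ := ENNReal.inv_le_inv.2 (by norm_num)
  have h1 (n : ℕ) : (81 * p) ^ 2 ^ n ≤ 8⁻¹ * 2⁻¹ ^ n := by
    have hn : n + 1 ≤ 2 ^ n := Nat.lt_two_pow_self
    calc (81 * p) ^ 2 ^ n ≤ (8⁻¹) ^ 2 ^ n := by gcongr
      _ ≤ (8⁻¹) ^ (n + 1) := pow_le_pow_of_le_one zero_le (h8.trans (by simp)) hn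
      _ = 8⁻¹ * 8⁻¹ ^ n := pow_succ' _ _
      _ ≤ 8⁻¹ * 2⁻¹ ^ n := by gcongr
  rw [Set.ofPred_exists]
  calc P (⋃ n, {ω | ¬ Good (G ω) n (0, 0)}) ≤ ∑' n, P {ω | ¬ Good (G ω) n (0, 0)} :=
        measure_iUnion_le _
    _ ≤ ∑' n, 8⁻¹ * 2⁻¹ ^ n := ENNReal.tsum_le_tsum fun n =>
        (measure_not_good_le hp n _).trans (h1 n)
    _ = 4⁻¹ := by
        rw [ENNReal.tsum_mul_left, ENNReal.tsum_geometric_two,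
          show (8 : ℝ≥0∞) = 4 * 2 by norm_num, ENNReal.mul_inv (by simp) (by simp), mul_assoc,
          ENNReal.inv_mul_cancel (by simp) (by simp), mul_one]

end Witness

end Block

/-! ### Tails of Poisson counts. -/

/-- The law of the counts in disjoint sets, for the event that all of them are small. -/
lemma IsMecke.measure_forall_lt {m : Measure User} {Q : Measure (Measure User)}
    [IsProbabilityMeasure Q] (h : IsMecke m Q) {ι : Type*} [Fintype ι] {C : ι → Set User}
    (hC : ∀ a, MeasurableSet (C a)) (hd : Pairwise fun a b => Disjoint (C a) (C b))
    (hm : ∀ a, m (C a) ≠ ∞) (N : ℕ) :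
    Q {μ | ∀ a, μ (C a) < N} = ∏ a, poissonMeasure (m (C a)).toNNReal {k | k < N} := by
  have hev : Measurable fun (μ : Measure User) a => μ (C a) :=
    measurable_pi_lambda _ fun a => Measure.measurable_coe (hC a)
  have hS : MeasurableSet (Set.univ.pi fun _ : ι => Set.Iio (N : ℝ≥0∞)) :=
    MeasurableSet.univ_pi fun _ => measurableSet_Iio
  have h1 : {μ : Measure User | ∀ a, μ (C a) < N} =
      (fun μ a => μ (C a)) ⁻¹' (Set.univ.pi fun _ : ι => Set.Iio (N : ℝ≥0∞)) := by
    ext μ; simp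
  rw [h1, ← Measure.map_apply hev hS, h.map_counts hC hd hm,
    Measure.map_apply (by fun_prop) hS]
  have h2 : (fun (n : ι → ℕ) a => (n a : ℝ≥0∞)) ⁻¹' (Set.univ.pi fun _ : ι => Set.Iio (N : ℝ≥0∞)) =
      Set.univ.pi fun _ : ι => {k : ℕ | k < N} := by
    ext n; simp
  rw [h2, Measure.pi_pi]

/-- A Poisson variable with a large mean is large with high probability. -/
lemma exists_poissonMeasure_lt_le (N : ℕ) {ε : ℝ≥0∞} (hε : 0 < ε) :
    ∃ r₀ : ℝ≥0, ∀ r, r₀ ≤ r → poissonMeasure r {k | k < N} ≤ ε := by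
  have h1 (r : ℝ≥0) : poissonMeasure r {k | k < N} =
      ∑ k ∈ Finset.range N, ENNReal.ofReal (Real.exp (-r) * r ^ k / k.factorial) := by
    have : {k | k < N} = (Finset.range N : Set ℕ) := by ext; simp
    rw [this, ← sum_measure_singleton]
    exact Finset.sum_congr rfl fun k _ => poissonMeasure_singleton r k
  have h2 : Filter.Tendsto (fun r : ℝ≥0 => ∑ k ∈ Finset.range N,
      ENNReal.ofReal (Real.exp (-r) * r ^ k / k.factorial)) Filter.atTop (nhds 0) := by
    rw [← Finset.sum_const_zero (s := Finset.range N)]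
    refine tendsto_finsetSum _ fun k _ => ?_
    rw [← ENNReal.ofReal_zero]
    refine ENNReal.tendsto_ofReal ?_
    have h3 := ((Real.tendsto_pow_mul_exp_neg_atTop_nhds_zero k).div_const (k.factorial : ℝ)).comp
      (NNReal.tendsto_coe_atTop.2 Filter.tendsto_id)
    rw [zero_div] at h3
    refine h3.congr fun r => ?_
    simp only [Function.comp_apply, id]
    ring
  obtain ⟨r₀, hr₀⟩ := Filter.eventually_atTop.1 (h2.eventually (ge_mem_nhds hε))
  exact ⟨r₀, fun r hr => (h1 r).trans_le (hr₀ r hr)⟩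

/-! ### Ignition of tiles. -/

namespace PowerControl

variable {c : PowerControl}

lemma mul_le_required {μ : Measure User} {q : User → ℝ≥0∞} {i : User} {A : Set User}
    (hA : MeasurableSet A) {K : ℝ≥0∞} (h : ∀ᵐ j ∂μ, j ∈ A → j ≠ i ∧ K ≤ c.gain j i * q j) :
    K * μ A ≤ c.required μ q i := by
  rw [← setLIntegral_const, required]
  refine le_trans (lintegral_mono_ae ?_) (setLIntegral_le_lintegral A _)
  rw [ae_restrict_iff' hA]
  filter_upwards [h] with j hj hjA
  rw [if_neg (hj hjA).1]
  exact (hj hjA).2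

lemma threshold_le_realize (hM : (c.threshold : ℝ≥0∞) ≤ c.maxIncrease) {v : ℝ≥0∞}
    (hv : (c.threshold : ℝ≥0∞) < v) : (c.threshold : ℝ≥0∞) ≤ c.realize v := by
  rw [realize, if_pos hv]
  exact le_min hv.le hM

lemma pathLoss_anti (hα : 0 < c.exponent) {s s' : ℝ} (h : s ≤ s') :
    c.pathLoss s' ≤ c.pathLoss s :=
  ENNReal.inv_le_inv.2 (ENNReal.rpow_le_rpow (ENNReal.ofReal_le_ofReal h) hα.le)

lemma le_gain (hα : 0 < c.exponent) {d s : ℝ} (hd : 0 < d) (hs : 0 < s) {j i : User}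
    (hi : ‖i.2‖ = d) (hji : dist j.1 (i.1 + i.2) ≤ s) :
    ENNReal.ofReal (c.sinr * (d / s) ^ c.exponent) ≤ c.gain j i := by
  have h1 : dist i.tx i.rx = d := by
    simp only [User.tx, User.rx, dist_self_add_right, hi]
  have h2 : ENNReal.ofReal (c.sinr * (d / s) ^ c.exponent) =
      c.sinr * c.pathLoss s / c.pathLoss d := by
    rw [pathLoss, pathLoss, ENNReal.ofReal_rpow_of_pos hs, ENNReal.ofReal_rpow_of_pos hd,
      div_eq_mul_inv (_ * _) (_⁻¹), inv_inv, ENNReal.ofReal_mul (by positivity),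
      Real.div_rpow hd.le hs.le, ENNReal.ofReal_div_of_pos (by positivity), div_eq_mul_inv,
      ENNReal.ofReal_coe_nnreal]
    ring
  rw [h2, gain, h1]
  gcongr
  exact pathLoss_anti hα hji

/-- All users of the tile `t` with link length `d` have changed their power by at least `δ'`
in some round. -/
def Ignited (c : PowerControl) (d : ℝ) (δ' : ℝ≥0) (μ : Measure User) (x : User) (t : ℕ × ℕ) : Prop :=
  ∃ n, ∀ i ∈ userCell ((t.1 : ℤ), (t.2 : ℤ)), ‖i.2‖ = d → (δ' : ℝ≥0∞) ≤ c.power μ x n i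

/-- Taking `δ'` below both `δ` and `Δ` spares a case distinction later: the initial user always has
`Δ`, and any other user that reacts realises at least `δ` because `δ ≤ M`. -/
lemma le_power_succ {μ : Measure User} {x i : User} {n : ℕ} {δ' : ℝ≥0}
    (hM : (c.threshold : ℝ≥0∞) ≤ c.maxIncrease)
    (h1 : δ' ≤ c.threshold) (h2 : δ' ≤ c.update)
    (h : i ≠ x → (c.threshold : ℝ≥0∞) < c.required μ (c.power μ x n) i) :
    (δ' : ℝ≥0∞) ≤ c.power μ x (n + 1) i := by
  by_cases hi : i = x
  · subst hi
    rw [power_self]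
    exact_mod_cast h2
  · rw [power_succ_of_ne hi]
    exact le_trans (by exact_mod_cast h1) (threshold_le_realize hM (h hi))

lemma dist_le_three_of_adj {t t' : ℕ × ℕ} (h : Block.Adj t t') {i j : User}
    (hj : j ∈ userCell ((t.1 : ℤ), (t.2 : ℤ))) (hi : i ∈ userCell ((t'.1 : ℤ), (t'.2 : ℤ))) :
    dist j.1 i.1 ≤ 3 := by
  simp only [userCell, Set.mem_ofPred_eq, Int.floor_eq_iff, Int.cast_natCast] at hi hj
  obtain ⟨⟨a1, a2⟩, a3, a4⟩ := hj
  obtain ⟨⟨b1, b2⟩, b3, b4⟩ := hi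
  have h1 : |(t.1 : ℝ) - t'.1| ≤ 1 ∧ |(t.2 : ℝ) - t'.2| ≤ 1 ∧ ((t.1 : ℝ) = t'.1 ∨ (t.2 : ℝ) = t'.2) := by
    rcases h with ⟨e, e' | e'⟩ | ⟨e, e' | e'⟩ <;> rw [← e', e] <;> push_cast <;> simp
  obtain ⟨h1, h2, h3⟩ := h1
  rw [abs_le] at h1 h2
  rw [EuclideanSpace.dist_eq, Fin.sum_univ_two]
  refine Real.sqrt_le_iff.2 ⟨by norm_num, ?_⟩
  rw [Real.dist_eq, Real.dist_eq, sq_abs, sq_abs]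
  have c1 : (j.1 0 - i.1 0) ^ 2 ≤ 2 ^ 2 := sq_le_sq' (by linarith) (by linarith)
  have c2 : (j.1 1 - i.1 1) ^ 2 ≤ 2 ^ 2 := sq_le_sq' (by linarith) (by linarith)
  linarith

section Ignition

variable {d : ℝ} {δ' g : ℝ≥0} {N : ℕ} {μ : Measure User} {x : User}

/-- Each of at least `N` users in tile `t` contributes at least `g * δ'` to every user of the
neighbouring tile, and `N` copies exceed the threshold. -/
lemma ignited_of_adj (hM : (c.threshold : ℝ≥0∞) ≤ c.maxIncrease)
    (hδ1 : δ' ≤ c.threshold) (hδ2 : δ' ≤ c.update)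
    (hg : ∀ j i : User, ‖i.2‖ = d → dist j.1 i.1 ≤ 3 → (g : ℝ≥0∞) ≤ c.gain j i)
    (hN : c.threshold < g * δ' * N)
    (hμ : ∀ᵐ i ∂μ, ‖i.2‖ = d) {t t' : ℕ × ℕ} (ht : Ignited c d δ' μ x t)
    (hG : (N : ℝ≥0∞) ≤ μ (userCell ((t.1 : ℤ), (t.2 : ℤ)))) (hadj : Block.Adj t t') :
    Ignited c d δ' μ x t' := by
  obtain ⟨n, hn⟩ := ht
  refine ⟨n + 1, fun i hi hid => le_power_succ hM hδ1 hδ2 fun _ => ?_⟩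
  have hne : ((t.1 : ℤ), (t.2 : ℤ)) ≠ ((t'.1 : ℤ), (t'.2 : ℤ)) := by
    rcases hadj with ⟨e, e' | e'⟩ | ⟨e, e' | e'⟩ <;> simp only [ne_eq, Prod.mk.injEq] <;> omega
  have key : ((g * δ' : ℝ≥0) : ℝ≥0∞) * μ (userCell ((t.1 : ℤ), (t.2 : ℤ))) ≤
      c.required μ (c.power μ x n) i := by
    refine mul_le_required (measurableSet_userCell _) ?_
    filter_upwards [hμ] with j hjd hj
    refine ⟨?_, ?_⟩
    · rintro rfl
      exact Set.disjoint_left.1 (pairwise_disjoint_userCell hne) hj hi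
    · rw [ENNReal.coe_mul]
      exact mul_le_mul' (hg j i hid (dist_le_three_of_adj hadj hj hi)) (hn j hj hjd)
  refine lt_of_lt_of_le ?_ (le_trans (mul_le_mul_right hG _) key)
  exact_mod_cast hN

/-- Ignition takes two rounds: `x` alone triggers every user of `A` with link length `d`, and then
the `N` or more users of `A` together trigger the tile at the origin. -/
lemma ignited_zero (hM : (c.threshold : ℝ≥0∞) ≤ c.maxIncrease)
    (hδ1 : δ' ≤ c.threshold) (hδ2 : δ' ≤ c.update)
    (hg : ∀ j i : User, ‖i.2‖ = d → dist j.1 i.1 ≤ 3 → (g : ℝ≥0∞) ≤ c.gain j i)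
    (hN : c.threshold < g * δ' * N)
    (hμ : ∀ᵐ i ∂μ, ‖i.2‖ = d) {A : Set User} (hA : MeasurableSet A)
    (hAx : ∀ i ∈ A, ‖i.2‖ = d → (c.threshold : ℝ≥0∞) < c.gain x i * c.update)
    (hA0 : ∀ i ∈ A, ‖i.1‖ ≤ 1) (hNA : (N : ℝ≥0∞) ≤ μ A) (hx : 1 ≤ μ {x}) :
    Ignited c d δ' μ x (0, 0) := by
  have h1 : ∀ i ∈ A, ‖i.2‖ = d → (δ' : ℝ≥0∞) ≤ c.power μ x 1 i := by
    intro i hi hid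
    refine le_power_succ hM hδ1 hδ2 fun hix => (hAx i hi hid).trans_le ?_
    refine le_trans ?_ (mul_le_required (μ := μ) (K := c.gain x i * c.update) (measurableSet_singleton x)
      (Filter.Eventually.of_forall fun j hj => ?_))
    · exact le_mul_of_one_le_right' hx
    · obtain rfl : j = x := hj
      exact ⟨hix.symm, by rw [power_self]⟩
  refine ⟨2, fun i hi hid => ?_⟩
  -- A user does not contribute to its own requirement, so users of `A` are carried over by
  -- monotonicity in the rounds instead.
  by_cases hiA : i ∈ A
  · exact (h1 i hiA hid).trans (power_le_succ μ x 1 i)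
  · refine le_power_succ hM hδ1 hδ2 fun _ => ?_
    have key : ((g * δ' : ℝ≥0) : ℝ≥0∞) * μ A ≤ c.required μ (c.power μ x 1) i := by
      refine mul_le_required hA ?_
      filter_upwards [hμ] with j hjd hj
      refine ⟨fun h => hiA (h ▸ hj), ?_⟩
      rw [ENNReal.coe_mul]
      refine mul_le_mul' (hg j i hid ?_) (h1 j hj hjd)
      have hi1 : ‖i.1‖ ≤ 2 := by
        simp only [userCell, Set.mem_ofPred_eq, Int.floor_eq_iff] at hi
        obtain ⟨⟨b1, b2⟩, b3, b4⟩ := hi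
        simp at b1 b2 b3 b4
        rw [EuclideanSpace.norm_eq, Fin.sum_univ_two]
        refine Real.sqrt_le_iff.2 ⟨by norm_num, ?_⟩
        rw [Real.norm_eq_abs, Real.norm_eq_abs, sq_abs, sq_abs]
        nlinarith
      calc dist j.1 i.1 ≤ ‖j.1‖ + ‖i.1‖ := dist_le_norm_add_norm _ _
        _ ≤ 3 := by linarith [hA0 j hj]
    refine lt_of_lt_of_le ?_ (le_trans (mul_le_mul_right hNA _) key)
    exact_mod_cast hN

/-- Infinitely many disjoint ignited tiles carry mass at least one each, and almost all of that mass
belongs to reached users. -/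
lemma reach_eq_top (hδ0 : 0 < δ') (hN0 : 1 ≤ N) (hμ : ∀ᵐ i ∂μ, ‖i.2‖ = d)
    (hinf : {t : ℕ × ℕ | Ignited c d δ' μ x t ∧
      (N : ℝ≥0∞) ≤ μ (userCell ((t.1 : ℤ), (t.2 : ℤ)))}.Infinite) :
    μ (c.reach μ x) = ∞ := by
  set T := {t : ℕ × ℕ | Ignited c d δ' μ x t ∧
      (N : ℝ≥0∞) ≤ μ (userCell ((t.1 : ℤ), (t.2 : ℤ)))} with hT
  let C (t : ℕ × ℕ) : Set User := userCell ((t.1 : ℤ), (t.2 : ℤ))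
  have hdisj : Pairwise (Function.onFun Disjoint C) := by
    intro t t' h
    refine pairwise_disjoint_userCell fun h' => h ?_
    simp only [Prod.mk.injEq, Nat.cast_inj] at h'
    exact Prod.ext h'.1 h'.2
  -- The initial user does not count as reached; at most one tile contains it, and that tile is
  -- dropped.
  have hT' : (T \ {t | x ∈ C t}).Infinite := by
    refine hinf.sdiff (Set.Subsingleton.finite fun t ht t' ht' => ?_)
    by_contra hne
    exact Set.disjoint_left.1 (hdisj hne) ht ht'
  have := hT'.to_subtype
  have h1 : μ (⋃ t : (T \ {t | x ∈ C t} : Set (ℕ × ℕ)), C t) = ∞ := by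
    have hd' : Pairwise (Function.onFun Disjoint
        fun t : (T \ {t | x ∈ C t} : Set (ℕ × ℕ)) => C t) :=
      fun t t' h => hdisj (Subtype.coe_injective.ne h)
    rw [measure_iUnion hd' (fun t => measurableSet_userCell _)]
    refine top_unique ?_
    rw [← ENNReal.tsum_const_eq_top_of_ne_zero (α := (T \ {t | x ∈ C t} : Set (ℕ × ℕ))) one_ne_zero]
    refine ENNReal.tsum_le_tsum fun t => ?_
    exact le_trans (by exact_mod_cast hN0) t.2.1.2
  refine top_unique ?_
  rw [← h1]
  refine measure_mono_ae ?_
  filter_upwards [hμ] with i hid hi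
  obtain ⟨t, ht⟩ := Set.mem_iUnion.1 hi
  obtain ⟨n, hn⟩ := t.2.1.1
  refine ⟨?_, n, ?_⟩
  · rintro rfl
    exact t.2.2 ht
  · have := hn i ht hid
    intro h0
    rw [h0] at this
    simp at this
    exact hδ0.ne' this

end Ignition

end PowerControl

/-! ### Infinite propagation at high density. -/

lemma ae_norm_userIntensity {ν : Measure Plane} [IsProbabilityMeasure ν] {d : ℝ}
    (hν : ∀ᵐ w ∂ν, ‖w‖ = d) (lam : ℝ≥0) : ∀ᵐ i ∂(userIntensity ν lam), ‖i.2‖ = d :=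
  Measure.ae_smul_measure (Measure.quasiMeasurePreserving_snd.ae hν) _

lemma measurableSet_norm_eq (d : ℝ) : MeasurableSet {i : User | ‖i.2‖ = d} := by
  have : Measurable fun i : User => ‖i.2‖ := by fun_prop
  exact this (measurableSet_singleton d)

lemma ae_norm_poissonLaw {ν : Measure Plane} [IsProbabilityMeasure ν] {d : ℝ}
    (hν : ∀ᵐ w ∂ν, ‖w‖ = d) (lam : ℝ≥0) :
    ∀ᵐ μ ∂(poissonLaw ν lam), ∀ᵐ i ∂μ, ‖i.2‖ = d := by
  have h := (isMecke_poissonLaw ν lam).lintegral_apply (measurableSet_norm_eq d).compl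
  rw [show userIntensity ν lam {i | ‖i.2‖ = d}ᶜ = 0 from ae_norm_userIntensity hν lam,
    lintegral_eq_zero_iff (Measure.measurable_coe (measurableSet_norm_eq d).compl)] at h
  exact h

namespace PowerControl

variable (c : PowerControl) (ν : Measure Plane) [IsProbabilityMeasure ν] (lam : ℝ≥0)

lemma measurableSet_reach_eq_top :
    MeasurableSet {q : User × Measure User | pts q.2 (c.reach (pts q.2) q.1) = ∞} :=
  c.measurable_reach (f := fun q : User × Measure User => q.2) (f' := fun q => q.2)
    (g := fun q => q.1) measurable_snd measurable_snd measurable_fst (measurableSet_singleton ∞)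

/-- The Mecke equation for the expected number of users whose update affects infinitely many
users. -/
lemma lintegral_reach_eq_top :
    ∫⁻ μ, pts μ {x | pts μ (c.reach (pts μ) x) = ∞} ∂(poissonLaw ν lam) =
      ∫⁻ x, poissonLaw ν lam {μ | pts (μ + Measure.dirac x)
        (c.reach (pts (μ + Measure.dirac x)) x) = ∞} ∂(userIntensity ν lam) := by
  have h := (isMecke_poissonLaw ν lam).mecke
    (fun x μ => {q : User × Measure User | pts q.2 (c.reach (pts q.2) q.1) = ∞}.indicator 1 (x, μ))
    (measurable_one.indicator c.measurableSet_reach_eq_top)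
  have h1 (μ : Measure User) : ∫⁻ x, {q : User × Measure User |
      pts q.2 (c.reach (pts q.2) q.1) = ∞}.indicator (1 : User × Measure User → ℝ≥0∞) (x, μ) ∂(pts μ) =
      pts μ {x | pts μ (c.reach (pts μ) x) = ∞} := by
    rw [← lintegral_indicator_one (c.measurableSet_setOf_reach_eq_top μ)]
    rfl
  have h2 (x : User) : ∫⁻ μ, {q : User × Measure User |
      pts q.2 (c.reach (pts q.2) q.1) = ∞}.indicator (1 : User × Measure User → ℝ≥0∞) (x, μ + Measure.dirac x)
        ∂(poissonLaw ν lam) =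
      poissonLaw ν lam {μ | pts (μ + Measure.dirac x)
        (c.reach (pts (μ + Measure.dirac x)) x) = ∞} := by
    have hm : Measurable fun μ : Measure User => (x, μ + Measure.dirac x) := by fun_prop
    exact lintegral_indicator_one (hm c.measurableSet_reach_eq_top)
  simp_rw [h1, h2] at h
  exact h

/-- Reduces percolation to an expectation, which the Mecke equation can evaluate by planting the
initial user. -/
lemma poissonLaw_percolating_eq_zero_iff : poissonLaw ν lam c.percolating = 0 ↔
    ∫⁻ μ, pts μ {x | pts μ (c.reach (pts μ) x) = ∞} ∂(poissonLaw ν lam) = 0 := by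
  have hm : Measurable fun μ : Measure User => pts μ {x | pts μ (c.reach (pts μ) x) = ∞} := by
    have h1 : (fun μ : Measure User => pts μ {x | pts μ (c.reach (pts μ) x) = ∞}) = fun μ =>
        ∫⁻ x, {x | pts μ (c.reach (pts μ) x) = ∞}.indicator 1 x ∂(pts μ) := by
      ext μ
      rw [lintegral_indicator_one (c.measurableSet_setOf_reach_eq_top μ)]
    rw [h1]
    exact measurable_lintegral_pts_self (F := fun x μ =>
      {q : User × Measure User | pts q.2 (c.reach (pts q.2) q.1) = ∞}.indicator 1 (x, μ))
      (measurable_one.indicator c.measurableSet_reach_eq_top)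
  rw [lintegral_eq_zero_iff hm, Filter.EventuallyEq, ae_iff]
  rfl

variable {c ν}

lemma poissonLaw_not_good_le {N : ℕ} {p : ℝ≥0∞}
    (hp : poissonMeasure lam {k | k < N} ≤ p) (w : Finset (ℕ × ℕ)) :
    poissonLaw ν lam {μ | ∀ t ∈ w, ¬ (N : ℝ≥0∞) ≤ μ (userCell ((t.1 : ℤ), (t.2 : ℤ)))} ≤
      p ^ w.card := by
  have h := (isMecke_poissonLaw ν lam).measure_forall_lt (ι := w)
    (C := fun t => userCell ((t.1.1 : ℤ), (t.1.2 : ℤ))) (fun _ => measurableSet_userCell _)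
    (fun t t' h => pairwise_disjoint_userCell fun h' => h ?_)
    (fun _ => userIntensity_userCell_ne_top ν lam _) N
  · have h1 : {μ : Measure User | ∀ t ∈ w, ¬ (N : ℝ≥0∞) ≤ μ (userCell ((t.1 : ℤ), (t.2 : ℤ)))} =
        {μ : Measure User | ∀ t : w, μ (userCell ((t.1.1 : ℤ), (t.1.2 : ℤ))) < (N : ℝ≥0∞)} := by
      ext μ; simp
    rw [h1, h]
    simp only [userIntensity_userCell, ENNReal.toNNReal_coe, Finset.prod_const, Finset.card_univ,
      Fintype.card_coe]
    gcongr
  · simp only [Prod.mk.injEq, Nat.cast_inj] at h'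
    exact Subtype.ext (Prod.ext h'.1 h'.2)

/-- At high density the propagation of change is infinite. -/
theorem exists_poissonLaw_percolating (hα : 0 < c.exponent) (hβ : 0 < c.sinr)
    (hδ : 0 < c.threshold) (hΔ : 0 < c.update) (hM : (c.threshold : ℝ≥0∞) ≤ c.maxIncrease)
    {d : ℝ} (hd : 0 < d) (hν : ∀ᵐ w ∂ν, ‖w‖ = d) :
    ∃ lam, poissonLaw ν lam c.percolating = 1 := by
  -- the gain between neighbouring tiles
  obtain ⟨g, hg0, hg⟩ : ∃ g : ℝ≥0, 0 < g ∧
      ∀ j i : User, ‖i.2‖ = d → dist j.1 i.1 ≤ 3 → (g : ℝ≥0∞) ≤ c.gain j i := by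
    refine ⟨(c.sinr * (d / (3 + d)) ^ c.exponent : ℝ).toNNReal, ?_, fun j i hi hji => ?_⟩
    · rw [Real.toNNReal_pos]; positivity
    · refine le_gain hα hd (by positivity) hi ?_
      calc dist j.1 (i.1 + i.2) ≤ dist j.1 i.1 + dist i.1 (i.1 + i.2) := dist_triangle _ _ _
        _ ≤ 3 + d := by rw [dist_self_add_right, hi]; linarith
  set δ' := min c.threshold c.update with hδ'
  have hδ'0 : 0 < δ' := lt_min hδ hΔ
  obtain ⟨N, hN⟩ : ∃ N : ℕ, c.threshold < g * δ' * N := by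
    obtain ⟨N, hN⟩ := exists_nat_gt (c.threshold / (g * δ'))
    exact ⟨N, by rwa [div_lt_iff₀' (by positivity)] at hN⟩
  have hN1 : 1 ≤ N := by
    rcases Nat.eq_zero_or_pos N with rfl | h
    · simp at hN
    · exact h
  -- the gain of an update at short distance
  obtain ⟨s, hs, hgs⟩ : ∃ s : ℝ, 0 < s ∧
      (c.threshold : ℝ) < c.sinr * (d / s) ^ c.exponent * c.update := by
    -- With `s = d / y` the increase caused by `x` at distance `s` is exactly twice the threshold.
    set y : ℝ := (2 * c.threshold / (c.sinr * c.update)) ^ (c.exponent⁻¹) with hy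
    have hy0 : 0 < y := by positivity
    refine ⟨d / y, by positivity, ?_⟩
    rw [div_div_cancel₀ hd.ne', hy, Real.rpow_inv_rpow (by positivity) hα.ne']
    have h1 : (0 : ℝ) < c.sinr := hβ
    have h2 : (0 : ℝ) < c.update := hΔ
    have h3 : (0 : ℝ) < c.threshold := hδ
    field_simp
    linarith
  -- Three errors below `s / 3` add up to less than `s`, and the bound 1 keeps the users of `A`
  -- within reach of the tile at the origin.
  set ρ := min (s / 3) 1 with hρ
  have hρ0 : 0 < ρ := by positivity
  -- A point of the support of `ν`: every neighbourhood of `w₀` has positive probability as a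
  -- displacement.
  obtain ⟨w₀, -, hw₀⟩ := exists_mem_forall_mem_nhdsWithin_pos_measure (μ := ν) (s := Set.univ)
    (by simp)
  have hw : 0 < ν (Metric.ball w₀ ρ) :=
    hw₀ _ (by rw [nhdsWithin_univ]; exact Metric.ball_mem_nhds _ hρ0)
  -- Users of `A` transmit near the origin and receive near `w₀`. Users of `X` transmit near `w₀`,
  -- hence close to all those receivers.
  set A : Set User := Metric.ball 0 ρ ×ˢ Metric.ball w₀ ρ with hA
  set X : Set User := Metric.ball w₀ ρ ×ˢ Set.univ with hX
  have hAm : MeasurableSet A := measurableSet_ball.prod measurableSet_ball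
  have hXm : MeasurableSet X := measurableSet_ball.prod MeasurableSet.univ
  have hAX : ∀ x ∈ X, ∀ i ∈ A, ‖i.2‖ = d → (c.threshold : ℝ≥0∞) < c.gain x i * c.update := by
    intro x hx i hi hid
    have hdist : dist x.1 (i.1 + i.2) ≤ s := by
      have e1 : dist x.1 w₀ < ρ := hx.1
      have e2 : dist i.1 0 < ρ := hi.1
      have e3 : dist i.2 w₀ < ρ := hi.2
      have e4 : dist w₀ (i.1 + i.2) ≤ dist i.1 0 + dist i.2 w₀ := by
        have := dist_add_add_le i.1 i.2 0 w₀
        rwa [zero_add, dist_comm _ w₀] at this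
      have e5 : ρ ≤ s / 3 := min_le_left _ _
      linarith [dist_triangle x.1 w₀ (i.1 + i.2)]
    refine lt_of_lt_of_le ?_ (mul_le_mul_left (le_gain hα hd hs hid hdist) _)
    rw [← ENNReal.ofReal_coe_nnreal, ← ENNReal.ofReal_coe_nnreal, ← ENNReal.ofReal_mul (by positivity)]
    exact (ENNReal.ofReal_lt_ofReal_iff (lt_of_le_of_lt (by positivity) hgs)).2 hgs
  -- the density
  have hvol : 0 < (volume : Measure Plane) (Metric.ball 0 ρ) := Metric.measure_ball_pos _ _ hρ0
  have hvol' : (volume : Measure Plane) (Metric.ball 0 ρ) ≠ ∞ := measure_ball_lt_top.ne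
  set κ := (volume : Measure Plane) (Metric.ball 0 ρ) * ν (Metric.ball w₀ ρ) with hκ
  have hκ0 : κ ≠ 0 := mul_ne_zero hvol.ne' hw.ne'
  have hκt : κ ≠ ∞ := ENNReal.mul_ne_top hvol' (measure_ne_top _ _)
  -- Here `648 = 81 * 8` meets the requirement `81 * p ≤ 8⁻¹` of the block estimate.
  obtain ⟨r₁, hr₁⟩ := exists_poissonMeasure_lt_le N (ε := 648⁻¹) (by simp)
  obtain ⟨r₂, hr₂⟩ := exists_poissonMeasure_lt_le N (ε := 4⁻¹) (by simp)
  set lam : ℝ≥0 := max (max r₁ 1) (r₂ / κ.toNNReal) with hlam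
  refine ⟨lam, ?_⟩
  set Q := poissonLaw ν lam with hQ
  have hκ' : 0 < κ.toNNReal := ENNReal.toNNReal_pos hκ0 hκt
  have hlam0 : lam ≠ 0 :=
    (zero_lt_one.trans_le ((le_max_right r₁ 1).trans (le_max_left _ _))).ne'
  have hb1 : Q {μ | μ A < N} ≤ 4⁻¹ := by
    have hmA : userIntensity ν lam A = lam * κ := userIntensity_prod ν lam _ _
    have h := (isMecke_poissonLaw ν lam).measure_forall_lt (ι := Unit) (C := fun _ => A)
      (fun _ => hAm) (fun a b hab => absurd rfl hab)
      (fun _ => by rw [hmA]; finiteness) N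
    simp only [forall_const, Finset.univ_unique, Finset.prod_singleton] at h
    rw [hQ, h]
    refine hr₂ _ ?_
    rw [hmA, ENNReal.toNNReal_mul, ENNReal.toNNReal_coe]
    calc r₂ = r₂ / κ.toNNReal * κ.toNNReal := (div_mul_cancel₀ _ hκ'.ne').symm
      _ ≤ lam * κ.toNNReal := by gcongr; exact le_max_right _ _
  have hb2 : Q {μ | ∃ n, ¬ Block.Good (fun t : ℕ × ℕ =>
      (N : ℝ≥0∞) ≤ μ (userCell ((t.1 : ℤ), (t.2 : ℤ)))) n (0, 0)} ≤ 4⁻¹ := by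
    refine Block.measure_exists_not_good_le (p := 648⁻¹)
      (G := fun (μ : Measure User) (t : ℕ × ℕ) => (N : ℝ≥0∞) ≤ μ (userCell ((t.1 : ℤ), (t.2 : ℤ)))) ?_ ?_
    · rw [show (648 : ℝ≥0∞) = 81 * 8 by norm_num, ENNReal.mul_inv (by simp) (by simp),
        ← mul_assoc, ENNReal.mul_inv_cancel (by simp) (by simp), one_mul]
    · exact poissonLaw_not_good_le lam (hr₁ _ ((le_max_left r₁ 1).trans (le_max_left _ _)))
  set E : Set (Measure User) := {μ | (LocFin μ ∧ ∀ᵐ i ∂μ, ‖i.2‖ = d) ∧ (N : ℝ≥0∞) ≤ μ A ∧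
    ∀ n, Block.Good (fun t : ℕ × ℕ =>
      (N : ℝ≥0∞) ≤ μ (userCell ((t.1 : ℤ), (t.2 : ℤ)))) n (0, 0)} with hE
  -- The two exceptional events have total probability at most one half. Only monotonicity and
  -- subadditivity are used, so `E` need not be measurable.
  have hQE : Q E ≠ 0 := by
    intro h0
    have h1 : Q {μ | ¬ (LocFin μ ∧ ∀ᵐ i ∂μ, ‖i.2‖ = d)} = 0 := by
      have := (isMecke_poissonLaw ν lam).locFin.and (ae_norm_poissonLaw hν lam)
      exact this
    have h2 : (Set.univ : Set (Measure User)) ⊆ (E ∪ {μ | ¬ (LocFin μ ∧ ∀ᵐ i ∂μ, ‖i.2‖ = d)}) ∪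
        ({μ | μ A < N} ∪ {μ | ∃ n, ¬ Block.Good (fun t : ℕ × ℕ =>
          (N : ℝ≥0∞) ≤ μ (userCell ((t.1 : ℤ), (t.2 : ℤ)))) n (0, 0)}) := by
      intro μ _
      by_cases a1 : LocFin μ ∧ ∀ᵐ i ∂μ, ‖i.2‖ = d
      · by_cases a2 : μ A < N
        · exact Or.inr (Or.inl a2)
        · by_cases a3 : ∃ n, ¬ Block.Good (fun t : ℕ × ℕ =>
            (N : ℝ≥0∞) ≤ μ (userCell ((t.1 : ℤ), (t.2 : ℤ)))) n (0, 0)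
          · exact Or.inr (Or.inr a3)
          · push Not at a3
            exact Or.inl (Or.inl ⟨a1, not_lt.1 a2, a3⟩)
      · exact Or.inl (Or.inr a1)
    have h3 := (measure_mono (μ := Q) h2).trans ((measure_union_le _ _).trans
      (add_le_add (measure_union_le _ _) (measure_union_le _ _)))
    rw [h0, h1, measure_univ, zero_add, zero_add] at h3
    have h4 := h3.trans (add_le_add hb1 hb2)
    have h5 : (4⁻¹ + 4⁻¹ : ℝ≥0∞) < 1 := by
      rw [show (4⁻¹ : ℝ≥0∞) = ENNReal.ofReal (4⁻¹) by
        rw [ENNReal.ofReal_inv_of_pos (by norm_num)]; simp,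
        ← ENNReal.ofReal_add (by norm_num) (by norm_num), ENNReal.ofReal_lt_one]
      norm_num
    exact absurd h4 (not_le.2 h5)
  -- on the event, an update in `X` percolates
  have hstep : ∀ x ∈ X, ‖x.2‖ = d → E ⊆ {μ | pts (μ + Measure.dirac x)
      (c.reach (pts (μ + Measure.dirac x)) x) = ∞} := by
    rintro x hxX hxd μ ⟨⟨hloc, hnorm⟩, hNA, hgood⟩
    set μ' := μ + Measure.dirac x with hμ'
    have hloc' : LocFin μ' := hloc.add (locFin_of_finite _)
    have hle : μ ≤ μ' := Measure.le_add_right le_rfl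
    have hnorm' : ∀ᵐ i ∂μ', ‖i.2‖ = d := by
      rw [hμ', ae_add_measure_iff]
      exact ⟨hnorm, (ae_dirac_iff (measurableSet_norm_eq d)).2 hxd⟩
    change pts μ' (c.reach (pts μ') x) = ∞
    rw [pts_of_locFin hloc']
    have hx1 : 1 ≤ μ' {x} := by simp [hμ']
    have h0 : Ignited c d δ' μ' x (0, 0) :=
      ignited_zero hM (min_le_left _ _) (min_le_right _ _) hg hN hnorm' hAm (hAX x hxX)
        (fun i hi => by
          have : dist i.1 0 < ρ := hi.1
          rw [dist_zero_right] at this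
          exact this.le.trans (min_le_right _ _))
        (hNA.trans (hle A)) hx1
    -- Good tiles are those of `μ`, without the planted user, so the event `E` does not depend on
    -- `x`.
    have hinf := Block.infinite_of_good (I := fun t => Ignited c d δ' μ' x t)
      (G := fun t : ℕ × ℕ => (N : ℝ≥0∞) ≤ μ (userCell ((t.1 : ℤ), (t.2 : ℤ))))
      (fun t t' ht hG hadj => ignited_of_adj hM (min_le_left _ _) (min_le_right _ _) hg hN hnorm'
        ht (hG.trans (hle _)) hadj) hgood h0
    exact reach_eq_top hδ'0 hN1 hnorm' (hinf.mono fun t ht => ⟨ht.1, ht.2.trans (hle _)⟩)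
  -- By the zero-one law it is enough to exclude probability zero, and the expected number of
  -- percolating users is at least `Q E` times the intensity of `X`.
  refine (c.poissonLaw_percolating_zero_or_one ν lam).resolve_left fun hzero => ?_
  rw [poissonLaw_percolating_eq_zero_iff, lintegral_reach_eq_top] at hzero
  have hmX : userIntensity ν lam X ≠ 0 := by
    rw [hX, userIntensity_prod]
    have : 0 < (volume : Measure Plane) (Metric.ball w₀ ρ) := Metric.measure_ball_pos _ _ hρ0
    exact mul_ne_zero (by exact_mod_cast hlam0) (mul_ne_zero this.ne' (by simp))
  have hlow : Q E * userIntensity ν lam X ≤ ∫⁻ x, Q {μ | pts (μ + Measure.dirac x)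
        (c.reach (pts (μ + Measure.dirac x)) x) = ∞} ∂(userIntensity ν lam) := by
    rw [← setLIntegral_const]
    refine le_trans (lintegral_mono_ae ?_) (setLIntegral_le_lintegral X _)
    rw [ae_restrict_iff' hXm]
    filter_upwards [ae_norm_userIntensity hν lam] with x hxd hxX
    exact measure_mono (hstep x hxX hxd)
  rw [hzero] at hlow
  exact mul_ne_zero hQE hmX (le_zero_iff.1 hlow)

end PowerControl

/-! ### Truncated influence of a user. -/

/-- A random set depending on the random measure almost surely does not carry a mass strictly
between zero and one. -/
lemma IsMecke.ae_not_pos_lt_one {m : Measure User} {Q : Measure (Measure User)} (h : IsMecke m Q)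
    {B : Set (User × Measure User)} (hB : MeasurableSet B) :
    ∀ᵐ μ ∂Q, ¬ (μ {x | (x, μ) ∈ B} ≠ 0 ∧ μ {x | (x, μ) ∈ B} < 1) := by
  have hBμ (μ : Measure User) : MeasurableSet {x | (x, μ) ∈ B} :=
    (by fun_prop : Measurable fun x : User => (x, μ)) hB
  have hcount : Measurable fun μ : Measure User => pts μ {x | (x, μ) ∈ B} := by
    have h1 : (fun μ : Measure User => pts μ {x | (x, μ) ∈ B}) = fun μ =>
        ∫⁻ x, B.indicator 1 (x, μ) ∂(pts μ) := by
      ext μ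
      exact (lintegral_indicator_one (hBμ μ)).symm
    rw [h1]
    exact measurable_lintegral_pts_self (F := fun x μ => B.indicator 1 (x, μ))
      (measurable_one.indicator hB)
  have hS : MeasurableSet {μ : Measure User | pts μ {x | (x, μ) ∈ B} < 1} :=
    measurableSet_lt hcount measurable_const
  -- After a point `x` with `(x, μ + δ_x) ∈ B` is added, the set has mass at least one. So the right
  -- side vanishes, and configurations with mass below one almost surely have mass zero.
  have key := h.mecke (fun x μ => B.indicator 1 (x, μ) *
      {μ : Measure User | pts μ {x | (x, μ) ∈ B} < 1}.indicator 1 μ)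
    ((measurable_one.indicator hB).mul ((measurable_one.indicator hS).comp measurable_snd))
  have hr : ∫⁻ x, ∫⁻ μ, B.indicator (1 : User × Measure User → ℝ≥0∞) (x, μ + Measure.dirac x) *
      {μ : Measure User | pts μ {x | (x, μ) ∈ B} < 1}.indicator 1 (μ + Measure.dirac x) ∂Q ∂m = 0 := by
    rw [lintegral_congr (g := fun _ => 0), lintegral_zero]
    intro x
    rw [lintegral_congr_ae (g := fun _ => 0), lintegral_zero]
    filter_upwards [h.locFin] with μ hμ
    by_cases hx : (x, μ + Measure.dirac x) ∈ B
    · have : μ + Measure.dirac x ∉ {μ : Measure User | pts μ {x | (x, μ) ∈ B} < 1} := by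
        simp only [Set.mem_ofPred_eq, not_lt]
        rw [pts_of_locFin (hμ.add (locFin_of_finite _))]
        refine le_trans ?_ (Measure.le_add_left le_rfl _ : Measure.dirac x _ ≤ _)
        rw [Measure.dirac_apply' _ (hBμ _)]
        simp [hx]
      simp [Set.indicator_of_notMem this]
    · simp [hx]
  rw [hr, lintegral_eq_zero_iff] at key
  · filter_upwards [key, h.locFin] with μ hμ hloc
    rintro ⟨h1, h2⟩
    have h3 : μ ∈ {μ : Measure User | pts μ {x | (x, μ) ∈ B} < 1} := by
      simpa only [Set.mem_ofPred_eq, pts_of_locFin hloc] using h2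
    simp only [Set.indicator_of_mem h3, Pi.one_apply, mul_one, Pi.zero_apply] at hμ
    refine h1 ?_
    have h4 : pts μ {x | (x, μ) ∈ B} = 0 := (lintegral_indicator_one (hBμ μ)).symm.trans hμ
    rwa [pts_of_locFin hloc] at h4
  · exact measurable_lintegral_pts_self (F := fun x μ => B.indicator 1 (x, μ) *
      {μ : Measure User | pts μ {x | (x, μ) ∈ B} < 1}.indicator 1 μ)
      ((measurable_one.indicator hB).mul ((measurable_one.indicator hS).comp measurable_snd))

/-- Truncation of an integral against a measure without small atoms. -/
lemma one_le_lintegral_min {μ : Measure User} {f : User → ℝ≥0∞} (hf : Measurable f)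
    (h : μ {j | 1 ≤ f j} ≠ 0 → 1 ≤ μ {j | 1 ≤ f j}) (h1 : 1 ≤ ∫⁻ j, f j ∂μ) :
    1 ≤ ∫⁻ j, min 1 (f j) ∂μ := by
  by_cases h0 : μ {j | 1 ≤ f j} = 0
  · refine h1.trans (lintegral_mono_ae ?_)
    have : ∀ᵐ j ∂μ, ¬ 1 ≤ f j := by rw [ae_iff]; simpa using h0
    filter_upwards [this] with j hj
    exact le_min (not_le.1 hj).le le_rfl
  · have hm : MeasurableSet {j | 1 ≤ f j} := measurableSet_le measurable_const hf
    calc (1 : ℝ≥0∞) ≤ μ {j | 1 ≤ f j} := h h0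
      _ = ∫⁻ j in {j | 1 ≤ f j}, 1 ∂μ := by simp
      _ = ∫⁻ j in {j | 1 ≤ f j}, min 1 (f j) ∂μ :=
        setLIntegral_congr_fun hm fun j hj => (min_eq_left hj).symm
      _ ≤ _ := setLIntegral_le_lintegral _ _

namespace PowerControl

variable (c : PowerControl)

/-- An upper bound for all power increases. -/
noncomputable def powerBound : ℝ≥0∞ := max c.maxIncrease c.update

/-- A bound for the influence of a change of the power of `j` on user `i`. -/
noncomputable def influence (j i : User) : ℝ≥0∞ :=
  min 1 (c.powerBound / c.threshold * c.gain j i)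

lemma measurable_influence : Measurable (Function.uncurry c.influence) :=
  measurable_const.min (c.measurable_gain.const_mul _)

lemma power_le_bound (μ : Measure User) (x : User) (n : ℕ) (i : User) :
    c.power μ x n i ≤ c.powerBound := by
  cases n with
  | zero =>
    simp only [power]
    split_ifs
    · exact le_max_right _ _
    · exact zero_le
  | succ n =>
    simp only [power, realize]
    split_ifs
    · exact le_max_right _ _
    · exact (min_le_right _ _).trans (le_max_left _ _)
    · exact zero_le

open Classical in
lemma required_add_dirac (μ : Measure User) (q : User → ℝ≥0∞) (i j : User) :
    c.required (μ + Measure.dirac i) q j =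
      c.required μ q j + if i = j then 0 else c.gain i j * q i := by
  rw [required, lintegral_add_measure, lintegral_dirac]
  rfl

/-- A user does not influence the propagation of change before it is reached. -/
lemma power_add_dirac (μ : Measure User) (x i : User) (n : ℕ) (h : c.power μ x n i = 0) :
    c.power (μ + Measure.dirac i) x n = c.power μ x n := by
  induction n with
  | zero => ext j; simp [power]
  | succ n ih =>
    have h0 : c.power μ x n i = 0 := le_zero_iff.1 (h ▸ power_le_succ μ x n i)
    ext j
    simp only [power, ih h0, required_add_dirac, h0, mul_zero, ite_self, add_zero]

/-- Whether `i` is reached does not depend on `i` being in the network. This removes the planted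
user after the Mecke equation has been applied. -/
lemma power_ne_zero_of_add_dirac {μ : Measure User} {x i : User} {n : ℕ}
    (h : c.power (μ + Measure.dirac i) x n i ≠ 0) : c.power μ x n i ≠ 0 :=
  fun h0 => h (by rw [c.power_add_dirac μ x i n h0, h0])

/-- The users that have been reached by round `n`. -/
def reachBy (μ : Measure User) (x : User) (n : ℕ) : Set User := {i | i ≠ x ∧ c.power μ x n i ≠ 0}

lemma measurableSet_reachBy_aux {α : Type*} [MeasurableSpace α] {f : α → Measure User}
    {g h : α → User} (hf : Measurable f) (hg : Measurable g) (hh : Measurable h) (n : ℕ) :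
    MeasurableSet {a | h a ∈ c.reachBy (pts (f a)) (g a) n} :=
  (measurableSet_eq_fun hh hg).compl.inter
    ((c.measurable_power hf hg hh n) (measurableSet_singleton 0)).compl

/-- A user that is reached has a large total influence from the users reached before. -/
lemma one_le_lintegral_of_mem_reachBy (hδ : 0 < c.threshold) {μ : Measure User} {x i : User}
    {n : ℕ} (hi : i ∈ c.reachBy μ x (n + 1)) :
    1 ≤ ∫⁻ j, {j | j ≠ i ∧ c.power μ x n j ≠ 0}.indicator
      (fun j => c.powerBound / c.threshold * c.gain j i) j ∂μ := by
  have h1 : (c.threshold : ℝ≥0∞) < c.required μ (c.power μ x n) i := by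
    by_contra h
    refine hi.2 ?_
    rw [power_succ_of_ne hi.1, realize, if_neg h]
  have hδ' : (c.threshold : ℝ≥0∞) ≠ 0 := by exact_mod_cast hδ.ne'
  have h2 : c.required μ (c.power μ x n) i ≤ c.threshold *
      ∫⁻ j, {j | j ≠ i ∧ c.power μ x n j ≠ 0}.indicator
      (fun j => c.powerBound / c.threshold * c.gain j i) j ∂μ := by
    rw [← lintegral_const_mul' _ _ ENNReal.coe_ne_top, required]
    refine lintegral_mono fun j => ?_
    dsimp only
    split_ifs with hj
    · exact zero_le
    · by_cases h0 : c.power μ x n j = 0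
      · simp [h0]
      · have : j ∈ {j | j ≠ i ∧ c.power μ x n j ≠ 0} := ⟨hj, h0⟩
        rw [Set.indicator_of_mem this, ← mul_assoc, ENNReal.mul_div_cancel hδ' ENNReal.coe_ne_top,
          mul_comm]
        exact mul_le_mul_left (c.power_le_bound _ _ _ _) _
  have h3 := h1.le.trans h2
  rwa [← ENNReal.div_le_iff' hδ' ENNReal.coe_ne_top, ENNReal.div_self hδ' ENNReal.coe_ne_top] at h3

end PowerControl

/-! ### Integrability of the influence. -/

namespace PowerControl

variable (c : PowerControl)

/-- The total influence of a user of the network of density one. -/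
noncomputable def totalInfluence (d : ℝ) : ℝ≥0∞ :=
  ∫⁻ u : Plane, min 1 (c.powerBound / c.threshold * (c.sinr * c.pathLoss ‖u‖ / c.pathLoss d))

/-- For a fixed displacement of the affected user, the influence is a function of its transmitter
translated by a constant, so the integral depends neither on `j` nor on the displacement. -/
lemma lintegral_influence {ν : Measure Plane} [IsProbabilityMeasure ν] {d : ℝ}
    (hν : ∀ᵐ w ∂ν, ‖w‖ = d) (lam : ℝ≥0) (j : User) :
    ∫⁻ i, c.influence j i ∂(userIntensity ν lam) = lam * c.totalInfluence d := by
  have hm : Measurable fun i => c.influence j i :=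
    c.measurable_influence.uncurry_apply measurable_const measurable_id
  rw [userIntensity, lintegral_smul_measure, lintegral_prod_symm' _ hm,
    lintegral_congr_ae (g := fun _ => c.totalInfluence d)]
  · simp [ENNReal.smul_def]
  · filter_upwards [hν] with w hw
    set g : Plane → ℝ≥0∞ := fun u => min 1 (c.powerBound / c.threshold *
        (c.sinr * c.pathLoss ‖u‖ / c.pathLoss d)) with hg
    have h1 (t : Plane) : c.influence j (t, w) = g (t - (j.1 - w)) := by
      simp only [hg, influence, gain, User.tx, User.rx, dist_eq_norm]
      rw [norm_sub_rev j.1, sub_add_cancel_left, norm_neg, hw, sub_sub_eq_add_sub]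
    rw [lintegral_congr h1]
    exact lintegral_sub_right_eq_self g (j.1 - w)

lemma pathLoss_eq_ofReal {s : ℝ} (hs : 0 < s) : c.pathLoss s = ENNReal.ofReal (s ^ (-c.exponent)) := by
  rw [pathLoss, ENNReal.ofReal_rpow_of_pos hs, ← ENNReal.ofReal_inv_of_pos (by positivity),
    Real.rpow_neg hs.le]

/-- The truncation removes the singularity of the path loss at the transmitter, and `α > 2` makes
the decay integrable in the plane. Both regimes are dominated by a multiple of `(1 + ‖u‖) ^ (-α)`;
`M < ∞` makes the factor `D` finite. -/
lemma totalInfluence_ne_top {d : ℝ} (hd : 0 < d) (hα : 2 < c.exponent) (hδ : 0 < c.threshold)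
    (hM : c.maxIncrease ≠ ∞) : c.totalInfluence d ≠ ∞ := by
  obtain ⟨D, hD⟩ : ∃ D : ℝ≥0, (c.powerBound / c.threshold * (c.sinr / c.pathLoss d) : ℝ≥0∞) = D := by
    have h1 : c.powerBound ≠ ∞ := by simp [powerBound, hM]
    have h2 : (c.threshold : ℝ≥0∞) ≠ 0 := by exact_mod_cast hδ.ne'
    have h3 : c.pathLoss d ≠ 0 := by
      rw [c.pathLoss_eq_ofReal hd]
      exact (ENNReal.ofReal_pos.2 (by positivity)).ne'
    exact ⟨_, (ENNReal.coe_toNNReal (ENNReal.mul_ne_top (ENNReal.div_ne_top h1 h2)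
      (ENNReal.div_ne_top ENNReal.coe_ne_top h3))).symm⟩
  have hle (u : Plane) : min 1 (c.powerBound / c.threshold *
      (c.sinr * c.pathLoss ‖u‖ / c.pathLoss d)) ≤
      ENNReal.ofReal (2 ^ c.exponent * (1 + D)) * ENNReal.ofReal ((1 + ‖u‖) ^ (-c.exponent)) := by
    rw [← ENNReal.ofReal_mul (by positivity)]
    have h0 : 0 < 1 + ‖u‖ := by positivity
    rcases le_or_gt ‖u‖ 1 with h | h
    · refine (min_le_left _ _).trans ?_
      rw [ENNReal.one_le_ofReal, Real.rpow_neg h0.le, ← div_eq_mul_inv, one_le_div (by positivity)]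
      have h1 : (1 + ‖u‖) ^ c.exponent ≤ 2 ^ c.exponent :=
        Real.rpow_le_rpow h0.le (by linarith) (by linarith)
      have h2 : (0 : ℝ) ≤ 2 ^ c.exponent * D := by positivity
      linarith
    · refine (min_le_right _ _).trans ?_
      have h1 : c.powerBound / c.threshold * (c.sinr * c.pathLoss ‖u‖ / c.pathLoss d) =
          D * c.pathLoss ‖u‖ := by
        rw [← hD]; simp only [div_eq_mul_inv]; ring
      rw [h1, c.pathLoss_eq_ofReal (by linarith), ← ENNReal.ofReal_coe_nnreal,
        ← ENNReal.ofReal_mul (by positivity)]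
      refine ENNReal.ofReal_le_ofReal ?_
      have h2 : ‖u‖ ^ (-c.exponent) ≤ 2 ^ c.exponent * (1 + ‖u‖) ^ (-c.exponent) := by
        have h3 : (1 + ‖u‖) ^ c.exponent ≤ (2 * ‖u‖) ^ c.exponent :=
          Real.rpow_le_rpow h0.le (by linarith) (by linarith)
        rw [Real.mul_rpow (by norm_num) (by positivity)] at h3
        have h5 : 0 < ‖u‖ := by linarith
        rw [Real.rpow_neg h0.le, Real.rpow_neg (by positivity), ← div_eq_mul_inv,
          inv_eq_one_div, div_le_div_iff₀ (by positivity) (by positivity), one_mul]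
        exact h3
      have h4 : (0 : ℝ) ≤ 2 ^ c.exponent * (1 + ‖u‖) ^ (-c.exponent) := by positivity
      calc (D : ℝ) * ‖u‖ ^ (-c.exponent) ≤ D * (2 ^ c.exponent * (1 + ‖u‖) ^ (-c.exponent)) := by
            gcongr
        _ ≤ 2 ^ c.exponent * (1 + D) * (1 + ‖u‖) ^ (-c.exponent) := by linarith
  refine ne_top_of_le_ne_top ?_ (lintegral_mono hle)
  rw [lintegral_const_mul' _ _ ENNReal.ofReal_ne_top]
  exact ENNReal.mul_ne_top ENNReal.ofReal_ne_top
    (finite_integral_one_add_norm (by simpa using hα)).ne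

end PowerControl

lemma userIntensity_singleton (ν : Measure Plane) [IsProbabilityMeasure ν] (lam : ℝ≥0) (x : User) :
    userIntensity ν lam {x} = 0 := by
  rw [show ({x} : Set User) = {x.1} ×ˢ {x.2} by simp, userIntensity_prod]
  simp

/-- The integral of a function over a random set that depends on the random measure can be
truncated. -/
lemma IsMecke.ae_one_le_lintegral_min {m : Measure User} {Q : Measure (Measure User)}
    [IsProbabilityMeasure Q] (h : IsMecke m Q) {x : User} (hx : m {x} = 0)
    {T : Set (User × Measure User)} (hT : MeasurableSet T) {g : User → ℝ≥0∞} (hg : Measurable g) :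
    ∀ᵐ μ ∂Q, 1 ≤ ∫⁻ j, {j | (j, μ) ∈ T}.indicator g j ∂(μ + Measure.dirac x) →
      1 ≤ min 1 (g x) + ∫⁻ j, ({j | (j, μ) ∈ T} \ {x}).indicator (fun j => min 1 (g j)) j ∂μ := by
  have hfm : Measurable (T.indicator fun q => g q.1) := (hg.comp measurable_fst).indicator hT
  have hB : MeasurableSet {q : User × Measure User | 1 ≤ T.indicator (fun q => g q.1) q} :=
    measurableSet_le measurable_const hfm
  have hatom : ∀ᵐ μ ∂Q, μ {x} = 0 := by
    have h0 := h.lintegral_apply (measurableSet_singleton x)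
    rwa [hx, lintegral_eq_zero_iff (Measure.measurable_coe (measurableSet_singleton x))] at h0
  filter_upwards [h.ae_not_pos_lt_one hB, hatom] with μ hμ hx h1
  set f : User → ℝ≥0∞ := {j | (j, μ) ∈ T}.indicator g with hf
  have hfμ : Measurable f := hfm.comp (by fun_prop : Measurable fun j : User => (j, μ))
  have hfx : MeasurableSet {j | 1 ≤ f j} := measurableSet_le measurable_const hfμ
  have h2 : 1 ≤ ∫⁻ j, min 1 (f j) ∂(μ + Measure.dirac x) := by
    -- The set where `f` is at least one depends on `μ`. If it contains `x`, the point mass there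
    -- suffices; otherwise `IsMecke.ae_not_pos_lt_one` excludes a mass strictly between zero and
    -- one.
    refine one_le_lintegral_min hfμ (fun h0 => ?_) h1
    rw [Measure.add_apply] at h0 ⊢
    by_cases hxf : x ∈ {j | 1 ≤ f j}
    · rw [Measure.dirac_apply_of_mem hxf]
      exact le_add_self
    · rw [Measure.dirac_apply' _ hfx, Set.indicator_of_notMem hxf, add_zero] at h0 ⊢
      by_contra hlt
      exact hμ ⟨h0, not_le.1 hlt⟩
  rw [lintegral_add_measure, lintegral_dirac, add_comm] at h2
  refine h2.trans (add_le_add (min_le_min_left _ (Set.indicator_le_self _ _ _)) ?_)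
  have hne : ∀ᵐ j ∂μ, j ≠ x := by rw [ae_iff]; simpa using hx
  refine lintegral_mono_ae ?_
  filter_upwards [hne] with j hj
  by_cases h : j ∈ {j | (j, μ) ∈ T}
  · rw [Set.indicator_of_mem (show j ∈ {j | (j, μ) ∈ T} \ {x} from ⟨h, hj⟩)]
    exact min_le_min_left _ (Set.indicator_le_self _ _ _)
  · rw [hf, Set.indicator_of_notMem h]
    simp

/-! ### Finite propagation at low density. -/

namespace PowerControl

variable (c : PowerControl) (ν : Measure Plane) [IsProbabilityMeasure ν] (lam : ℝ≥0)

lemma measurableSet_ne_power_ne_zero (x i : User) (n : ℕ) :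
    MeasurableSet {q : User × Measure User |
      q.1 ≠ i ∧ c.power (pts (q.2 + Measure.dirac x)) x n q.1 ≠ 0} :=
  (measurableSet_eq_fun measurable_fst measurable_const).compl.inter
    ((c.measurable_power (f := fun q : User × Measure User => q.2 + Measure.dirac x)
      (g := fun _ => x) (h := fun q => q.1) (by fun_prop) measurable_const measurable_fst n)
      (measurableSet_singleton 0)).compl

/-- A user that is reached has a total truncated influence of at least one from the users reached
before. -/
lemma ae_one_le_influence (hδ : 0 < c.threshold) (x i : User) (n : ℕ) :
    ∀ᵐ μ ∂(poissonLaw ν lam), i ∈ c.reachBy (pts (μ + Measure.dirac x)) x (n + 1) →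
      1 ≤ c.influence x i +
        ∫⁻ j, (c.reachBy (pts (μ + Measure.dirac x)) x n).indicator
          (fun j => c.influence j i) j ∂(pts μ) := by
  have hg : Measurable fun j => c.powerBound / c.threshold * c.gain j i :=
    (c.measurable_gain.uncurry_apply measurable_id measurable_const).const_mul _
  filter_upwards [(isMecke_poissonLaw ν lam).ae_one_le_lintegral_min
    (userIntensity_singleton ν lam x) (c.measurableSet_ne_power_ne_zero x i n) hg,
    (isMecke_poissonLaw ν lam).locFin] with μ hμ hloc hi
  have h1 := c.one_le_lintegral_of_mem_reachBy hδ hi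
  have hpts := pts_of_locFin (hloc.add (locFin_of_finite (Measure.dirac x)))
  have h2 : 1 ≤ ∫⁻ j, {j | j ≠ i ∧ c.power (pts (μ + Measure.dirac x)) x n j ≠ 0}.indicator
      (fun j => c.powerBound / c.threshold * c.gain j i) j ∂(μ + Measure.dirac x) := by
    rw [hpts] at h1 ⊢
    exact h1
  refine (hμ h2).trans (add_le_add le_rfl ?_)
  rw [pts_of_locFin hloc]
  refine lintegral_mono fun j => Set.indicator_le_indicator_of_subset ?_ (fun _ => zero_le) j
  exact fun k hk => ⟨hk.2, hk.1.2⟩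

variable {ν}

/-- A first moment bound as for a branching process: `x` and each user reached by round `n` account
for at most `λ I` expected users reached by round `n + 1`, where `I` is the total influence. -/
lemma lintegral_reachBy_succ_le (hδ : 0 < c.threshold) {d : ℝ} (hν : ∀ᵐ w ∂ν, ‖w‖ = d)
    (x : User) (n : ℕ) :
    ∫⁻ μ, pts μ (c.reachBy (pts (μ + Measure.dirac x)) x (n + 1)) ∂(poissonLaw ν lam) ≤
      lam * c.totalInfluence d * (1 +
        ∫⁻ μ, pts μ (c.reachBy (pts (μ + Measure.dirac x)) x n) ∂(poissonLaw ν lam)) := by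
  set Q := poissonLaw ν lam with hQ
  set m := userIntensity ν lam with hm
  have hset (k : ℕ) : MeasurableSet {q : User × Measure User |
      q.1 ∈ c.reachBy (pts (q.2 + Measure.dirac x)) x k} :=
    c.measurableSet_reachBy_aux (f := fun q : User × Measure User => q.2 + Measure.dirac x)
      (g := fun _ => x) (h := fun q => q.1) (by fun_prop) measurable_const measurable_fst k
  have hsetμ (k : ℕ) (μ : Measure User) :
      MeasurableSet (c.reachBy (pts (μ + Measure.dirac x)) x k) :=
    (by fun_prop : Measurable fun i : User => (i, μ)) (hset k)
  have hseti (k : ℕ) (i : User) :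
      MeasurableSet {μ : Measure User | i ∈ c.reachBy (pts (μ + Measure.dirac x)) x k} :=
    (by fun_prop : Measurable fun μ : Measure User => (i, μ)) (hset k)
  -- the integrand after the exchange of sums
  set J : User → Measure User → User → ℝ≥0∞ := fun i μ =>
    (c.reachBy (pts (μ + Measure.dirac x)) x n).indicator (fun j => c.influence j i) with hJ
  have hJm : Measurable fun q : (User × Measure User) × User => J q.1.1 q.1.2 q.2 :=
    (c.measurable_influence.uncurry_apply (by fun_prop : Measurable
      fun q : (User × Measure User) × User => q.2) (by fun_prop)).indicator
      ((by fun_prop : Measurable fun q : (User × Measure User) × User => (q.2, q.1.2)) (hset n))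
  have hJint : Measurable fun q : User × Measure User => ∫⁻ j, J q.1 q.2 j ∂(pts q.2) :=
    measurable_lintegral_pts measurable_snd (F := fun (q : User × Measure User) j => J q.1 q.2 j)
      hJm
  have hmecke : ∫⁻ μ, pts μ (c.reachBy (pts (μ + Measure.dirac x)) x (n + 1)) ∂Q =
      ∫⁻ i, Q {μ | i ∈ c.reachBy (pts (μ + Measure.dirac i + Measure.dirac x)) x (n + 1)} ∂m := by
    have h := (isMecke_poissonLaw ν lam).mecke (fun i μ => {q : User × Measure User |
      q.1 ∈ c.reachBy (pts (q.2 + Measure.dirac x)) x (n + 1)}.indicator 1 (i, μ))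
      (measurable_one.indicator (hset (n + 1)))
    have e1 (μ : Measure User) : ∫⁻ i, {q : User × Measure User |
        q.1 ∈ c.reachBy (pts (q.2 + Measure.dirac x)) x (n + 1)}.indicator
          (1 : User × Measure User → ℝ≥0∞) (i, μ) ∂(pts μ) =
        pts μ (c.reachBy (pts (μ + Measure.dirac x)) x (n + 1)) :=
      lintegral_indicator_one (hsetμ (n + 1) μ)
    have e2 (i : User) : ∫⁻ μ, {q : User × Measure User |
        q.1 ∈ c.reachBy (pts (q.2 + Measure.dirac x)) x (n + 1)}.indicator
          (1 : User × Measure User → ℝ≥0∞) (i, μ + Measure.dirac i) ∂Q =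
        Q {μ | i ∈ c.reachBy (pts (μ + Measure.dirac i + Measure.dirac x)) x (n + 1)} :=
      lintegral_indicator_one
        ((by fun_prop : Measurable fun μ : Measure User => μ + Measure.dirac i)
          (hseti (n + 1) i))
    simp_rw [e1] at h
    rw [h]
    exact lintegral_congr e2
  have hstep (i : User) :
      Q {μ | i ∈ c.reachBy (pts (μ + Measure.dirac i + Measure.dirac x)) x (n + 1)} ≤
      ∫⁻ μ, (c.influence x i + ∫⁻ j, J i μ j ∂(pts μ)) ∂Q := by
    calc Q {μ | i ∈ c.reachBy (pts (μ + Measure.dirac i + Measure.dirac x)) x (n + 1)}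
        ≤ Q {μ | i ∈ c.reachBy (pts (μ + Measure.dirac x)) x (n + 1)} := by
          refine measure_mono_ae ?_
          filter_upwards [(isMecke_poissonLaw ν lam).locFin] with μ hloc hi
          have hl := hloc.add (locFin_of_finite (Measure.dirac x))
          change i ∈ c.reachBy (pts (μ + Measure.dirac x)) x (n + 1)
          have hi' : i ∈ c.reachBy (pts (μ + Measure.dirac i + Measure.dirac x)) x (n + 1) := hi
          rw [add_right_comm, pts_of_locFin (hl.add (locFin_of_finite (Measure.dirac i)))] at hi'
          rw [pts_of_locFin hl]
          -- Discarding the planted `i` makes the reached set independent of `i`, which allows the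
          -- integration over `i` below.
          exact ⟨hi'.1, c.power_ne_zero_of_add_dirac hi'.2⟩
      _ = ∫⁻ μ, {μ | i ∈ c.reachBy (pts (μ + Measure.dirac x)) x (n + 1)}.indicator 1 μ ∂Q :=
          (lintegral_indicator_one (hseti (n + 1) i)).symm
      _ ≤ _ := by
          refine lintegral_mono_ae ?_
          filter_upwards [c.ae_one_le_influence ν lam hδ x i n] with μ hμ
          by_cases hi : μ ∈ {μ : Measure User | i ∈ c.reachBy (pts (μ + Measure.dirac x)) x (n + 1)}
          · rw [Set.indicator_of_mem hi]
            exact hμ hi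
          · rw [Set.indicator_of_notMem hi]
            exact zero_le
  have hswap : ∫⁻ i, ∫⁻ μ, ∫⁻ j, J i μ j ∂(pts μ) ∂Q ∂m =
      lam * c.totalInfluence d *
        ∫⁻ μ, pts μ (c.reachBy (pts (μ + Measure.dirac x)) x n) ∂Q := by
    -- Integrating over `i` first turns every reached user `j` into the constant `λ I`.
    rw [lintegral_lintegral_swap hJint.aemeasurable]
    have e (μ : Measure User) : ∫⁻ i, ∫⁻ j, J i μ j ∂(pts μ) ∂m =
        lam * c.totalInfluence d * pts μ (c.reachBy (pts (μ + Measure.dirac x)) x n) := by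
      rw [lintegral_lintegral_swap (f := fun i j => J i μ j) (hJm.comp
        (by fun_prop : Measurable fun q : User × User => ((q.1, μ), q.2))).aemeasurable]
      have e' (j : User) : ∫⁻ i, J i μ j ∂m =
          (c.reachBy (pts (μ + Measure.dirac x)) x n).indicator
            (fun _ => lam * c.totalInfluence d) j := by
        by_cases hj : j ∈ c.reachBy (pts (μ + Measure.dirac x)) x n
        · simp only [hJ, Set.indicator_of_mem hj]
          exact c.lintegral_influence hν lam j
        · simp only [hJ, Set.indicator_of_notMem hj, lintegral_zero]
      rw [lintegral_congr e', lintegral_indicator_const (hsetμ n μ)]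
    rw [lintegral_congr e, lintegral_const_mul]
    have h3 : (fun μ : Measure User => pts μ (c.reachBy (pts (μ + Measure.dirac x)) x n)) =
        fun μ => ∫⁻ i, {q : User × Measure User |
          q.1 ∈ c.reachBy (pts (q.2 + Measure.dirac x)) x n}.indicator 1 (i, μ) ∂(pts μ) := by
      ext μ
      exact (lintegral_indicator_one (hsetμ n μ)).symm
    rw [h3]
    exact measurable_lintegral_pts_self (F := fun i μ => {q : User × Measure User |
      q.1 ∈ c.reachBy (pts (q.2 + Measure.dirac x)) x n}.indicator 1 (i, μ))
      (measurable_one.indicator (hset n))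
  calc _ = _ := hmecke
    _ ≤ ∫⁻ i, ∫⁻ μ, (c.influence x i + ∫⁻ j, J i μ j ∂(pts μ)) ∂Q ∂m := lintegral_mono hstep
    _ = ∫⁻ i, (c.influence x i + ∫⁻ μ, ∫⁻ j, J i μ j ∂(pts μ) ∂Q) ∂m := by
        refine lintegral_congr fun i => ?_
        rw [lintegral_add_left measurable_const, lintegral_const, measure_univ, mul_one]
    _ = lam * c.totalInfluence d + ∫⁻ i, ∫⁻ μ, ∫⁻ j, J i μ j ∂(pts μ) ∂Q ∂m := by
        have hx : Measurable fun i => c.influence x i :=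
          c.measurable_influence.uncurry_apply measurable_const measurable_id
        rw [lintegral_add_left hx, c.lintegral_influence hν]
    _ = _ := by rw [hswap, mul_add, mul_one]

end PowerControl

namespace PowerControl

variable (c : PowerControl) {ν : Measure Plane} [IsProbabilityMeasure ν] {lam : ℝ≥0}

/-- One is the fixed point of `e ↦ (1 + e) / 2`, so the bound survives every round. -/
lemma lintegral_reachBy_le_one (hδ : 0 < c.threshold) {d : ℝ} (hν : ∀ᵐ w ∂ν, ‖w‖ = d)
    (hlam : lam * c.totalInfluence d ≤ 2⁻¹) (x : User) (n : ℕ) :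
    ∫⁻ μ, pts μ (c.reachBy (pts (μ + Measure.dirac x)) x n) ∂(poissonLaw ν lam) ≤ 1 := by
  induction n with
  | zero =>
    have (μ : Measure User) : c.reachBy μ x 0 = ∅ := by
      ext i
      simp only [reachBy, power, Set.mem_ofPred_eq, Set.mem_empty_iff_false, iff_false, not_and,
        not_not]
      exact fun h => if_neg h
    simp [this]
  | succ n ih =>
    calc _ ≤ _ := c.lintegral_reachBy_succ_le lam hδ hν x n
      _ ≤ 2⁻¹ * (1 + 1) := by gcongr
      _ = 1 := by rw [one_add_one_eq_two]; exact ENNReal.inv_mul_cancel (by simp) (by simp)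

lemma reach_eq_iUnion_reachBy (μ : Measure User) (x : User) :
    c.reach μ x = ⋃ n, c.reachBy μ x n := by
  ext i
  simp [reach, reachBy]

lemma monotone_reachBy (μ : Measure User) (x : User) : Monotone (c.reachBy μ x) :=
  fun _ _ h i hi => ⟨hi.1, fun h0 => hi.2 (le_zero_iff.1 (h0 ▸ monotone_power μ x h i))⟩

lemma lintegral_reach_le_one (hδ : 0 < c.threshold) {d : ℝ} (hν : ∀ᵐ w ∂ν, ‖w‖ = d)
    (hlam : lam * c.totalInfluence d ≤ 2⁻¹) (x : User) :
    ∫⁻ μ, pts μ (c.reach (pts (μ + Measure.dirac x)) x) ∂(poissonLaw ν lam) ≤ 1 := by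
  have hmeas (n : ℕ) : Measurable fun μ : Measure User =>
      pts μ (c.reachBy (pts (μ + Measure.dirac x)) x n) := by
    have hset : MeasurableSet {q : User × Measure User |
        q.1 ∈ c.reachBy (pts (q.2 + Measure.dirac x)) x n} :=
      c.measurableSet_reachBy_aux (f := fun q : User × Measure User => q.2 + Measure.dirac x)
        (g := fun _ => x) (h := fun q => q.1) (by fun_prop) measurable_const measurable_fst n
    have h3 : (fun μ : Measure User => pts μ (c.reachBy (pts (μ + Measure.dirac x)) x n)) =
        fun μ => ∫⁻ i, {q : User × Measure User |
          q.1 ∈ c.reachBy (pts (q.2 + Measure.dirac x)) x n}.indicator 1 (i, μ) ∂(pts μ) := by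
      ext μ
      exact (lintegral_indicator_one
        ((by fun_prop : Measurable fun i : User => (i, μ)) hset)).symm
    rw [h3]
    exact measurable_lintegral_pts_self (F := fun i μ => {q : User × Measure User |
      q.1 ∈ c.reachBy (pts (q.2 + Measure.dirac x)) x n}.indicator 1 (i, μ))
      (measurable_one.indicator hset)
  have h (μ : Measure User) : pts μ (c.reach (pts (μ + Measure.dirac x)) x) =
      ⨆ n, pts μ (c.reachBy (pts (μ + Measure.dirac x)) x n) := by
    rw [reach_eq_iUnion_reachBy]
    exact (c.monotone_reachBy _ x).measure_iUnion
  rw [lintegral_congr h, lintegral_iSup hmeas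
    fun i j hij μ => measure_mono (c.monotone_reachBy _ x hij)]
  exact iSup_le (c.lintegral_reachBy_le_one hδ hν hlam x)

/-- At low density, the propagation of change is finite. -/
theorem poissonLaw_percolating_eq_zero (hδ : 0 < c.threshold) {d : ℝ} (hν : ∀ᵐ w ∂ν, ‖w‖ = d)
    (hlam : lam * c.totalInfluence d ≤ 2⁻¹) : poissonLaw ν lam c.percolating = 0 := by
  rw [poissonLaw_percolating_eq_zero_iff, lintegral_reach_eq_top,
    lintegral_congr (g := fun _ => 0), lintegral_zero]
  intro x
  have hm : Measurable fun μ : Measure User => pts μ (c.reach (pts (μ + Measure.dirac x)) x) :=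
    c.measurable_reach (f := fun μ => μ) (f' := fun μ => μ + Measure.dirac x) (g := fun _ => x)
      measurable_id (by fun_prop) measurable_const
  have hlt := ae_lt_top hm
    (ne_top_of_le_ne_top ENNReal.one_ne_top (c.lintegral_reach_le_one hδ hν hlam x))
  have hae : ∀ᵐ μ ∂(poissonLaw ν lam), ¬ pts (μ + Measure.dirac x)
      (c.reach (pts (μ + Measure.dirac x)) x) = ∞ := by
    filter_upwards [hlt, (isMecke_poissonLaw ν lam).locFin] with μ hμ hloc
    rw [pts_of_locFin hloc] at hμ
    have hl := hloc.add (locFin_of_finite (Measure.dirac x))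
    rw [pts_of_locFin hl] at hμ ⊢
    rw [Measure.add_apply]
    exact ENNReal.add_ne_top.2 ⟨hμ.ne, measure_ne_top _ _⟩
  simpa [ae_iff] using hae

end PowerControl

theorem mainTheorem1 (c : PowerControl)
    (hα : 0 < c.exponent) (hβ : 0 < c.sinr) (hδ : 0 < c.threshold) (hΔ : 0 < c.update)
    (hM : (c.threshold : ℝ≥0∞) ≤ c.maxIncrease)
    (d : ℝ) (hd : 0 < d) (ν : Measure Plane) [IsProbabilityMeasure ν]
    (hν : ∀ᵐ w ∂ν, ‖w‖ = d) :
    ∃ lamc : ℝ≥0,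
      (2 < c.exponent → c.maxIncrease ≠ ∞ → 0 < lamc) ∧
      ∀ (Ω : Type*) [MeasurableSpace Ω] (P : Measure Ω) [IsProbabilityMeasure P]
        (Φ : Ω → Set User) (lam : ℝ≥0),
        IsPoissonPointProcess P (lam • (volume : Measure Plane).prod ν) Φ →
          (lam < lamc → ∀ᵐ ω ∂P, ∀ x ∈ Φ ω, (c.affected (Φ ω) x).Finite) ∧
          (lamc < lam → ∀ᵐ ω ∂P, ∃ x ∈ Φ ω, (c.affected (Φ ω) x).Infinite) := by
  have hne := c.exists_poissonLaw_percolating hα hβ hδ hΔ hM hd hν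
  -- The nonemptiness `hne` matters: without it the infimum in `ℝ≥0` would be the default value zero
  -- and the upper regime would fail.
  refine ⟨sInf {l | poissonLaw ν l c.percolating = 1}, fun hα2 hMt => ?_,
    fun Ω _ P _ Φ lam h => c.sInf_dichotomy ν hne P Φ lam h⟩
  have hκ := c.totalInfluence_ne_top hd hα2 hδ hMt
  -- Below this density the product with the total influence is at most one half; the added one
  -- avoids a division by zero.
  have hpos : 0 < 2⁻¹ / ((c.totalInfluence d).toNNReal + 1) := by positivity
  refine hpos.trans_le (le_csInf hne fun l hl => ?_)
  by_contra hlt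
  have hl' : (l : ℝ≥0∞) * c.totalInfluence d ≤ 2⁻¹ := by
    rw [← ENNReal.coe_toNNReal hκ, ← ENNReal.coe_mul, ← ENNReal.coe_ofNat,
      ← ENNReal.coe_inv two_ne_zero, ENNReal.coe_le_coe]
    calc l * (c.totalInfluence d).toNNReal
        ≤ 2⁻¹ / ((c.totalInfluence d).toNNReal + 1) * ((c.totalInfluence d).toNNReal + 1) := by
          gcongr
          · exact (not_le.1 hlt).le
          · exact le_self_add
      _ = 2⁻¹ := div_mul_cancel₀ _ (by positivity)
  have h1 : poissonLaw ν l c.percolating = 1 := hl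
  rw [c.poissonLaw_percolating_eq_zero hδ hν hl'] at h1
  exact zero_ne_one h1
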